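/- All graphs are finite, undirected and simple, with $n$ vertices and $m$ edges, given by a list of edges. For positive integer vertex weights $w$, a vertex cut of $G$ is a set $S$ of vertices such that $G-S$ is disconnected (has at least two components); $\kappa$ is the minimum weight of a vertex cut (we assume that one exists, i.e. $G$ is not complete), and $W$ is the total vertex weight. For an independent set $R$ with $|R|\ge 2$, an $R$-isolating vertex cut is given by a vertex set $A$ with $A\cap R=\{r\}$ for some $r$ and $N(A)\cap R=\emptyset$, and its weight is $w(N(A))$. Algorithms are programs for a randomized random access machine with logarithmic cost. They may call, as a black box, a (possibly randomized) subroutine that, given a graph with $m$ edges and $n$ vertices (with integer weights in $[1,U]$ in part (1), and unweighted in part (2)) and such an $R$, returns in time $T_{\mathrm{ivc}}(m,n)$ a side $A$ of a minimum-weight $R$-isolating vertex cut, correctly with probability at least $2/3$ in each call, independently of all earlier random choices. Assume $T_{\mathrm{ivc}}(m,n)\ge m+n$. "With high probability in time $\tilde O(f)$" means: for every constant $c$ there are an algorithm (independent of the graph, the weights, $U$, $T_{\mathrm{ivc}}$ and the subroutine) and constants $a, C$ such that on every instance, with probability at least $1-n^{-c}$, the algorithm halts within time $C f\cdot(1+\log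 (nU))^a$ with a correct output (with $U=1$ for unweighted graphs). (1) If $w:V\to\{1,\dots,U\}$ is integral, then a minimum-weight vertex cut can be computed with high probability in time $$\tilde O\Bigl(\kappa'\, T_{\mathrm{ivc}}(m,n)\,\min\bigl\{\kappa',\tfrac{W}{W-\kappa}\bigr\}\Bigr),\qquad \kappa'=\max\{\kappa,1\}.$$ (2) Suppose moreover that $T_{\mathrm{ivc}}(m,n)$ is nondecreasing in $m$ and $T_{\mathrm{ivc}}(2m,n)\le D\,T_{\mathrm{ivc}}(m,n)$ for all $m,n$ and a constant $D$. If $G$ is unweighted (all weights are $1$), then a minimum vertex cut can be computed with high probability in time $$\tilde O\Bigl(1+m+\kappa\, T_{\mathrm{ivc}}(n\kappa,n)\,\min\bigl\{\kappa,\tfrac{n}{n-\kappa}\bigr\}\Bigr),$$ where the constant $C$ may depend on $D$ (the algorithm and $a$ do not). -/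

import Mathlib

open scoped ENNReal

noncomputable section

namespace VertexCut

/-! ### Vertex cuts and isolating vertex cuts -/

section Graph

variable {n : ℕ} (G : SimpleGraph (Fin n)) (w : Fin n → ℕ)

/-- `es` lists every edge of the simple graph `G` exactly once, in any order and with any
orientation; in particular `es.length` is the number of edges of `G`. -/
def IsEdgeList (es : List (Fin n × Fin n)) : Prop :=
  (es.map fun e => s(e.1, e.2)).Nodup ∧
    ∀ e : Sym2 (Fin n), e ∈ es.map (fun e => s(e.1, e.2)) ↔ e ∈ G.edgeSet

/-- The total weight of a set of vertices. -/
def weight (S : Finset (Fin n)) : ℕ := ∑ v ∈ S, w v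

/-- `S` is a vertex cut: `G - S` has two vertices in different connected components. -/
def IsVertexCut (S : Finset (Fin n)) : Prop :=
  ¬ (G.induce {v | v ∉ S}).Preconnected

/-- `S` is a vertex cut of minimum weight. -/
def IsMinVertexCut (S : Finset (Fin n)) : Prop :=
  IsVertexCut G S ∧ ∀ S', IsVertexCut G S' → weight w S ≤ weight w S'

/-- `κ` is the (weighted) vertex connectivity of `G`, the minimum weight of a vertex cut.
If `G` is complete it has no vertex cut and no `κ : ℕ` qualifies. -/
def IsVertexConnectivity (κ : ℕ) : Prop :=
  IsLeast {c | ∃ S, IsVertexCut G S ∧ weight w S = c} κ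

open Classical in
/-- The open neighbourhood `N(A)`: the vertices outside `A` with a neighbour in `A`. -/
def boundary (A : Finset (Fin n)) : Finset (Fin n) :=
  Finset.univ.filter fun v => v ∉ A ∧ ∃ u ∈ A, G.Adj u v

/-- `A` is one side of an `R`-isolating vertex cut: `A` contains exactly one terminal `r`, and the
separator `N(A)` contains none. So `N(A)` separates `r` from all the other terminals. -/
def IsIsolating (R A : Finset (Fin n)) : Prop :=
  (∃ r, A ∩ R = {r}) ∧ Disjoint (boundary G A) R

/-- `A` is a side of a minimum `R`-isolating vertex cut: the weight of the separator `N(A)` is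
minimum among all isolating vertex cuts, over all choices of the isolated terminal. -/
def IsMinIsolating (R A : Finset (Fin n)) : Prop :=
  IsIsolating G R A ∧
    ∀ A', IsIsolating G R A' → weight w (boundary G A) ≤ weight w (boundary G A')

end Graph

/-! ### A randomized RAM with logarithmic cost and a subroutine for isolating vertex cuts -/

/-- A memory state: registers and arrays of natural numbers. A program names finitely many
registers and arrays; an array is indexed by computed values (random access). -/
structure State where
  reg : ℕ → ℕ
  arr : ℕ → ℕ → ℕ

/-- Write `v` to register `x`. -/
def State.setReg (s : State) (x v : ℕ) : State :=
  { s with reg := Function.update s.reg x v }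

/-- Write `v` to cell `i` of array `a`. -/
def State.setCell (s : State) (a i v : ℕ) : State :=
  { s with arr := Function.update s.arr a (Function.update (s.arr a) i v) }

/-- Arithmetic expressions over registers and array cells. -/
inductive Term where
  | const (c : ℕ)
  | reg (x : ℕ)
  | cell (a : ℕ) (i : Term)
  | add (l r : Term)
  | sub (l r : Term)
  | mul (l r : Term)
  | div (l r : Term)
  | eq (l r : Term)
  | lt (l r : Term)

/-- The value of an expression; comparisons return `1` or `0`. -/
def Term.val (s : State) : Term → ℕ
  | .const c => c
  | .reg x => s.reg x
  | .cell a i => s.arr a (i.val s)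
  | .add l r => l.val s + r.val s
  | .sub l r => l.val s - r.val s
  | .mul l r => l.val s * r.val s
  | .div l r => l.val s / r.val s
  | .eq l r => if l.val s = r.val s then 1 else 0
  | .lt l r => if l.val s < r.val s then 1 else 0

/-- The logarithmic cost of evaluating an expression: every node, hence every operand, every
address and every result, is charged one unit plus the number of its bits. -/
def Term.cost (s : State) : Term → ℕ
  | .const c => 1 + Nat.size c
  | .reg x => 1 + Nat.size (s.reg x)
  | .cell a i => i.cost s + (1 + Nat.size (s.arr a (i.val s)))
  | .add l r => l.cost s + r.cost s + (1 + Nat.size (l.val s + r.val s))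
  | .sub l r => l.cost s + r.cost s + (1 + Nat.size (l.val s - r.val s))
  | .mul l r => l.cost s + r.cost s + (1 + Nat.size (l.val s * r.val s))
  | .div l r => l.cost s + r.cost s + (1 + Nat.size (l.val s / r.val s))
  | .eq l r => l.cost s + r.cost s + 2
  | .lt l r => l.cost s + r.cost s + 2

/-- Programs. `rand x k` draws a uniformly random `k`-bit number. `ivc n m src dst wt term ans`
calls the isolating vertex cut subroutine on the weighted graph whose numbers of vertices and
edges are in registers `n` and `m`, whose edges are in arrays `src`, `dst` and whose weights are in
array `wt`, with the terminal set given by its bit vector in array `term`; the answer is written,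
as a bit vector, to array `ans`. -/
inductive Program where
  | skip
  | assign (x : ℕ) (e : Term)
  | store (a : ℕ) (i e : Term)
  | rand (x : ℕ) (k : Term)
  | ivc (n m src dst wt term ans : ℕ)
  | seq (p q : Program)
  | branch (e : Term) (p q : Program)
  | loop (e : Term) (p : Program)

/-- The data passed to the isolating vertex cut subroutine. -/
structure Query where
  n : ℕ
  edges : List (ℕ × ℕ)
  weights : List ℕ
  terminals : Finset ℕ

/-- The query for a weighted graph on `Fin n` given by an edge list, and a terminal set. -/
def Query.of {n : ℕ} (es : List (Fin n × Fin n)) (w : Fin n → ℕ) (R : Finset (Fin n)) : Query where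
  n := n
  edges := es.map fun e => (e.1.val, e.2.val)
  weights := List.ofFn w
  terminals := R.map Fin.valEmbedding

/-- The query stored in the registers and arrays that an `ivc` command names. -/
def State.query (s : State) (n m src dst wt term : ℕ) : Query where
  n := s.reg n
  edges := (List.range (s.reg m)).map fun i => (s.arr src i, s.arr dst i)
  weights := (List.range (s.reg n)).map (s.arr wt)
  terminals := (Finset.range (s.reg n)).filter fun v => s.arr term v ≠ 0

/-- Write the bit vector of `A ∩ {0, …, n - 1}` to the first `n` cells of array `a`. -/
def State.setBits (s : State) (a n : ℕ) (A : Finset ℕ) : State :=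
  { s with arr := Function.update s.arr a fun v =>
      if v < n then (if v ∈ A then 1 else 0) else s.arr a v }

/-- A possibly randomized subroutine, used as a black box: a distribution over answers for every
query. Every call is answered with fresh randomness. -/
abbrev Subroutine := Query → PMF (Finset ℕ)

/-- `O` computes a minimum isolating vertex cut, in every simple graph with integer vertex weights
between `1` and `U` and for every independent set of at least two terminals, with probability at
least `2 / 3` (a deterministic subroutine has success probability `1`). -/
def SolvesIsolatingCut (U : ℕ) (O : Subroutine) : Prop :=
  ∀ (n : ℕ) (G : SimpleGraph (Fin n)) (es : List (Fin n × Fin n)) (w : Fin n → ℕ)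
    (R : Finset (Fin n)),
    IsEdgeList G es → (∀ v, 1 ≤ w v ∧ w v ≤ U) → G.IsIndepSet (R : Set (Fin n)) → 2 ≤ R.card →
    2 / 3 ≤ (O (Query.of es w R)).toOuterMeasure
      {A | ∃ A' : Finset (Fin n), A'.map Fin.valEmbedding = A ∧ IsMinIsolating G w R A'}

/-- The result of a run with a time budget: `none` if the budget did not suffice, and otherwise
the final state with the part of the budget that is left. -/
abbrev Result := PMF (Option (State × ℕ))

/-- Spend `t` time units of the budget `b`, then continue with the rest. -/
def spend (b t : ℕ) (k : ℕ → Result) : Result :=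
  if t ≤ b then k (b - t) else PMF.pure none

/-- Sequential composition of runs. -/
def andThen (p : Result) (k : State → ℕ → Result) : Result :=
  p.bind fun r => match r with
    | none => PMF.pure none
    | some (s, b) => k s b

/-- Iterate `body` while `e` is nonzero, at most `f` tests of `e`. -/
def iterate (e : Term) (body : State → ℕ → Result) : ℕ → State → ℕ → Result
  | 0, _, _ => PMF.pure none
  | f + 1, s, b => spend b (1 + e.cost s) fun b' =>
      if e.val s = 0 then PMF.pure (some (s, b')) else andThen (body s b') (iterate e body f)

/-- Run a program from a state with time budget `b`, where a call of the subroutine `O` on a graph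
with `m` edges and `n` vertices takes time `T m n`. Every test of a loop costs at least one unit,
so the bound `b + 1` on the number of tests is no restriction beyond the budget. -/
def Program.run (T : ℕ → ℕ → ℕ) (O : Subroutine) : Program → State → ℕ → Result
  | .skip, s, b => spend b 1 fun b' => PMF.pure (some (s, b'))
  | .assign x e, s, b => spend b (1 + e.cost s) fun b' =>
      PMF.pure (some (s.setReg x (e.val s), b'))
  | .store a i e, s, b => spend b (1 + i.cost s + e.cost s) fun b' =>
      PMF.pure (some (s.setCell a (i.val s) (e.val s), b'))
  | .rand x k, s, b => spend b (1 + k.cost s + k.val s) fun b' =>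
      (PMF.uniformOfFintype (Fin (2 ^ k.val s))).map fun v => some (s.setReg x v.val, b')
  | .ivc n m src dst wt term ans, s, b => spend b (1 + T (s.reg m) (s.reg n)) fun b' =>
      (O (s.query n m src dst wt term)).map fun A => some (s.setBits ans (s.reg n) A, b')
  | .seq p q, s, b => andThen (p.run T O s b) (q.run T O)
  | .branch e p q, s, b => spend b (1 + e.cost s) fun b' =>
      if e.val s = 0 then q.run T O s b' else p.run T O s b'
  | .loop e p, s, b => iterate e (p.run T O) (b + 1) s b

/-- The initial state for a weighted graph: the numbers of vertices and edges in registers `0` and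
`1`, the end points of the edges in arrays `0` and `1`, the weights in array `2`; everything else
is zero. -/
def input {n : ℕ} (es : List (Fin n × Fin n)) (w : Fin n → ℕ) : State where
  reg x := if x = 0 then n else if x = 1 then es.length else 0
  arr a i :=
    if a = 0 then ((es.map fun e => e.1.val)[i]?).getD 0
    else if a = 1 then ((es.map fun e => e.2.val)[i]?).getD 0
    else if a = 2 then ((List.ofFn w)[i]?).getD 0
    else 0

/-- The output of a run: the set listed in array `3`, with the length of the list in register
`2`. -/
def State.output (s : State) : Finset ℕ := (Finset.range (s.reg 2)).image (s.arr 3)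

/-- The probability that program `P`, started on the weighted graph `G` given by the edge list
`es`, halts within `B` time units and outputs a minimum vertex cut of `G`. -/
def successProb (T : ℕ → ℕ → ℕ) (O : Subroutine) (P : Program) {n : ℕ} (G : SimpleGraph (Fin n))
    (es : List (Fin n × Fin n)) (w : Fin n → ℕ) (B : ℕ) : ℝ≥0∞ :=
  (P.run T O (input es w) B).toOuterMeasure
    {r | ∃ s b S, r = some (s, b) ∧ IsMinVertexCut G w S ∧ s.output = S.map Fin.valEmbedding}

end VertexCut

end

open VertexCut

namespace VertexCut

variable {T : ℕ → ℕ → ℕ} {O : Subroutine}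

/-! ### Support of a run: written variables and decreasing budgets -/

/-! Let S be a minimum vertex cut with sides A and B, w(A) ≤ w(B), and let M = max(κ, w(A)). Choose
a scale with 4M ≤ 2^i ≤ 8M and sample every vertex v independently with probability min(2^i,
w(v))/2^i. With probability at least 1/(512X) the sample Q has exactly one vertex in A, none in S
and some in B (`IsSplit.exists_scale`). Here X ≥ 1 is any number with κ² ≤ X or κW ≤ X(W - κ); this
is the relation `Acc`, and the least such X is κ' min{κ', W/(W - κ)} up to a constant
(`exists_firstAcc`). Removing from Q all vertices with a smaller neighbour in Q leaves an
independent set that retains the vertex in A and the smallest vertex of Q in B. So A isolates a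
terminal, and with probability at least 2/3 the subroutine returns a cut of weight at most κ. The
program tries a random scale out of O(log W) many and checks every answer itself, so that O(X)
iterations, up to logarithmic factors, make the failure probability polynomially small
(`hoare_iterLoop`, `le_one_sub_pow`).

As κ is unknown, there are stages X = 1, 2, 4, ..., and a stage accepts only cuts of weight c with
`Acc W X c`, called affordable. A weight below an affordable one is affordable too. Hence no stage
accepts any cut before κ is affordable, and the first stage in which it is finds a minimum cut with
high probability (`Setup.loop_spec`). The stages have geometrically growing length, so the last one
dominates the time (`hoare_mainLoop`).

For unweighted graphs a stage works on a sparse certificate. In a maximum adjacency order, number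
the edges from each vertex to its earlier neighbours. The edges of label at most K are at most nK in
number (`IsMaxAdjOrder.length_lowEdges_le`) and have the same vertex cuts of fewer than K vertices
as G (`IsMaxAdjOrder.certificate`). A stage takes K just above all affordable weights, and then K ≤
4 max(κ, 1) (`Cap.le`). The order is found by a scan with buckets in O(m + n) steps, by a potential
argument (`hoare_scanLoop`). Disconnected graphs are recognised before the search, since for κ = 0
only time about 1 + m is granted.

Programs are verified by triples `Hoare` that carry a time and a probability. All numbers have
O(log(nU)) bits, so a straight-line block costs O(log(nU)). Registers: 3 is W, 6 the exponent t
bounding the scales, 7 is X, 8 the repetitions per unit of X, 17 the best weight plus one (0 if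
none), 18 the number of edges kept, 19 the cap K. Arrays: 4 sample, 5 terminals, 6 answer, 7 its
boundary, 8 and 9 the edges kept, 10 labels, 11 and 12 adjacency lists, 13 and 14 buckets, 15
positions, 16 numbers of earlier neighbours. -/

/-- The registers a program may write. -/
def Program.wregs : Program → List ℕ
  | .skip => []
  | .assign x _ => [x]
  | .store _ _ _ => []
  | .rand x _ => [x]
  | .ivc _ _ _ _ _ _ _ => []
  | .seq p q => p.wregs ++ q.wregs
  | .branch _ p q => p.wregs ++ q.wregs
  | .loop _ p => p.wregs

/-- The arrays a program may write. -/
def Program.warrs : Program → List ℕ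
  | .skip => []
  | .assign _ _ => []
  | .store a _ _ => [a]
  | .rand _ _ => []
  | .ivc _ _ _ _ _ _ ans => [ans]
  | .seq p q => p.warrs ++ q.warrs
  | .branch _ p q => p.warrs ++ q.warrs
  | .loop _ p => p.warrs

/-- `s'` agrees with `s` outside the registers `R` and the arrays `A`. -/
def SameOff (R A : List ℕ) (s s' : State) : Prop :=
  (∀ x, x ∉ R → s'.reg x = s.reg x) ∧ ∀ a, a ∉ A → s'.arr a = s.arr a

theorem SameOff.refl (R A : List ℕ) (s : State) : SameOff R A s s :=
  ⟨fun _ _ => rfl, fun _ _ => rfl⟩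

theorem SameOff.trans {R A : List ℕ} {s s' s'' : State} (h : SameOff R A s s')
    (h' : SameOff R A s' s'') : SameOff R A s s'' :=
  ⟨fun x hx => (h'.1 x hx).trans (h.1 x hx), fun a ha => (h'.2 a ha).trans (h.2 a ha)⟩

theorem SameOff.mono {R A R' A' : List ℕ} {s s' : State} (h : SameOff R A s s')
    (hR : ∀ x ∈ R, x ∈ R') (hA : ∀ a ∈ A, a ∈ A') : SameOff R' A' s s' :=
  ⟨fun x hx => h.1 x fun hx' => hx (hR x hx'), fun a ha => h.2 a fun ha' => ha (hA a ha')⟩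

/-- All final states of `r` satisfy `F` and keep at most `b` units of budget. -/
def Result.Sound (r : Result) (b : ℕ) (F : State → Prop) : Prop :=
  ∀ s' b', some (s', b') ∈ r.support → b' ≤ b ∧ F s'

theorem sound_spend {b t : ℕ} {k : ℕ → Result} {F : State → Prop}
    (h : ∀ b' ≤ b, (k b').Sound b' F) : (spend b t k).Sound b F := by
  intro s' b' hs
  unfold spend at hs
  split_ifs at hs with hb
  · obtain ⟨h1, h2⟩ := h (b - t) (Nat.sub_le _ _) s' b' hs
    exact ⟨h1.trans (Nat.sub_le _ _), h2⟩
  · simp at hs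

theorem sound_pure {s : State} {b : ℕ} {F : State → Prop} (h : F s) :
    Result.Sound (PMF.pure (some (s, b))) b F := by
  intro s' b' hs
  simp only [PMF.support_pure, Set.mem_singleton_iff, Option.some.injEq, Prod.mk.injEq] at hs
  obtain ⟨rfl, rfl⟩ := hs
  exact ⟨le_rfl, h⟩

theorem sound_andThen {r : Result} {k : State → ℕ → Result} {b : ℕ} {F F' : State → Prop}
    (h : r.Sound b F) (hk : ∀ s' b', F s' → (k s' b').Sound b' F') : (andThen r k).Sound b F' := by
  intro s' b' hs
  simp only [andThen, PMF.mem_support_bind_iff] at hs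
  obtain ⟨a, ha, hs⟩ := hs
  match a with
  | none => simp at hs
  | some (s1, b1) =>
    obtain ⟨h1, h2⟩ := h s1 b1 ha
    obtain ⟨h3, h4⟩ := hk s1 b1 h2 s' b' hs
    exact ⟨h3.trans h1, h4⟩

theorem sound_iterate {e : Term} {body : State → ℕ → Result} {R A : List ℕ}
    (h : ∀ s b, (body s b).Sound b (SameOff R A s)) (f : ℕ) (s : State) (b : ℕ) :
    (iterate e body f s b).Sound b (SameOff R A s) := by
  induction f generalizing s b with
  | zero => intro s' b' hs; simp [iterate] at hs
  | succ f ih =>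
    unfold iterate
    refine sound_spend fun b' _ => ?_
    split_ifs
    · exact sound_pure (SameOff.refl _ _ _)
    · refine sound_andThen (h s b') fun s1 b1 h1 => ?_
      intro s2 b2 h2
      obtain ⟨h3, h4⟩ := ih s1 b1 s2 b2 h2
      exact ⟨h3, h1.trans h4⟩

/-- A single induction gives the frame rule, applied later by `decide` to concrete lists of
variables, and the fact that the budget never grows, on which the unrolling of loops rests. -/
theorem Program.sound (P : Program) (s : State) (b : ℕ) :
    (P.run T O s b).Sound b (SameOff P.wregs P.warrs s) := by
  induction P generalizing s b with
  | skip => exact sound_spend fun b' _ => sound_pure (SameOff.refl _ _ _)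
  | assign x e =>
    refine sound_spend fun b' _ => sound_pure ⟨fun y hy => ?_, fun _ _ => rfl⟩
    simp only [wregs, List.mem_singleton] at hy
    simp [State.setReg, hy]
  | store a i e =>
    refine sound_spend fun b' _ => sound_pure ⟨fun _ _ => rfl, fun y hy => ?_⟩
    simp only [warrs, List.mem_singleton] at hy
    simp [State.setCell, hy]
  | rand x k =>
    refine sound_spend fun b' _ => ?_
    intro s' b'' hs
    simp only [PMF.mem_support_map_iff, Option.some.injEq, Prod.mk.injEq] at hs
    obtain ⟨v, -, rfl, rfl⟩ := hs
    refine ⟨le_rfl, fun y hy => ?_, fun _ _ => rfl⟩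
    simp only [wregs, List.mem_singleton] at hy
    simp [State.setReg, hy]
  | ivc n m src dst wt term ans =>
    refine sound_spend fun b' _ => ?_
    intro s' b'' hs
    simp only [PMF.mem_support_map_iff, Option.some.injEq, Prod.mk.injEq] at hs
    obtain ⟨v, -, rfl, rfl⟩ := hs
    refine ⟨le_rfl, fun _ _ => rfl, fun y hy => ?_⟩
    simp only [warrs, List.mem_singleton] at hy
    simp [State.setBits, hy]
  | seq p q ihp ihq =>
    refine sound_andThen (ihp s b) fun s1 b1 h1 => ?_
    intro s2 b2 h2
    obtain ⟨h3, h4⟩ := ihq s1 b1 s2 b2 h2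
    exact ⟨h3, (h1.mono (by simp +contextual [wregs]) (by simp +contextual [warrs])).trans
      (h4.mono (by simp +contextual [wregs]) (by simp +contextual [warrs]))⟩
  | branch e p q ihp ihq =>
    refine sound_spend fun b' _ => ?_
    split_ifs
    · intro s2 b2 h2
      obtain ⟨h3, h4⟩ := ihq s b' s2 b2 h2
      exact ⟨h3, h4.mono (by simp +contextual [wregs]) (by simp +contextual [warrs])⟩
    · intro s2 b2 h2
      obtain ⟨h3, h4⟩ := ihp s b' s2 b2 h2
      exact ⟨h3, h4.mono (by simp +contextual [wregs]) (by simp +contextual [warrs])⟩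
  | loop e p ih => exact sound_iterate ih _ s b

/-! ### Unrolling loops -/

theorem bind_congr_support {α β : Type*} (p : PMF α) {f g : α → PMF β}
    (h : ∀ a ∈ p.support, f a = g a) : p.bind f = p.bind g := by
  ext b
  simp only [PMF.bind_apply]
  refine tsum_congr fun a => ?_
  by_cases ha : p a = 0
  · simp [ha]
  · rw [h a ((PMF.mem_support_iff _ _).2 ha)]

/-- Every test of the loop costs at least one unit, so the budget is exhausted before the fuel; two
amounts of fuel above the budget give the same run. -/
theorem iterate_fuel {e : Term} {body : State → ℕ → Result} {F : State → State → Prop}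
    (h : ∀ s b, (body s b).Sound b (F s)) (f : ℕ) :
    ∀ (f' : ℕ) (s : State) (b : ℕ), b < f → b < f' →
      iterate e body f s b = iterate e body f' s b := by
  induction f with
  | zero => intro f' s b hb; omega
  | succ f ih =>
    intro f' s b hb hb'
    obtain ⟨g, rfl⟩ : ∃ g, f' = g + 1 := ⟨f' - 1, by omega⟩
    unfold iterate spend
    split_ifs with h1 h2
    · rfl
    · refine bind_congr_support _ fun a ha => ?_
      match a with
      | none => rfl
      | some (s1, b1) =>
        have := (h s _ s1 b1 ha).1
        exact ih g s1 b1 (by omega) (by omega)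
    · rfl

theorem run_loop (e : Term) (p : Program) (s : State) (b : ℕ) :
    (Program.loop e p).run T O s b = spend b (1 + e.cost s) fun b' =>
      if e.val s = 0 then PMF.pure (some (s, b'))
      else (Program.seq p (Program.loop e p)).run T O s b' := by
  simp only [Program.run]
  rw [iterate]
  unfold spend
  split_ifs with h1 h2
  · rfl
  · refine bind_congr_support _ fun a ha => ?_
    match a with
    | none => rfl
    | some (s1, b1) =>
      have := (p.sound s _ s1 b1 ha).1
      exact iterate_fuel (fun s b => p.sound s b) _ _ s1 b1 (by omega) (by omega)
  · rfl

/-! ### Timed probabilistic Hoare triples -/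

/-- The runs that end in `Q` with at least `b` units of budget left. -/
def Ends (b : ℕ) (Q : State → Prop) : Set (Option (State × ℕ)) :=
  {r | ∃ s' b', r = some (s', b') ∧ b ≤ b' ∧ Q s'}

/-- Started in `s`, the program `P` reaches `Q` within `t` time units with probability at least
`p`. -/
def Hoare (T : ℕ → ℕ → ℕ) (O : Subroutine) (P : Program) (s : State) (t : ℕ) (Q : State → Prop)
    (p : ℝ≥0∞) : Prop :=
  ∀ b, p ≤ (P.run T O s (t + b)).toOuterMeasure (Ends b Q)

theorem Ends.mono {b b' : ℕ} {Q Q' : State → Prop} (hb : b' ≤ b) (h : ∀ s, Q s → Q' s) :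
    Ends b Q ⊆ Ends b' Q' := by
  rintro r ⟨s, c, rfl, hc, hs⟩
  exact ⟨s, c, rfl, hb.trans hc, h s hs⟩

/-- `Hoare` quantifies over the surplus budget b, and this is what allows the time to be raised: the
extra time is simply added to the surplus. -/
theorem Hoare.mono {P : Program} {s : State} {t t' : ℕ} {Q Q' : State → Prop} {p p' : ℝ≥0∞}
    (h : Hoare T O P s t Q p) (ht : t ≤ t') (hQ : ∀ s', Q s' → Q' s') (hp : p' ≤ p) :
    Hoare T O P s t' Q' p' := by
  intro b
  have := h (t' - t + b)
  rw [← add_assoc, Nat.add_sub_cancel' ht] at this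
  exact hp.trans (this.trans ((P.run T O s (t' + b)).toOuterMeasure.mono
    (Ends.mono (by omega) hQ)))

theorem Hoare.post {P : Program} {s : State} {t : ℕ} {Q Q' : State → Prop} {p : ℝ≥0∞}
    (h : Hoare T O P s t Q p) (hQ : ∀ s', Q s' → Q' s') : Hoare T O P s t Q' p :=
  h.mono le_rfl hQ le_rfl

theorem Hoare.zero (P : Program) (s : State) (t : ℕ) (Q : State → Prop) :
    Hoare T O P s t Q 0 := fun _ => zero_le

/-- Adds to a postcondition, at no cost, everything that the program cannot change. -/
theorem Hoare.and_frame {P : Program} {s : State} {t : ℕ} {Q : State → Prop} {p : ℝ≥0∞}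
    (h : Hoare T O P s t Q p) :
    Hoare T O P s t (fun s' => Q s' ∧ SameOff P.wregs P.warrs s s') p := by
  intro b
  refine (h b).trans (PMF.toOuterMeasure_mono _ ?_)
  rintro r ⟨⟨s', b', rfl, hb, hQ⟩, hr⟩
  exact ⟨s', b', rfl, hb, hQ, (P.sound s _ s' b' hr).2⟩

theorem run_seq_toOuterMeasure (P P' : Program) (s : State) (b : ℕ)
    (E : Set (Option (State × ℕ))) :
    ((Program.seq P P').run T O s b).toOuterMeasure E =
      ∑' r, P.run T O s b r * (match r with
        | none => PMF.pure none
        | some (s, b) => P'.run T O s b : Result).toOuterMeasure E := by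
  refine (PMF.toOuterMeasure_bind_apply _ _ _).trans (tsum_congr fun r => ?_)
  match r with
  | none => rfl
  | some (s, b) => rfl

/-- Sequential composition, with a second chance: from every state in `Q` the rest succeeds with
probability `p'`, and from the states in `Q₁` with probability `p' + d`. -/
theorem Hoare.seq_mix {P P' : Program} {s : State} {t t' : ℕ} {Q Q₁ R : State → Prop}
    {p q p' d : ℝ≥0∞} (h : Hoare T O P s t Q p) (h₁ : Hoare T O P s t Q₁ q)
    (hQ : ∀ s', Q₁ s' → Q s')
    (h' : ∀ s', Q s' → Hoare T O P' s' t' R p')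
    (h₁' : ∀ s', Q₁ s' → Hoare T O P' s' t' R (p' + d)) :
    Hoare T O (.seq P P') s (t + t') R (p * p' + q * d) := by
  classical
  intro b
  rw [run_seq_toOuterMeasure, add_assoc]
  have hp := h (t' + b)
  have hq := h₁ (t' + b)
  rw [PMF.toOuterMeasure_apply] at hp hq
  refine (add_le_add (mul_le_mul_left hp p') (mul_le_mul_left hq d)).trans ?_
  rw [← ENNReal.tsum_mul_right, ← ENNReal.tsum_mul_right, ← ENNReal.tsum_add]
  refine ENNReal.tsum_le_tsum fun r => ?_
  have key : ∀ s' b', t' + b ≤ b' → ∀ x, Hoare T O P' s' t' R x →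
      x ≤ (P'.run T O s' b').toOuterMeasure (Ends b R) := by
    intro s' b' hb x hx
    have := hx (b' - t')
    rw [Nat.add_sub_cancel' (by omega)] at this
    exact this.trans ((P'.run T O s' b').toOuterMeasure.mono (Ends.mono (by omega) fun _ h => h))
  -- The two sums are compared term by term: an intermediate result in `Q₁` contributes p' + d, one
  -- that is only in `Q` contributes p'.
  by_cases h1 : r ∈ Ends (t' + b) Q₁
  · have h2 : r ∈ Ends (t' + b) Q := Ends.mono le_rfl hQ h1
    rw [Set.indicator_of_mem h1, Set.indicator_of_mem h2, ← mul_add]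
    obtain ⟨s', b', rfl, hb, hs⟩ := h1
    exact mul_le_mul_right (key s' b' hb _ (h₁' s' hs)) _
  · rw [Set.indicator_of_notMem h1, zero_mul, add_zero]
    by_cases h2 : r ∈ Ends (t' + b) Q
    · rw [Set.indicator_of_mem h2]
      obtain ⟨s', b', rfl, hb, hs⟩ := h2
      exact mul_le_mul_right (key s' b' hb _ (h' s' hs)) _
    · rw [Set.indicator_of_notMem h2, zero_mul]
      exact zero_le

theorem Hoare.seq {P P' : Program} {s : State} {t t' : ℕ} {Q R : State → Prop}
    {p p' : ℝ≥0∞} (h : Hoare T O P s t Q p) (h' : ∀ s', Q s' → Hoare T O P' s' t' R p') :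
    Hoare T O (.seq P P') s (t + t') R (p * p') := by
  have := Hoare.seq_mix (Q₁ := fun _ => False) (q := 0) (d := 0) h (Hoare.zero _ _ _ _)
    (fun _ h => h.elim) h' (fun _ h => h.elim)
  simpa using this

theorem Hoare.seq_one {P P' : Program} {s : State} {t t' : ℕ} {Q R : State → Prop}
    {p : ℝ≥0∞} (h : Hoare T O P s t Q 1) (h' : ∀ s', Q s' → Hoare T O P' s' t' R p) :
    Hoare T O (.seq P P') s (t + t') R p := by
  simpa using h.seq h'

theorem hoare_of_pure {P : Program} {s s' : State} {t : ℕ} {Q : State → Prop}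
    (h : ∀ b, P.run T O s (t + b) = PMF.pure (some (s', b))) (hQ : Q s') :
    Hoare T O P s t Q 1 := by
  classical
  intro b
  rw [h b, PMF.toOuterMeasure_pure_apply, if_pos]
  exact ⟨s', b, rfl, le_rfl, hQ⟩

theorem Hoare.skip {s : State} {Q : State → Prop} (hQ : Q s) : Hoare T O .skip s 1 Q 1 :=
  hoare_of_pure (fun b => by simp [Program.run, spend]) hQ

theorem Hoare.assign {s : State} {x : ℕ} {e : Term} {Q : State → Prop}
    (hQ : Q (s.setReg x (e.val s))) : Hoare T O (.assign x e) s (1 + e.cost s) Q 1 :=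
  hoare_of_pure (fun b => by simp [Program.run, spend]) hQ

theorem Hoare.store {s : State} {a : ℕ} {i e : Term} {Q : State → Prop}
    (hQ : Q (s.setCell a (i.val s) (e.val s))) :
    Hoare T O (.store a i e) s (1 + i.cost s + e.cost s) Q 1 :=
  hoare_of_pure (fun b => by simp [Program.run, spend]) hQ

theorem Hoare.branch_pos {s : State} {e : Term} {P P' : Program} {t : ℕ} {Q : State → Prop}
    {p : ℝ≥0∞} (he : e.val s ≠ 0) (h : Hoare T O P s t Q p) :
    Hoare T O (.branch e P P') s (1 + e.cost s + t) Q p := by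
  intro b
  rw [add_assoc _ t]
  simpa [Program.run, spend, he] using h b

theorem Hoare.branch_neg {s : State} {e : Term} {P P' : Program} {t : ℕ} {Q : State → Prop}
    {p : ℝ≥0∞} (he : e.val s = 0) (h : Hoare T O P' s t Q p) :
    Hoare T O (.branch e P P') s (1 + e.cost s + t) Q p := by
  intro b
  rw [add_assoc _ t]
  simpa [Program.run, spend, he] using h b

theorem Hoare.loop_done {s : State} {e : Term} {P : Program} {Q : State → Prop}
    (he : e.val s = 0) (hQ : Q s) : Hoare T O (.loop e P) s (1 + e.cost s) Q 1 :=
  hoare_of_pure (fun b => by rw [run_loop]; simp [spend, he]) hQ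

theorem Hoare.loop_step {s : State} {e : Term} {P : Program} {t : ℕ} {Q : State → Prop}
    {p : ℝ≥0∞} (he : e.val s ≠ 0) (h : Hoare T O (.seq P (.loop e P)) s t Q p) :
    Hoare T O (.loop e P) s (1 + e.cost s + t) Q p := by
  intro b
  rw [run_loop, add_assoc _ t]
  simpa [spend, he] using h b

/-- `Z` is a set of favourable draws; only a lower bound is claimed, so it need not contain all of
them. -/
theorem Hoare.rand {s : State} {x : ℕ} {k : Term} {Q : State → Prop}
    (Z : Finset (Fin (2 ^ k.val s))) (hQ : ∀ v ∈ Z, Q (s.setReg x v.val)) :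
    Hoare T O (.rand x k) s (1 + k.cost s + k.val s) Q (Z.card / 2 ^ k.val s) := by
  classical
  intro b
  have : (Program.rand x k).run T O s (1 + k.cost s + k.val s + b) =
      (PMF.uniformOfFintype (Fin (2 ^ k.val s))).map fun v => some (s.setReg x v.val, b) := by
    simp [Program.run, spend]
  rw [this, PMF.toOuterMeasure_map_apply, PMF.toOuterMeasure_uniformOfFintype_apply]
  simp only [Fintype.card_fin, Nat.cast_pow, Nat.cast_ofNat]
  gcongr
  rw [← Fintype.card_coe]
  refine Fintype.card_le_of_injective
    (fun v => ⟨v.1, by exact ⟨_, _, rfl, le_rfl, hQ v.1 v.2⟩⟩) ?_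
  intro a b h
  exact Subtype.ext (congrArg (fun x => x.1) h)

theorem Hoare.ivc {s : State} {n m src dst wt term ans : ℕ} {Q : State → Prop}
    (E : Set (Finset ℕ)) (hQ : ∀ A ∈ E, Q (s.setBits ans (s.reg n) A)) :
    Hoare T O (.ivc n m src dst wt term ans) s (1 + T (s.reg m) (s.reg n)) Q
      ((O (s.query n m src dst wt term)).toOuterMeasure E) := by
  intro b
  have : (Program.ivc n m src dst wt term ans).run T O s (1 + T (s.reg m) (s.reg n) + b) =
      (O (s.query n m src dst wt term)).map fun A => some (s.setBits ans (s.reg n) A, b) := by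
    simp [Program.run, spend]
  rw [this, PMF.toOuterMeasure_map_apply]
  exact (O _).toOuterMeasure.mono fun A hA => ⟨_, _, rfl, le_rfl, hQ A hA⟩

/-- The probabilities of mutually exclusive postconditions add up. -/
theorem Hoare.sum {ι : Type*} {P : Program} {s : State} {t : ℕ} (F : Finset ι)
    (Q : ι → State → Prop) (p : ι → ℝ≥0∞) (h : ∀ i ∈ F, Hoare T O P s t (Q i) (p i))
    (hd : ∀ i ∈ F, ∀ j ∈ F, ∀ s', Q i s' → Q j s' → i = j) :
    Hoare T O P s t (fun s' => ∃ i ∈ F, Q i s') (∑ i ∈ F, p i) := by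
  classical
  intro b
  refine (Finset.sum_le_sum fun i hi => h i hi b).trans ?_
  simp only [PMF.toOuterMeasure_apply]
  rw [← Summable.tsum_finsetSum (fun i _ => ENNReal.summable)]
  refine ENNReal.tsum_le_tsum fun r => ?_
  -- By exclusivity at most one summand is nonzero at a given result.
  by_cases hr : ∃ i ∈ F, r ∈ Ends b (Q i)
  · obtain ⟨i, hi, hri⟩ := hr
    rw [Finset.sum_eq_single_of_mem i hi]
    · rw [Set.indicator_of_mem hri, Set.indicator_of_mem]
      exact Ends.mono le_rfl (fun s' h => ⟨i, hi, h⟩) hri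
    · intro j hj hji
      refine Set.indicator_of_notMem (fun hrj => hji ?_) _
      obtain ⟨s', b', rfl, -, h1⟩ := hri
      obtain ⟨s'', b'', h', -, h2⟩ := hrj
      simp only [Option.some.injEq, Prod.mk.injEq] at h'
      obtain ⟨rfl, rfl⟩ := h'
      exact hd j hj i hi s' h2 h1
  · push Not at hr
    rw [Finset.sum_eq_zero fun i hi => Set.indicator_of_notMem (hr i hi) _]
    exact zero_le

/-! ### Bounded states and costs -/

/-- All stored values have at most `Λ` bits. -/
def Bdd (Λ : ℕ) (s : State) : Prop := (∀ x, s.reg x < 2 ^ Λ) ∧ ∀ a i, s.arr a i < 2 ^ Λ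

@[simp] theorem setReg_reg (s : State) (x v y : ℕ) :
    (s.setReg x v).reg y = if y = x then v else s.reg y := by
  simp [State.setReg, Function.update_apply]

@[simp] theorem setReg_arr (s : State) (x v : ℕ) : (s.setReg x v).arr = s.arr := rfl

@[simp] theorem setCell_reg (s : State) (a i v : ℕ) : (s.setCell a i v).reg = s.reg := rfl

@[simp] theorem setCell_arr (s : State) (a i v b j : ℕ) :
    (s.setCell a i v).arr b j = if b = a ∧ j = i then v else s.arr b j := by
  simp only [State.setCell, Function.update_apply]
  by_cases h : b = a
  · subst h; simp [Function.update_apply]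
  · simp [h]

@[simp] theorem setBits_reg (s : State) (a n : ℕ) (A : Finset ℕ) :
    (s.setBits a n A).reg = s.reg := rfl

@[simp] theorem setBits_arr (s : State) (a n b v : ℕ) (A : Finset ℕ) :
    (s.setBits a n A).arr b v =
      if b = a ∧ v < n then (if v ∈ A then 1 else 0) else s.arr b v := by
  simp only [State.setBits, Function.update_apply]
  by_cases h : b = a
  · subst h; simp
  · simp [h]

theorem Bdd.setReg {Λ : ℕ} {s : State} (h : Bdd Λ s) {x v : ℕ} (hv : v < 2 ^ Λ) :
    Bdd Λ (s.setReg x v) := by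
  refine ⟨fun y => ?_, h.2⟩
  rw [setReg_reg]
  split_ifs
  · exact hv
  · exact h.1 y

theorem Bdd.setCell {Λ : ℕ} {s : State} (h : Bdd Λ s) {a i v : ℕ} (hv : v < 2 ^ Λ) :
    Bdd Λ (s.setCell a i v) := by
  refine ⟨h.1, fun b j => ?_⟩
  rw [setCell_arr]
  split_ifs
  · exact hv
  · exact h.2 b j

theorem Bdd.setBits {Λ : ℕ} {s : State} (hΛ : 1 ≤ Λ) (h : Bdd Λ s) (a n : ℕ) (A : Finset ℕ) :
    Bdd Λ (s.setBits a n A) := by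
  refine ⟨h.1, fun b j => ?_⟩
  have : 2 ^ 1 ≤ 2 ^ Λ := Nat.pow_le_pow_right (by norm_num) hΛ
  rw [setBits_arr]
  split_ifs
  · omega
  · omega
  · exact h.2 b j

/-- A value of `e` has at most `e.bits * Λ` bits in a state bounded by `Λ`. -/
def Term.bits : Term → ℕ
  | .const c => Nat.size c
  | .reg _ => 1
  | .cell _ _ => 1
  | .add l r => l.bits + r.bits
  | .sub l _ => l.bits
  | .mul l r => l.bits + r.bits
  | .div l _ => l.bits
  | .eq _ _ => 1
  | .lt _ _ => 1

/-- Evaluating `e` costs at most `e.cw * Λ` in a state bounded by `Λ`. -/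
def Term.cw : Term → ℕ
  | .const c => 1 + Nat.size c
  | .reg _ => 2
  | .cell _ i => i.cw + 2
  | .add l r => l.cw + r.cw + (1 + (l.bits + r.bits))
  | .sub l r => l.cw + r.cw + (1 + l.bits)
  | .mul l r => l.cw + r.cw + (1 + (l.bits + r.bits))
  | .div l r => l.cw + r.cw + (1 + l.bits)
  | .eq l r => l.cw + r.cw + 2
  | .lt l r => l.cw + r.cw + 2

theorem Term.val_lt {Λ : ℕ} (hΛ : 1 ≤ Λ) {s : State} (h : Bdd Λ s) (e : Term) :
    e.val s < 2 ^ (e.bits * Λ) := by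
  have h2 : 2 ^ 1 ≤ 2 ^ Λ := Nat.pow_le_pow_right (by norm_num) hΛ
  induction e with
  | const c =>
    exact (Nat.lt_size_self c).trans_le
      (Nat.pow_le_pow_right (by norm_num) (Nat.le_mul_of_pos_right _ hΛ))
  | reg x => simpa [val, bits] using h.1 x
  | cell a i => simpa [val, bits] using h.2 a _
  | add l r hl hr =>
    simp only [val, bits, Nat.add_mul, pow_add]
    generalize 2 ^ (l.bits * Λ) = x at *
    generalize 2 ^ (r.bits * Λ) = y at *
    -- For a < x and b < y one has a + b < (a + 1)(b + 1) ≤ xy.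
    nlinarith [Nat.mul_le_mul (Nat.succ_le_of_lt hl) (Nat.succ_le_of_lt hr)]
  | sub l r hl hr => exact (Nat.sub_le _ _).trans_lt hl
  | mul l r hl hr =>
    simp only [val, bits, Nat.add_mul, pow_add]
    exact Nat.mul_lt_mul'' hl hr
  | div l r hl hr => exact (Nat.div_le_self _ _).trans_lt hl
  | eq l r hl hr => simp only [val, bits, one_mul]; split_ifs <;> omega
  | lt l r hl hr => simp only [val, bits, one_mul]; split_ifs <;> omega

theorem Term.size_val_le {Λ : ℕ} (hΛ : 1 ≤ Λ) {s : State} (h : Bdd Λ s) (e : Term) :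
    Nat.size (e.val s) ≤ e.bits * Λ :=
  Nat.size_le.2 (e.val_lt hΛ h)

theorem Term.cost_le {Λ : ℕ} (hΛ : 1 ≤ Λ) {s : State} (h : Bdd Λ s) (e : Term) :
    e.cost s ≤ e.cw * Λ := by
  induction e with
  | const c => simp only [cost, cw]; nlinarith
  | reg x =>
    have := Nat.size_le.2 (h.1 x)
    simp only [cost, cw]; omega
  | cell a i ih =>
    have := Nat.size_le.2 (h.2 a (i.val s))
    simp only [cost, cw]; nlinarith
  | add l r hl hr =>
    have := (Term.add l r).size_val_le hΛ h
    simp only [cost, cw, val, bits] at *; nlinarith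
  | sub l r hl hr =>
    have := (Term.sub l r).size_val_le hΛ h
    simp only [cost, cw, val, bits] at *; nlinarith
  | mul l r hl hr =>
    have := (Term.mul l r).size_val_le hΛ h
    simp only [cost, cw, val, bits] at *; nlinarith
  | div l r hl hr =>
    have := (Term.div l r).size_val_le hΛ h
    simp only [cost, cw, val, bits] at *; nlinarith
  | eq l r hl hr => simp only [cost, cw] at *; nlinarith
  | lt l r hl hr => simp only [cost, cw] at *; nlinarith

/-! ### Straight-line programs -/

/-- The effect of a program without loops, random choices and calls. -/
def Program.eff : Program → State → State
  | .assign x e, s => s.setReg x (e.val s)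
  | .store a i e, s => s.setCell a (i.val s) (e.val s)
  | .seq p q, s => q.eff (p.eff s)
  | .branch e p q, s => if e.val s = 0 then q.eff s else p.eff s
  | _, s => s

/-- `P` is a program without loops, random choices and calls, and all values that it stores when
started in `s` have at most `Λ` bits. -/
def Program.Ok (Λ : ℕ) : Program → State → Prop
  | .skip, _ => True
  | .assign _ e, s => e.val s < 2 ^ Λ
  | .store _ _ e, s => e.val s < 2 ^ Λ
  | .seq p q, s => p.Ok Λ s ∧ q.Ok Λ (p.eff s)
  | .branch e p q, s => if e.val s = 0 then q.Ok Λ s else p.Ok Λ s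
  | _, _ => False

/-- Cost factor of a straight-line program. -/
def Program.cw : Program → ℕ
  | .assign _ e => 1 + e.cw
  | .store _ i e => 1 + i.cw + e.cw
  | .seq p q => p.cw + q.cw
  | .branch e p q => 1 + e.cw + (p.cw + q.cw)
  | _ => 1

/-- Straight-line code is deterministic, so it suffices to know that all stored values fit into Λ
bits. The factor `cw` depends on the text of the program only and is evaluated by `decide` for
concrete programs. -/
theorem Hoare.straight' {Λ : ℕ} (hΛ : 1 ≤ Λ) (P : Program) {s : State} (h : Bdd Λ s)
    (hP : P.Ok Λ s) :
    Hoare T O P s (P.cw * Λ) (fun s' => s' = P.eff s ∧ Bdd Λ s') 1 := by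
  induction P generalizing s with
  | skip =>
    refine (Hoare.skip ⟨rfl, h⟩).mono ?_ (fun _ h => h) le_rfl
    simpa [Program.cw] using hΛ
  | assign x e =>
    refine (Hoare.assign ⟨rfl, h.setReg hP⟩).mono ?_ (fun _ h => h) le_rfl
    have := e.cost_le hΛ h
    simp only [Program.cw]; nlinarith
  | store a i e =>
    refine (Hoare.store ⟨rfl, h.setCell hP⟩).mono ?_ (fun _ h => h) le_rfl
    have := e.cost_le hΛ h
    have := i.cost_le hΛ h
    simp only [Program.cw]; nlinarith
  | rand x k => exact hP.elim
  | ivc => exact hP.elim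
  | seq p q ihp ihq =>
    refine ((ihp h hP.1).seq_one (t' := q.cw * Λ) (R := fun s' => s' = q.eff (p.eff s) ∧ Bdd Λ s')
      ?_).mono ?_ (fun _ h => h) le_rfl
    · rintro s' ⟨rfl, hs'⟩
      exact ihq hs' hP.2
    · simp only [Program.cw]; nlinarith
  | branch e p q ihp ihq =>
    have := e.cost_le hΛ h
    by_cases he : e.val s = 0
    · simp only [Program.Ok, he, if_true] at hP
      refine (Hoare.branch_neg he (ihq h hP)).mono ?_ (fun s' h => ?_) le_rfl
      · simp only [Program.cw]; nlinarith
      · simpa [Program.eff, he] using h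
    · simp only [Program.Ok, he, if_false] at hP
      refine (Hoare.branch_pos he (ihp h hP)).mono ?_ (fun s' h => ?_) le_rfl
      · simp only [Program.cw]; nlinarith
      · simpa [Program.eff, he] using h
  | loop => exact hP.elim

theorem Hoare.straight {Λ : ℕ} (hΛ : 1 ≤ Λ) {P : Program} {s : State} {Q : State → Prop}
    (h : Bdd Λ s) (hP : P.Ok Λ s) (hQ : Bdd Λ (P.eff s) → Q (P.eff s)) :
    Hoare T O P s (P.cw * Λ) Q 1 :=
  (Hoare.straight' hΛ P h hP).post fun s' ⟨h1, h2⟩ => by subst h1; exact hQ h2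

/-! ### Loops -/

/-- `for i in 0, …, h - 1 do body`, where `h` is a register. -/
def forLoop (i h : ℕ) (body : Program) : Program :=
  .seq (.assign i (.const 0))
    (.loop (.lt (.reg i) (.reg h)) (.seq body (.assign i (.add (.reg i) (.const 1)))))

/-- The invariant `I k` refers to the state in which the counter already has the value k; hence the
`setReg` in the hypothesis on the body. The bounds `p k` hold from every state that satisfies the
invariant, so they multiply. -/
theorem Hoare.forLoop {Λ : ℕ} (hΛ : 1 ≤ Λ) {i h N t : ℕ} {body : Program} {s : State}
    (I : ℕ → State → Prop) (p : ℕ → ℝ≥0∞) (hB : Bdd Λ s) (hN : s.reg h = N) (hih : h ≠ i)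
    (hi : i ∉ body.wregs) (hh : h ∉ body.wregs) (h0 : I 0 (s.setReg i 0))
    (hb : ∀ k < N, ∀ s', s'.reg i = k → Bdd Λ s' → SameOff (i :: body.wregs) body.warrs s s' →
      I k s' → Hoare T O body s' t (fun s'' => Bdd Λ s'' ∧ I (k + 1) (s''.setReg i (k + 1))) (p k)) :
    Hoare T O (forLoop i h body) s (N * (t + 20 * Λ) + 20 * Λ)
      (fun s' => Bdd Λ s' ∧ SameOff (i :: body.wregs) body.warrs s s' ∧ I N s')
      (∏ k ∈ Finset.range N, p k) := by
  set F := SameOff (i :: body.wregs) body.warrs with hF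
  have hNΛ : N < 2 ^ Λ := hN ▸ hB.1 h
  -- Induction on the number d of remaining rounds.
  have key : ∀ d k s', k + d = N → s'.reg i = k → Bdd Λ s' → F s s' → I k s' →
      Hoare T O (.loop (.lt (.reg i) (.reg h)) (.seq body (.assign i (.add (.reg i) (.const 1)))))
        s' (d * (t + 20 * Λ) + 10 * Λ) (fun s' => Bdd Λ s' ∧ F s s' ∧ I N s')
        (∏ k ∈ Finset.Ico k N, p k) := by
    intro d
    induction d with
    | zero =>
      intro k s' hk hik hBs hFs hI
      obtain rfl : k = N := by omega
      have hc := (Term.lt (.reg i) (.reg h)).cost_le hΛ hBs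
      simp only [Term.cw] at hc
      refine (Hoare.loop_done ?_ ⟨hBs, hFs, hI⟩).mono ?_ (fun _ h => h) ?_
      · have : s'.reg h = k := (hFs.1 h (by simp [hih, hh])).trans hN
        simp [Term.val, hik, this]
      · omega
      · simp
    | succ d ih =>
      intro k s' hk hik hBs hFs hI
      have hc := (Term.lt (.reg i) (.reg h)).cost_le hΛ hBs
      simp only [Term.cw] at hc
      have hsh : s'.reg h = N := (hFs.1 h (by simp [hih, hh])).trans hN
      have hbody : Hoare T O (.seq body (.assign i (.add (.reg i) (.const 1)))) s'
          (t + 10 * Λ) (fun s'' => s''.reg i = k + 1 ∧ Bdd Λ s'' ∧ F s s'' ∧ I (k + 1) s'') (p k) := by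
        have := (hb k (by omega) s' hik hBs hFs hI).and_frame
        refine (this.seq (t' := 10 * Λ) (p' := 1) ?_).mono le_rfl (fun _ h => h) (by simp)
        rintro s1 ⟨⟨hB1, hI1⟩, hF1⟩
        have hi1 : s1.reg i = k := (hF1.1 i hi).trans hik
        have hval : (Term.add (.reg i) (.const 1)).val s1 = k + 1 := by simp [Term.val, hi1]
        have hc1 := (Term.add (.reg i) (.const 1)).cost_le hΛ hB1
        have h1 : Nat.size 1 = 1 := by decide
        simp only [Term.cw, Term.bits, h1] at hc1
        refine (Hoare.assign ?_).mono (by omega) (fun _ h => h) le_rfl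
        rw [hval]
        refine ⟨by simp, hB1.setReg (by omega), hFs.trans ⟨fun x hx => ?_, fun a ha => ?_⟩, hI1⟩
        · simp only [List.mem_cons, not_or] at hx
          simp [hx.1, hF1.1 x hx.2]
        · exact hF1.2 a ha
      have := hbody.seq (t' := d * (t + 20 * Λ) + 10 * Λ)
        fun s1 h1 => ih (k + 1) s1 (by omega) h1.1 h1.2.1 h1.2.2.1 h1.2.2.2
      refine (Hoare.loop_step ?_ this).mono ?_ (fun _ h => h) ?_
      · simp [Term.val, hik, hsh]; omega
      · have : (d + 1) * (t + 20 * Λ) = d * (t + 20 * Λ) + (t + 20 * Λ) := by ring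
        omega
      · rw [Finset.prod_eq_prod_Ico_succ_bot (by omega : k < N)]
  have h1 : Hoare T O (.assign i (.const 0)) s (2 * Λ) (fun s' => s' = s.setReg i 0) 1 := by
    have hc1 := (Term.const 0).cost_le hΛ hB
    simp only [Term.cw, Nat.size_zero] at hc1
    exact (Hoare.assign (by simp [Term.val])).mono (by omega) (fun _ h => h) le_rfl
  refine (h1.seq_one (t' := N * (t + 20 * Λ) + 10 * Λ) ?_).mono (by omega) (fun _ h => h) le_rfl
  rintro s' rfl
  have h2 := key N 0 (s.setReg i 0) (by omega) (by simp) (hB.setReg (by positivity))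
    ⟨fun x hx => by simp only [List.mem_cons, not_or] at hx; simp [hx.1], fun a _ => rfl⟩ h0
  rwa [← Finset.range_eq_Ico] at h2

/-- The rule `Hoare.forLoop` for deterministic bodies. -/
theorem Hoare.forLoop_one {Λ : ℕ} (hΛ : 1 ≤ Λ) {i h N t : ℕ} {body : Program} {s : State}
    (I : ℕ → State → Prop) (hB : Bdd Λ s) (hN : s.reg h = N) (hih : h ≠ i)
    (hi : i ∉ body.wregs) (hh : h ∉ body.wregs) (h0 : I 0 (s.setReg i 0))
    (hb : ∀ k < N, ∀ s', s'.reg i = k → Bdd Λ s' → SameOff (i :: body.wregs) body.warrs s s' →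
      I k s' → Hoare T O body s' t (fun s'' => Bdd Λ s'' ∧ I (k + 1) (s''.setReg i (k + 1))) 1) :
    Hoare T O (VertexCut.forLoop i h body) s (N * (t + 20 * Λ) + 20 * Λ)
      (fun s' => Bdd Λ s' ∧ SameOff (i :: body.wregs) body.warrs s s' ∧ I N s') 1 := by
  simpa using Hoare.forLoop hΛ I (fun _ => 1) hB hN hih hi hh h0 hb

/-- A deterministic loop: `I M` bounds the number of remaining iterations by `M`. -/
theorem Hoare.while {e : Term} {body : Program} {t ce : ℕ} (I : ℕ → State → Prop)
    (hc : ∀ M s, I M s → e.cost s ≤ ce)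
    (hb : ∀ M s, I M s → e.val s ≠ 0 →
      Hoare T O body s t (fun s' => ∃ M' < M, I M' s') 1) {M : ℕ} {s : State} (hI : I M s) :
    Hoare T O (.loop e body) s (M * (1 + ce + t) + (1 + ce))
      (fun s' => e.val s' = 0 ∧ ∃ M', I M' s') 1 := by
  induction M using Nat.strong_induction_on generalizing s with
  | _ M ih =>
    have h1 := hc M s hI
    by_cases he : e.val s = 0
    · exact (Hoare.loop_done he ⟨he, M, hI⟩).mono
        (by have := Nat.zero_le (M * (1 + ce + t)); omega) (fun _ h => h) le_rfl
    · refine (Hoare.loop_step he ((hb M s hI he).seq_one (t' := (M - 1) * (1 + ce + t) + (1 + ce))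
        ?_)).mono ?_ (fun _ h => h) le_rfl
      · rintro s' ⟨M', hM', hI'⟩
        refine (ih M' hM' hI').mono ?_ (fun _ h => h) le_rfl
        have : M' ≤ M - 1 := by omega
        gcongr
      · rcases Nat.eq_zero_or_pos M with rfl | hM
        -- With bound 0 the test cannot be nonzero: the body would have to reach an empty set of
        -- results with probability 1.
        · have := (hb 0 s hI he) 0
          have h0 : (Ends 0 fun s' => ∃ M' < 0, I M' s') = ∅ := by
            ext r; simp [Ends]
          rw [h0] at this
          simp at this
        · obtain ⟨M, rfl⟩ : ∃ k, M = k + 1 := ⟨M - 1, by omega⟩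
          simp only [Nat.add_sub_cancel, Nat.add_mul, one_mul]
          omega

/-! ### Vertex cuts as splits -/

section Graph

variable {n : ℕ} {G H : SimpleGraph (Fin n)} {w : Fin n → ℕ}

/-- `S` separates the nonempty sets `A` and `B`, and every vertex is in one of the three sets. -/
structure IsSplit (G : SimpleGraph (Fin n)) (A S B : Finset (Fin n)) : Prop where
  left : A.Nonempty
  right : B.Nonempty
  disj_left : Disjoint A S
  disj_right : Disjoint B S
  disj : Disjoint A B
  cover : ∀ v, v ∈ S ∨ v ∈ A ∨ v ∈ B
  not_adj : ∀ a ∈ A, ∀ b ∈ B, ¬ G.Adj a b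

theorem IsSplit.symm {A S B : Finset (Fin n)} (h : IsSplit G A S B) : IsSplit G B S A :=
  ⟨h.right, h.left, h.disj_right, h.disj_left, h.disj.symm, fun v => (h.cover v).imp_right Or.symm,
    fun a ha b hb hab => h.not_adj b hb a ha hab.symm⟩

theorem IsSplit.isVertexCut {A S B : Finset (Fin n)} (h : IsSplit G A S B) : IsVertexCut G S := by
  intro hc
  obtain ⟨a, ha⟩ := h.left
  obtain ⟨b, hb⟩ := h.right
  have haS : a ∉ S := Finset.disjoint_left.1 h.disj_left ha
  have hbS : b ∉ S := Finset.disjoint_left.1 h.disj_right hb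
  obtain ⟨p⟩ := hc ⟨a, haS⟩ ⟨b, hbS⟩
  have key : ∀ (u v : {v | v ∉ S}), ((G.induce {v | v ∉ S}).Walk u v) → u.1 ∈ A → v.1 ∈ A := by
    intro u v p
    induction p with
    | nil => exact id
    | @cons u v' w' huv _ ih =>
      intro hu
      refine ih ?_
      have hadj : G.Adj u.1 v'.1 := huv
      rcases h.cover v'.1 with h1 | h1 | h1
      · exact (v'.2 h1).elim
      · exact h1
      · exact (h.not_adj _ hu _ h1 hadj).elim
  exact Finset.disjoint_left.1 h.disj (key _ _ p ha) hb

/-- One side is the component of some vertex, the other one all that remains outside S; the latter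
need not be connected. -/
theorem IsVertexCut.exists_split {S : Finset (Fin n)} (h : IsVertexCut G S) :
    ∃ A B, IsSplit G A S B := by
  classical
  simp only [IsVertexCut, SimpleGraph.Preconnected, not_forall] at h
  obtain ⟨⟨a, ha⟩, ⟨b, hb⟩, hab⟩ := h
  let P : Fin n → Prop := fun v =>
    ∃ hv : v ∉ S, (G.induce {v | v ∉ S}).Reachable ⟨a, ha⟩ ⟨v, hv⟩
  refine ⟨Finset.univ.filter P, Finset.univ.filter fun v => v ∉ S ∧ ¬ P v, ⟨a, ?_⟩, ⟨b, ?_⟩,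
    ?_, ?_, ?_, ?_, ?_⟩
  · simpa using ⟨ha, SimpleGraph.Reachable.refl _⟩
  · simp only [Finset.mem_filter, Finset.mem_univ, true_and]
    exact ⟨hb, fun ⟨_, h⟩ => hab h⟩
  · rw [Finset.disjoint_left]
    intro v hv
    exact (Finset.mem_filter.1 hv).2.1
  · rw [Finset.disjoint_left]
    intro v hv
    exact (Finset.mem_filter.1 hv).2.1
  · rw [Finset.disjoint_left]
    intro v hv hv'
    exact (Finset.mem_filter.1 hv').2.2 (Finset.mem_filter.1 hv).2
  · intro v
    simp only [Finset.mem_filter, Finset.mem_univ, true_and]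
    tauto
  · intro x hx y hy hxy
    simp only [Finset.mem_filter, Finset.mem_univ, true_and] at hx hy
    obtain ⟨hxS, hx⟩ := hx
    refine hy.2 ⟨hy.1, hx.trans (SimpleGraph.Adj.reachable ?_)⟩
    exact hxy

theorem mem_boundary {A : Finset (Fin n)} {v : Fin n} :
    v ∈ boundary G A ↔ v ∉ A ∧ ∃ u ∈ A, G.Adj u v := by
  simp [boundary]

/-- These two conditions on A are easy to test, so no faulty answer of the subroutine can lead to a
false cut. -/
theorem isSplit_boundary {A : Finset (Fin n)} (hA : A.Nonempty)
    (h : ∃ v, v ∉ A ∧ v ∉ boundary G A) :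
    IsSplit G A (boundary G A) (Finset.univ \ (A ∪ boundary G A)) := by
  refine ⟨hA, ?_, ?_, ?_, ?_, ?_, ?_⟩
  · obtain ⟨v, hv⟩ := h
    exact ⟨v, by simpa using hv⟩
  · rw [Finset.disjoint_left]
    intro v hv hv'
    exact (mem_boundary.1 hv').1 hv
  · rw [Finset.disjoint_left]
    intro v hv hv'
    simp [hv'] at hv
  · rw [Finset.disjoint_left]
    intro v hv hv'
    simp [hv] at hv'
  · intro v
    simp only [Finset.mem_sdiff, Finset.mem_univ, true_and, Finset.mem_union]
    tauto
  · intro a ha b hb hab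
    simp only [Finset.mem_sdiff, Finset.mem_univ, true_and, Finset.mem_union, not_or] at hb
    exact hb.2 (mem_boundary.2 ⟨hb.1, a, ha, hab⟩)

theorem IsSplit.boundary_subset {A S B : Finset (Fin n)} (h : IsSplit G A S B) :
    boundary G A ⊆ S := by
  intro v hv
  obtain ⟨hvA, u, hu, huv⟩ := mem_boundary.1 hv
  rcases h.cover v with h1 | h1 | h1
  · exact h1
  · exact (hvA h1).elim
  · exact (h.not_adj u hu v h1 huv).elim

theorem weight_mono {S S' : Finset (Fin n)} (h : S ⊆ S') : weight w S ≤ weight w S' :=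
  Finset.sum_le_sum_of_subset h

theorem IsSplit.weight_univ {A S B : Finset (Fin n)} (h : IsSplit G A S B) :
    weight w Finset.univ = weight w A + weight w S + weight w B := by
  have : (Finset.univ : Finset (Fin n)) = (A ∪ S) ∪ B := by
    ext v
    simpa [or_assoc, or_left_comm] using h.cover v
  rw [this, weight, Finset.sum_union, Finset.sum_union h.disj_left]
  · rfl
  · rw [Finset.disjoint_union_left]
    exact ⟨h.disj, h.disj_right.symm⟩

/-! ### Sampling terminals -/

open Classical in
/-- The members of `Q` that have no smaller neighbour in `Q`: an independent set. -/
noncomputable def thin (G : SimpleGraph (Fin n)) (Q : Finset (Fin n)) : Finset (Fin n) :=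
  Q.filter fun v => ∀ u ∈ Q, u < v → ¬ G.Adj u v

theorem mem_thin {Q : Finset (Fin n)} {v : Fin n} :
    v ∈ thin G Q ↔ v ∈ Q ∧ ∀ u ∈ Q, u < v → ¬ G.Adj u v := by
  simp [thin]

theorem isIndepSet_thin (Q : Finset (Fin n)) : G.IsIndepSet (thin G Q : Set (Fin n)) := by
  intro u hu v hv huv hadj
  rw [Finset.mem_coe, mem_thin] at hu hv
  rcases lt_or_gt_of_ne huv with h | h
  · exact hv.2 u hu.1 h hadj
  · exact hu.2 v hv.1 h hadj.symm

/-- All neighbours of r lie in A ∪ S, where Q contains no vertex besides r; so r survives the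
thinning. -/
theorem IsSplit.thin_left {A S B Q : Finset (Fin n)} (h : IsSplit G A S B) {r : Fin n}
    (hA : Q ∩ A = {r}) (hS : Disjoint Q S) : A ∩ thin G Q = {r} := by
  have hr : r ∈ Q ∩ A := by simp [hA]
  ext v
  simp only [Finset.mem_inter, Finset.mem_singleton, mem_thin]
  constructor
  · rintro ⟨h1, h2, -⟩
    have : v ∈ Q ∩ A := by simp [h1, h2]
    simpa [hA] using this
  · rintro rfl
    rw [Finset.mem_inter] at hr
    refine ⟨hr.2, hr.1, fun u hu huv hadj => ?_⟩
    rcases h.cover u with h1 | h1 | h1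
    · exact Finset.disjoint_left.1 hS hu h1
    · have : u ∈ Q ∩ A := by simp [h1, hu]
      rw [hA, Finset.mem_singleton] at this
      exact huv.ne this
    · exact h.not_adj _ hr.2 u h1 hadj.symm

/-- The smallest sampled vertex of B survives as well: its neighbours lie in B ∪ S, and Q has no
vertex in S and no smaller one in B. -/
theorem IsSplit.two_le_card_thin {A S B Q : Finset (Fin n)} (h : IsSplit G A S B) {r : Fin n}
    (hA : Q ∩ A = {r}) (hS : Disjoint Q S) (hB : (Q ∩ B).Nonempty) : 2 ≤ (thin G Q).card := by
  have h1 := h.thin_left hA hS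
  have hr : r ∈ A ∩ thin G Q := by simp [h1]
  rw [Finset.mem_inter] at hr
  set b := (Q ∩ B).min' hB with hbdef
  have hb := Finset.min'_mem _ hB
  rw [← hbdef, Finset.mem_inter] at hb
  have hbt : b ∈ thin G Q := by
    refine mem_thin.2 ⟨hb.1, fun u hu hub hadj => ?_⟩
    rcases h.cover u with h1 | h1 | h1
    · exact Finset.disjoint_left.1 hS hu h1
    · exact h.not_adj _ h1 _ hb.2 hadj
    · exact absurd (Finset.min'_le (Q ∩ B) u (by simp [hu, h1])) (not_le.2 hub)
  refine Finset.one_lt_card.2 ⟨r, hr.2, b, hbt, ?_⟩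
  rintro rfl
  exact Finset.disjoint_left.1 h.disj hr.1 hb.2

theorem IsSplit.isIsolating {A S B Q : Finset (Fin n)} (h : IsSplit G A S B) {r : Fin n}
    (hA : Q ∩ A = {r}) (hS : Disjoint Q S) : IsIsolating G (thin G Q) A := by
  refine ⟨⟨r, h.thin_left hA hS⟩, ?_⟩
  rw [Finset.disjoint_left]
  intro v hv hvt
  exact Finset.disjoint_left.1 hS (mem_thin.1 hvt).1 (h.boundary_subset hv)

/-- A second terminal lies outside A, which has just one, and outside the boundary, which has none.
So correct answers pass the test of `isSplit_boundary`. -/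
theorem IsIsolating.outside {R A : Finset (Fin n)} (h : IsIsolating G R A) (hR : 2 ≤ R.card) :
    A.Nonempty ∧ ∃ v, v ∉ A ∧ v ∉ boundary G A := by
  obtain ⟨⟨r, hr⟩, hd⟩ := h
  have hrA : r ∈ A ∩ R := by simp [hr]
  rw [Finset.mem_inter] at hrA
  refine ⟨⟨r, hrA.1⟩, ?_⟩
  obtain ⟨v, hv, hvr⟩ := Finset.exists_mem_ne (by omega : 1 < R.card) r
  refine ⟨v, fun hvA => hvr ?_, fun hvb => Finset.disjoint_left.1 hd hvb hv⟩
  have : v ∈ A ∩ R := by simp [hvA, hv]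
  simpa [hr] using this

/-! ### Graphs from edge lists -/

/-- The graph whose edges are listed by `es`. -/
def ofList (es : List (Fin n × Fin n)) : SimpleGraph (Fin n) where
  Adj u v := u ≠ v ∧ ((u, v) ∈ es ∨ (v, u) ∈ es)
  symm := ⟨fun _ _ h => ⟨h.1.symm, h.2.symm⟩⟩
  loopless := ⟨fun _ h => h.1 rfl⟩

theorem IsEdgeList.adj_iff {es : List (Fin n × Fin n)} (h : IsEdgeList G es) {u v : Fin n} :
    G.Adj u v ↔ (u, v) ∈ es ∨ (v, u) ∈ es := by
  rw [← SimpleGraph.mem_edgeSet, ← h.2]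
  simp only [List.mem_map, Prod.exists, Sym2.eq_iff]
  constructor
  · rintro ⟨a, b, hab, ⟨rfl, rfl⟩ | ⟨rfl, rfl⟩⟩
    · exact Or.inl hab
    · exact Or.inr hab
  · rintro (h | h)
    · exact ⟨u, v, h, Or.inl ⟨rfl, rfl⟩⟩
    · exact ⟨v, u, h, Or.inr ⟨rfl, rfl⟩⟩

theorem IsEdgeList.ne {es : List (Fin n × Fin n)} (h : IsEdgeList G es) {e : Fin n × Fin n}
    (he : e ∈ es) : e.1 ≠ e.2 :=
  (h.adj_iff.2 (Or.inl he)).ne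

theorem IsEdgeList.ofList_eq {es : List (Fin n × Fin n)} (h : IsEdgeList G es) :
    ofList es = G := by
  ext u v
  rw [h.adj_iff]
  refine ⟨fun h => h.2, fun h' => ⟨?_, h'⟩⟩
  exact (h.adj_iff.2 h').ne

theorem IsEdgeList.filter {es : List (Fin n × Fin n)} (h : IsEdgeList G es)
    (p : Fin n × Fin n → Bool) : IsEdgeList (ofList (es.filter p)) (es.filter p) := by
  refine ⟨h.1.sublist (List.filter_sublist.map _), fun e => ?_⟩
  induction e using Sym2.ind with
  | _ u v =>
    rw [SimpleGraph.mem_edgeSet]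
    simp only [List.mem_map, Prod.exists, Sym2.eq_iff, ofList]
    constructor
    · rintro ⟨a, b, hab, ⟨rfl, rfl⟩ | ⟨rfl, rfl⟩⟩
      · exact ⟨h.ne (List.mem_of_mem_filter hab), Or.inl hab⟩
      · exact ⟨(h.ne (List.mem_of_mem_filter hab)).symm, Or.inr hab⟩
    · rintro ⟨-, h | h⟩
      · exact ⟨u, v, h, Or.inl ⟨rfl, rfl⟩⟩
      · exact ⟨v, u, h, Or.inr ⟨rfl, rfl⟩⟩

theorem IsEdgeList.length_le {es : List (Fin n × Fin n)} (h : IsEdgeList G es) :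
    es.length ≤ n * n := by
  have h1 : es.Nodup := h.1.of_map _
  have := h1.length_le_card
  simpa using this

end Graph

/-! ### The probability of sampling good terminals -/

section Sampling

variable {n : ℕ} {G : SimpleGraph (Fin n)} {w : Fin n → ℕ}

/-- The probability of the sample `Q` if every vertex `v` is sampled independently with
probability `p v`. -/
def sampleProb (p : Fin n → ℝ) (Q : Finset (Fin n)) : ℝ :=
  ∏ v, if v ∈ Q then p v else 1 - p v

open Classical in
/-- The samples with exactly one vertex in `A`, none in `S` and some in `B`. -/
noncomputable def goodSamples (A S B : Finset (Fin n)) : Finset (Finset (Fin n)) :=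
  Finset.univ.filter fun Q => (∃ r, Q ∩ A = {r}) ∧ Disjoint Q S ∧ (Q ∩ B).Nonempty

theorem mem_goodSamples {A S B Q : Finset (Fin n)} :
    Q ∈ goodSamples A S B ↔ (∃ r, Q ∩ A = {r}) ∧ Disjoint Q S ∧ (Q ∩ B).Nonempty := by
  simp [goodSamples]

/-- The union bound in product form; it bounds from below the chance that nothing else in A ∪ S is
sampled. -/
theorem one_sub_sum_le_prod {ι : Type*} (s : Finset ι) (p : ι → ℝ)
    (hp : ∀ i ∈ s, 0 ≤ p i ∧ p i ≤ 1) : 1 - ∑ i ∈ s, p i ≤ ∏ i ∈ s, (1 - p i) := by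
  classical
  induction s using Finset.induction_on with
  | empty => simp
  | insert a s ha ih =>
    rw [Finset.sum_insert ha, Finset.prod_insert ha]
    have h1 := ih fun i hi => hp i (Finset.mem_insert_of_mem hi)
    have h2 := hp a (Finset.mem_insert_self _ _)
    have h3 : 0 ≤ ∑ i ∈ s, p i :=
      Finset.sum_nonneg fun i hi => (hp i (Finset.mem_insert_of_mem hi)).1
    nlinarith [mul_le_mul_of_nonneg_left h1 (sub_nonneg.2 h2.2), mul_nonneg h2.1 h3]

/-- Induction with (1 - a)(1 + a + s) = 1 + s - a² - as ≤ 1 + s. It shows that a set with sampling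
sum s is hit with probability at least s/(1 + s). -/
theorem prod_mul_one_add_sum_le {ι : Type*} (s : Finset ι) (p : ι → ℝ)
    (hp : ∀ i ∈ s, 0 ≤ p i ∧ p i ≤ 1) : (∏ i ∈ s, (1 - p i)) * (1 + ∑ i ∈ s, p i) ≤ 1 := by
  classical
  induction s using Finset.induction_on with
  | empty => simp
  | insert a s ha ih =>
    rw [Finset.sum_insert ha, Finset.prod_insert ha]
    have h1 := ih fun i hi => hp i (Finset.mem_insert_of_mem hi)
    have h2 := hp a (Finset.mem_insert_self _ _)
    have h3 : 0 ≤ ∑ i ∈ s, p i :=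
      Finset.sum_nonneg fun i hi => (hp i (Finset.mem_insert_of_mem hi)).1
    have h4 : 0 ≤ ∏ i ∈ s, (1 - p i) :=
      Finset.prod_nonneg fun i hi => sub_nonneg.2 (hp i (Finset.mem_insert_of_mem hi)).2
    nlinarith [mul_nonneg h4 (mul_nonneg h2.1 h3), mul_nonneg h4 (mul_nonneg h2.1 h2.1)]

/-- All samples of B have total probability ∏ (p + (1 - p)) = 1, and the empty one has ∏ (1 - p). -/
theorem sum_powerset_nonempty {ι : Type*} [DecidableEq ι] (B : Finset ι) (p : ι → ℝ) :
    ∑ Q ∈ B.powerset.erase ∅, ∏ v ∈ B, (if v ∈ Q then p v else 1 - p v) =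
      1 - ∏ v ∈ B, (1 - p v) := by
  have h1 : ∑ Q ∈ B.powerset, ∏ v ∈ B, (if v ∈ Q then p v else 1 - p v) = 1 := by
    have := Finset.prod_add p (fun v => 1 - p v) B
    simp only [add_sub_cancel, Finset.prod_const_one] at this
    refine Eq.trans (Finset.sum_congr rfl fun Q hQ => ?_) this.symm
    rw [Finset.mem_powerset] at hQ
    rw [Finset.prod_ite]
    congr 2
    · ext v; simp only [Finset.mem_filter]; exact ⟨fun h => h.2, fun h => ⟨hQ h, h⟩⟩
    · ext v; simp
  have h2 := Finset.add_sum_erase B.powerset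
    (fun Q => ∏ v ∈ B, (if v ∈ Q then p v else 1 - p v)) (Finset.empty_mem_powerset B)
  rw [h1] at h2
  simp only [Finset.notMem_empty, if_false] at h2
  linarith

theorem IsSplit.prod_univ {A S B : Finset (Fin n)} (h : IsSplit G A S B) (f : Fin n → ℝ) :
    ∏ v, f v = (∏ v ∈ A, f v) * (∏ v ∈ S, f v) * ∏ v ∈ B, f v := by
  have : (Finset.univ : Finset (Fin n)) = (A ∪ S) ∪ B := by
    ext v
    simpa [or_assoc, or_left_comm] using h.cover v
  rw [this, Finset.prod_union, Finset.prod_union h.disj_left]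
  rw [Finset.disjoint_union_left]
  exact ⟨h.disj, h.disj_right.symm⟩

/-- The sets {r} ∪ Q' with r in A and Q' a nonempty subset of B are distinct good samples. Such a
sample has probability p(r) ∏ (1 - p) over A - r and S, times the probability of Q' within B; the
product is at least 1 minus the sum of p over A ∪ S, and the sum over Q' is the probability that B
is hit. -/
theorem IsSplit.le_sum_sampleProb {A S B : Finset (Fin n)} (h : IsSplit G A S B) (p : Fin n → ℝ)
    (hp : ∀ v, 0 ≤ p v ∧ p v ≤ 1) :
    (∑ r ∈ A, p r) * (1 - ∑ v ∈ A, p v - ∑ v ∈ S, p v) * (1 - ∏ v ∈ B, (1 - p v)) ≤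
      ∑ Q ∈ goodSamples A S B, sampleProb p Q := by
  have hB0 : 0 ≤ 1 - ∏ v ∈ B, (1 - p v) := by
    have : ∏ v ∈ B, (1 - p v) ≤ 1 :=
      Finset.prod_le_one (fun v _ => sub_nonneg.2 (hp v).2) fun v _ => by linarith [(hp v).1]
    linarith
  have hS0 : 0 ≤ ∏ v ∈ S, (1 - p v) := Finset.prod_nonneg fun v _ => sub_nonneg.2 (hp v).2
  have hdA : ∀ {v}, v ∈ A → v ∉ S ∧ v ∉ B := fun hv =>
    ⟨Finset.disjoint_left.1 h.disj_left hv, Finset.disjoint_left.1 h.disj hv⟩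
  have hdB : ∀ {v}, v ∈ B → v ∉ S ∧ v ∉ A := fun hv =>
    ⟨Finset.disjoint_left.1 h.disj_right hv, fun h' => Finset.disjoint_left.1 h.disj h' hv⟩
  have hsub : (A ×ˢ (B.powerset.erase ∅)).image (fun x => insert x.1 x.2) ⊆
      goodSamples A S B := by
    intro Q hQ
    simp only [Finset.mem_image, Finset.mem_product, Finset.mem_erase, Finset.mem_powerset,
      Prod.exists] at hQ
    obtain ⟨r, Q', ⟨hr, hne, hQ'⟩, rfl⟩ := hQ
    refine mem_goodSamples.2 ⟨⟨r, ?_⟩, ?_, ?_⟩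
    · ext v
      simp only [Finset.mem_inter, Finset.mem_insert, Finset.mem_singleton]
      constructor
      · rintro ⟨rfl | h1, h2⟩
        · rfl
        · exact ((hdB (hQ' h1)).2 h2).elim
      · rintro rfl
        exact ⟨Or.inl rfl, hr⟩
    · rw [Finset.disjoint_left]
      intro v hv
      rcases Finset.mem_insert.1 hv with rfl | h1
      · exact (hdA hr).1
      · exact (hdB (hQ' h1)).1
    · obtain ⟨b, hb⟩ := Finset.nonempty_iff_ne_empty.2 hne
      exact ⟨b, by simp [hb, hQ' hb]⟩
  have hinj : Set.InjOn (fun x : Fin n × Finset (Fin n) => insert x.1 x.2)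
      (A ×ˢ (B.powerset.erase ∅) : Finset _) := by
    rintro ⟨r, Q⟩ hx ⟨r', Q'⟩ hx' heq
    simp only [Finset.coe_product, Set.mem_prod, Finset.mem_coe, Finset.mem_erase,
      Finset.mem_powerset] at hx hx' heq
    have hrr : r = r' := by
      have : r ∈ insert r' Q' := heq ▸ Finset.mem_insert_self _ _
      rcases Finset.mem_insert.1 this with h1 | h1
      · exact h1
      · exact ((hdB (hx'.2.2 h1)).2 hx.1).elim
    subst hrr
    have h1 : r ∉ Q := fun h1 => (hdB (hx.2.2 h1)).2 hx.1
    have h2 : r ∉ Q' := fun h1 => (hdB (hx'.2.2 h1)).2 hx.1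
    have : Q = Q' := by rw [← Finset.erase_insert h1, ← Finset.erase_insert h2, heq]
    rw [this]
  have hterm : ∀ x ∈ A ×ˢ (B.powerset.erase ∅), p x.1 * (1 - ∑ v ∈ A, p v - ∑ v ∈ S, p v) *
      (∏ v ∈ B, if v ∈ x.2 then p v else 1 - p v) ≤ sampleProb p (insert x.1 x.2) := by
    rintro ⟨r, Q⟩ hx
    simp only [Finset.mem_product, Finset.mem_erase, Finset.mem_powerset] at hx
    obtain ⟨hr, -, hQ⟩ := hx
    rw [sampleProb, h.prod_univ]
    have eB : ∏ v ∈ B, (if v ∈ insert r Q then p v else 1 - p v) =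
        ∏ v ∈ B, if v ∈ Q then p v else 1 - p v := by
      refine Finset.prod_congr rfl fun v hv => ?_
      have : v ≠ r := by rintro rfl; exact (hdA hr).2 hv
      simp [this]
    have eS : ∏ v ∈ S, (if v ∈ insert r Q then p v else 1 - p v) = ∏ v ∈ S, (1 - p v) := by
      refine Finset.prod_congr rfl fun v hv => ?_
      rw [if_neg]
      intro h1
      rcases Finset.mem_insert.1 h1 with rfl | h1
      · exact (hdA hr).1 hv
      · exact (hdB (hQ h1)).1 hv
    have eA : ∏ v ∈ A, (if v ∈ insert r Q then p v else 1 - p v) =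
        p r * ∏ v ∈ A.erase r, (1 - p v) := by
      rw [← Finset.mul_prod_erase A _ hr]
      congr 1
      · simp
      · refine Finset.prod_congr rfl fun v hv => ?_
        rw [Finset.mem_erase] at hv
        rw [if_neg]
        intro h1
        rcases Finset.mem_insert.1 h1 with h1 | h1
        · exact hv.1 h1
        · exact (hdB (hQ h1)).2 hv.2
    rw [eA, eS, eB]
    have hB1 : 0 ≤ ∏ v ∈ B, (if v ∈ Q then p v else 1 - p v) := by
      refine Finset.prod_nonneg fun v _ => ?_
      split_ifs
      · exact (hp v).1
      · exact sub_nonneg.2 (hp v).2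
    refine mul_le_mul_of_nonneg_right ?_ hB1
    rw [mul_assoc]
    refine mul_le_mul_of_nonneg_left ?_ (hp r).1
    rw [← Finset.prod_union (h.disj_left.mono_left (Finset.erase_subset _ _))]
    refine le_trans ?_ (one_sub_sum_le_prod _ p fun v _ => hp v)
    rw [Finset.sum_union (h.disj_left.mono_left (Finset.erase_subset _ _))]
    have := Finset.sum_le_sum_of_subset_of_nonneg (Finset.erase_subset r A)
      (fun v _ _ => (hp v).1)
    linarith
  calc _ = ∑ x ∈ A ×ˢ (B.powerset.erase ∅), p x.1 * (1 - ∑ v ∈ A, p v - ∑ v ∈ S, p v) *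
      (∏ v ∈ B, if v ∈ x.2 then p v else 1 - p v) := by
        rw [← sum_powerset_nonempty, Finset.sum_product, Finset.sum_mul, Finset.sum_mul]
        exact Finset.sum_congr rfl fun r _ => Finset.mul_sum _ _ _
    _ ≤ ∑ x ∈ A ×ˢ (B.powerset.erase ∅), sampleProb p (insert x.1 x.2) := Finset.sum_le_sum hterm
    _ = ∑ Q ∈ (A ×ˢ (B.powerset.erase ∅)).image (fun x => insert x.1 x.2), sampleProb p Q := by
        rw [Finset.sum_image hinj]
    _ ≤ _ := by
        refine Finset.sum_le_sum_of_subset_of_nonneg hsub fun Q _ _ => ?_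
        refine Finset.prod_nonneg fun v _ => ?_
        split_ifs
        · exact (hp v).1
        · exact sub_nonneg.2 (hp v).2

/-- The weight `c` is affordable with `X` iterations; `W` is the total weight. -/
def Acc (W X c : ℕ) : Prop := c * c ≤ X ∨ c * W ≤ X * (W - c)

theorem Acc.anti {W X c c' : ℕ} (h : Acc W X c) (hc : c' ≤ c) : Acc W X c' := by
  rcases h with h | h
  · exact Or.inl ((Nat.mul_le_mul hc hc).trans h)
  · exact Or.inr ((Nat.mul_le_mul_right _ hc).trans
      (h.trans (Nat.mul_le_mul_left _ (Nat.sub_le_sub_left hc _))))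

theorem Acc.mono {W X X' c : ℕ} (h : Acc W X c) (hX : X ≤ X') : Acc W X' c := by
  rcases h with h | h
  · exact Or.inl (h.trans hX)
  · exact Or.inr (h.trans (Nat.mul_le_mul_right _ hX))

/-- Used in contrapositive form: doubling the number of iterations at most doubles the affordable
weights. -/
theorem Acc.half {W X c : ℕ} (h : Acc W (2 * X) (2 * c)) : Acc W X c := by
  rcases h with h | h
  · left; nlinarith
  · right
    have : X * (W - 2 * c) ≤ X * (W - c) := Nat.mul_le_mul_left _ (by omega)
    nlinarith

/-- The inclusion probability of a vertex of weight `k` at scale `i`. -/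
noncomputable def inclProb (i k : ℕ) : ℝ := (min (2 ^ i) k : ℕ) / 2 ^ i

theorem inclProb_nonneg (i k : ℕ) : 0 ≤ inclProb i k := by unfold inclProb; positivity

theorem inclProb_le_one (i k : ℕ) : inclProb i k ≤ 1 := by
  unfold inclProb
  rw [div_le_one (by positivity)]
  exact_mod_cast min_le_left _ _

/-- With M = max(κ, a) and 2^i between 4M and 8M, the expected numbers of samples in A and in S are
at most 1/4 each. This gives the lower bound a/(16M) · min(b, 8M)/(16M), and `hmain` compares it
with 1/(512X). -/
theorem IsSplit.exists_scale {A S B : Finset (Fin n)} (h : IsSplit G A S B)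
    (hw : ∀ v, 1 ≤ w v) (hAB : weight w A ≤ weight w B) {X : ℕ} (hX : 1 ≤ X)
    (hacc : Acc (weight w Finset.univ) X (weight w S)) :
    ∃ i, 2 ^ i ≤ 8 * weight w Finset.univ ∧
      1 / (512 * X : ℝ) ≤
        ∑ Q ∈ goodSamples A S B, sampleProb (fun v => inclProb i (w v)) Q := by
  set a := weight w A with ha
  set b := weight w B with hb
  set κ := weight w S with hκ
  have hW := h.weight_univ (w := w)
  rw [← ha, ← hb, ← hκ] at hW
  set W := weight w Finset.univ
  have one_le : ∀ {C : Finset (Fin n)}, C.Nonempty → 1 ≤ weight w C := by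
    intro C hC
    obtain ⟨v, hv⟩ := hC
    exact (hw v).trans (Finset.single_le_sum (f := w) (fun _ _ => Nat.zero_le _) hv)
  have ha1 : 1 ≤ a := one_le h.left
  have hb1 : 1 ≤ b := one_le h.right
  set M := max κ a with hM
  have hM1 : 1 ≤ M := ha1.trans (le_max_right _ _)
  have hMW : M ≤ W := max_le (by omega) (by omega)
  obtain ⟨i, hi1, hi2⟩ : ∃ i, 4 * M ≤ 2 ^ i ∧ 2 ^ i ≤ 8 * M := by
    refine ⟨Nat.clog 2 (4 * M), Nat.le_pow_clog (by norm_num) _, ?_⟩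
    have h1 := Nat.pow_pred_clog_lt_self (b := 2) (by norm_num) (x := 4 * M) (by omega)
    have h2 : 0 < Nat.clog 2 (4 * M) := Nat.clog_pos (by norm_num) (by omega)
    obtain ⟨k, hk⟩ : ∃ k, Nat.clog 2 (4 * M) = k + 1 := ⟨_, (Nat.succ_pred_eq_of_pos h2).symm⟩
    rw [hk] at h1 ⊢
    simp only [Nat.pred_eq_sub_one, Nat.add_sub_cancel] at h1
    rw [pow_succ]
    omega
  refine ⟨i, hi2.trans (by omega), le_trans ?_ (h.le_sum_sampleProb _ fun v =>
    ⟨inclProb_nonneg _ _, inclProb_le_one _ _⟩)⟩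
  have sum_eq : ∀ C : Finset (Fin n), weight w C ≤ M →
      ∑ v ∈ C, inclProb i (w v) = (weight w C : ℝ) / 2 ^ i := by
    intro C hC
    rw [weight, Nat.cast_sum, Finset.sum_div]
    refine Finset.sum_congr rfl fun v hv => ?_
    have : w v ≤ weight w C := Finset.single_le_sum (f := w) (fun _ _ => Nat.zero_le _) hv
    rw [inclProb, min_eq_right (by omega)]
  rw [sum_eq A (le_max_right _ _), sum_eq S (le_max_left _ _), ← ha, ← hκ]
  have hMr : (1 : ℝ) ≤ M := by exact_mod_cast hM1
  have hi1r : (4 * M : ℝ) ≤ 2 ^ i := by exact_mod_cast hi1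
  have hi2r : (2 ^ i : ℝ) ≤ 8 * M := by exact_mod_cast hi2
  have hpos : (0 : ℝ) < 2 ^ i := by positivity
  have har : (1 : ℝ) ≤ a := by exact_mod_cast ha1
  have hbr : (1 : ℝ) ≤ b := by exact_mod_cast hb1
  have haM : (a : ℝ) ≤ M := by exact_mod_cast le_max_right κ a
  have hκM : (κ : ℝ) ≤ M := by exact_mod_cast le_max_left κ a
  have hXr : (1 : ℝ) ≤ X := by exact_mod_cast hX
  -- the factor for `B`
  have hB : (min b (8 * M) : ℕ) / (16 * M : ℝ) ≤ 1 - ∏ v ∈ B, (1 - inclProb i (w v)) := by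
    have h1 := prod_mul_one_add_sum_le B (fun v => inclProb i (w v)) fun v _ =>
      ⟨inclProb_nonneg _ _, inclProb_le_one _ _⟩
    have h0 : 0 ≤ ∏ v ∈ B, (1 - inclProb i (w v)) :=
      Finset.prod_nonneg fun v _ => sub_nonneg.2 (inclProb_le_one _ _)
    have h2 : (min b (8 * M) : ℕ) / (8 * M : ℝ) ≤ ∑ v ∈ B, inclProb i (w v) := by
      -- Only in B can a weight exceed 2^i, and a vertex of such a weight is sampled with certainty.
      by_cases hall : ∀ v ∈ B, w v ≤ 2 ^ i
      · have : ∑ v ∈ B, inclProb i (w v) = (b : ℝ) / 2 ^ i := by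
          rw [hb, weight, Nat.cast_sum, Finset.sum_div]
          refine Finset.sum_congr rfl fun v hv => ?_
          rw [inclProb, min_eq_right (hall v hv)]
        rw [this]
        gcongr
        exact min_le_left _ _
      · push Not at hall
        obtain ⟨v, hv, hvw⟩ := hall
        have h3 : inclProb i (w v) = 1 := by
          rw [inclProb, min_eq_left hvw.le]
          push_cast
          exact div_self hpos.ne'
        have h4 := Finset.single_le_sum (f := fun v => inclProb i (w v))
          (fun v _ => inclProb_nonneg _ _) hv
        simp only [h3] at h4
        refine le_trans ?_ h4
        rw [div_le_one (by positivity)]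
        exact_mod_cast min_le_right _ _
    have h5 : (min b (8 * M) : ℕ) / (8 * M : ℝ) ≤ 1 := by
      rw [div_le_one (by positivity)]
      exact_mod_cast min_le_right _ _
    have h6 : (min b (8 * M) : ℕ) / (16 * M : ℝ) = ((min b (8 * M) : ℕ) / (8 * M : ℝ)) / 2 := by
      rw [div_div]; congr 1; ring
    rw [h6]
    have h7 : 0 ≤ (min b (8 * M) : ℕ) / (8 * M : ℝ) := by positivity
    generalize (min b (8 * M) : ℕ) / (8 * M : ℝ) = y at *
    generalize ∑ v ∈ B, inclProb i (w v) = x at *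
    generalize ∏ v ∈ B, (1 - inclProb i (w v)) = z at *
    have h8 : z * (1 + y) ≤ 1 := le_trans (by nlinarith) h1
    nlinarith
  have hA : (a : ℝ) / (16 * M) ≤ (a : ℝ) / 2 ^ i * (1 - a / 2 ^ i - κ / 2 ^ i) := by
    have h1 : (a : ℝ) / (8 * M) ≤ a / 2 ^ i := by gcongr
    have h2 : (1 : ℝ) / 2 ≤ 1 - a / 2 ^ i - κ / 2 ^ i := by
      have e1 : (a : ℝ) / 2 ^ i ≤ 1 / 4 := by
        rw [div_le_div_iff₀ hpos (by norm_num)]; linarith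
      have e2 : (κ : ℝ) / 2 ^ i ≤ 1 / 4 := by
        rw [div_le_div_iff₀ hpos (by norm_num)]; linarith
      linarith
    calc (a : ℝ) / (16 * M) = a / (8 * M) * (1 / 2) := by
          rw [div_mul_div_comm]; congr 1 <;> ring
      _ ≤ _ := by gcongr
  refine le_trans ?_ (mul_le_mul hA hB (by positivity) (by
    refine le_trans ?_ hA; positivity))
  rw [div_mul_div_comm, div_le_div_iff₀ (by positivity) (by positivity)]
  -- If κ ≤ a, then M = a ≤ min(b, 8M). If a ≤ κ ≤ b, then either form of affordability gives κ ≤ X.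
  -- If κ ≥ a and κ ≥ b, then the minimum is b, and κ² ≤ X or κ² ≤ κW ≤ X(a + b) with a + b ≤ 2ab.
  have hmain : M * M ≤ 2 * X * (a * min b (8 * M)) := by
    rcases le_total κ a with hκa | hκa
    · have hMa : M = a := max_eq_right hκa
      have : a ≤ min b (8 * M) := le_min hAB (by omega)
      rw [hMa] at this ⊢
      nlinarith [Nat.mul_le_mul_left a this]
    · have hMκ : M = κ := max_eq_left hκa
      rw [hMκ] at hM1 ⊢
      rcases le_total κ b with hκb | hκb
      · have h1 : κ ≤ min b (8 * κ) := le_min hκb (by omega)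
        have h2 : κ ≤ X := by
          rcases hacc with h | h
          · nlinarith
          · have : X * (W - κ) ≤ X * W := Nat.mul_le_mul_left _ (Nat.sub_le _ _)
            exact Nat.le_of_mul_le_mul_right (h.trans this) (by omega)
        calc κ * κ ≤ X * (1 * κ) := by nlinarith
          _ ≤ 2 * X * (a * min b (8 * κ)) := by
            gcongr
            omega
      · have h1 : min b (8 * κ) = b := min_eq_left (by omega)
        rw [h1]
        have hab : a + b ≤ 2 * (a * b) := by nlinarith
        rcases hacc with h | h
        · nlinarith [Nat.mul_le_mul ha1 hb1]
        · have e1 : W - κ = a + b := by omega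
          rw [e1] at h
          calc κ * κ ≤ κ * W := Nat.mul_le_mul_left _ (by omega)
            _ ≤ X * (a + b) := h
            _ ≤ X * (2 * (a * b)) := Nat.mul_le_mul_left _ hab
            _ = _ := by ring
  have hmr : (M * M : ℝ) ≤ 2 * X * (a * (min b (8 * M) : ℕ)) := by exact_mod_cast hmain
  nlinarith

end Sampling

/-! ### One iteration: sample terminals, call the subroutine, evaluate the answer -/

section Iteration

variable {n : ℕ} {w : Fin n → ℕ} {es : List (Fin n × Fin n)}

/-- Array `a` holds the bit vector of `S`. -/
def Bits (s : State) (a : ℕ) (S : Finset (Fin n)) : Prop :=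
  ∀ v : Fin n, s.arr a v = if v ∈ S then 1 else 0

theorem Bits.injective {s : State} {a : ℕ} {S S' : Finset (Fin n)} (h : Bits s a S)
    (h' : Bits s a S') : S = S' := by
  ext v
  have := (h v).symm.trans (h' v)
  split_ifs at this with h1 h2 h2 <;> simp_all

theorem Bits.congr {s s' : State} {a : ℕ} {S : Finset (Fin n)} (h : Bits s a S)
    (hs : s'.arr a = s.arr a) : Bits s' a S := fun v => by rw [hs]; exact h v

/-- The registers and arrays of `s` hold the graph with edge list `es` and weights `w`. -/
structure Holds (s : State) (w : Fin n → ℕ) (es : List (Fin n × Fin n)) : Prop where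
  reg_n : s.reg 0 = n
  reg_m : s.reg 18 = es.length
  src : ∀ i (h : i < es.length), s.arr 8 i = es[i].1
  dst : ∀ i (h : i < es.length), s.arr 9 i = es[i].2
  wt : ∀ v : Fin n, s.arr 2 v = w v

theorem Holds.congr {s s' : State} (h : Holds s w es) (h0 : s'.reg 0 = s.reg 0)
    (h18 : s'.reg 18 = s.reg 18) (h8 : s'.arr 8 = s.arr 8) (h9 : s'.arr 9 = s.arr 9)
    (h2 : s'.arr 2 = s.arr 2) : Holds s' w es :=
  ⟨h0.trans h.reg_n, h18.trans h.reg_m, fun i hi => by rw [h8]; exact h.src i hi,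
    fun i hi => by rw [h9]; exact h.dst i hi, fun v => by rw [h2]; exact h.wt v⟩

theorem ite_lt_two_pow {Λ : ℕ} (hΛ : 1 ≤ Λ) (p : Prop) [Decidable p] :
    (if p then 1 else 0) < 2 ^ Λ := by
  have h21 : 2 ^ 1 ≤ 2 ^ Λ := Nat.pow_le_pow_right (by norm_num) hΛ
  split_ifs <;> omega

theorem loop_time_le {N c Λ : ℕ} (hc : c ≤ 80) :
    N * (c * Λ + 20 * Λ) + 20 * Λ ≤ (N + 1) * (100 * Λ) := by
  have := Nat.mul_le_mul_left N (Nat.mul_le_mul_right Λ hc)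
  nlinarith

/-- Draw the sample bit of vertex `reg 11` at scale `reg 10`. -/
def sampleBody : Program :=
  .seq (.rand 13 (.reg 10))
    (.seq (.store 4 (.reg 11) (.lt (.reg 13) (.cell 2 (.reg 11))))
      (.seq (.store 5 (.reg 11) (.cell 4 (.reg 11))) (.store 7 (.reg 11) (.const 0))))

theorem card_filter_fin_lt (N k : ℕ) :
    (Finset.univ.filter fun v : Fin N => v.val < k).card = min N k := by
  rw [Fin.card_filter_val_lt]

theorem ofReal_inclProb (i k : ℕ) :
    ENNReal.ofReal (inclProb i k) = (min (2 ^ i) k : ℕ) / 2 ^ i := by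
  rw [inclProb, ENNReal.ofReal_div_of_pos (by positivity), ENNReal.ofReal_natCast]
  congr 1
  rw [ENNReal.ofReal_pow (by norm_num)]
  norm_num

theorem ofReal_one_sub_inclProb (i k : ℕ) :
    ENNReal.ofReal (1 - inclProb i k) = (2 ^ i - min (2 ^ i) k : ℕ) / 2 ^ i := by
  have : 1 - inclProb i k = ((2 ^ i - min (2 ^ i) k : ℕ) : ℝ) / 2 ^ i := by
    rw [inclProb, Nat.cast_sub (min_le_left _ _), sub_div]
    push_cast
    rw [div_self (by positivity)]
  rw [this, ENNReal.ofReal_div_of_pos (by positivity), ENNReal.ofReal_natCast]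
  congr 1
  rw [ENNReal.ofReal_pow (by norm_num)]
  norm_num

/-- A random i-bit number is below w(v) with probability min(2^i, w(v))/2^i, so sampling needs no
fractions. The bit is stored twice because array 5 will be thinned while array 4 keeps the sample;
the cell of array 7 is cleared for the boundary. -/
theorem hoare_sampleBody {Λ i k : ℕ} (hΛ : 1 ≤ Λ) {s : State} (hB : Bdd Λ s) (hi : s.reg 10 = i)
    (hiΛ : i ≤ Λ) (hk : s.reg 11 = k) (b : Bool) :
    Hoare T O sampleBody s (40 * Λ)
      (fun s' => Bdd Λ s' ∧ s'.arr 4 k = b.toNat ∧ s'.arr 5 k = b.toNat ∧ s'.arr 7 k = 0 ∧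
        ∀ j ≠ k, s'.arr 4 j = s.arr 4 j ∧ s'.arr 5 j = s.arr 5 j ∧ s'.arr 7 j = s.arr 7 j)
      (ENNReal.ofReal (if b then inclProb i (s.arr 2 k) else 1 - inclProb i (s.arr 2 k))) := by
  have hc := (Term.reg 10).cost_le hΛ hB
  simp only [Term.cw] at hc
  have hval : (Term.reg 10).val s = i := hi
  have h21 : 2 ^ 1 ≤ 2 ^ Λ := Nat.pow_le_pow_right (by norm_num) hΛ
  have h2i : 2 ^ i ≤ 2 ^ Λ := Nat.pow_le_pow_right (by norm_num) hiΛ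
  have hrest : ∀ x < 2 ^ i, (decide (x < s.arr 2 k) = b) →
      Hoare T O (.seq (.store 4 (.reg 11) (.lt (.reg 13) (.cell 2 (.reg 11))))
        (.seq (.store 5 (.reg 11) (.cell 4 (.reg 11))) (.store 7 (.reg 11) (.const 0))))
        (s.setReg 13 x) (30 * Λ)
      (fun s' => Bdd Λ s' ∧ s'.arr 4 k = b.toNat ∧ s'.arr 5 k = b.toNat ∧ s'.arr 7 k = 0 ∧
        ∀ j ≠ k, s'.arr 4 j = s.arr 4 j ∧ s'.arr 5 j = s.arr 5 j ∧ s'.arr 7 j = s.arr 7 j) 1 := by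
    intro x hx hxb
    have hB' : Bdd Λ (s.setReg 13 x) := hB.setReg (by omega)
    refine (Hoare.straight hΛ hB' ?_ ?_).mono (Nat.mul_le_mul_right Λ (by decide)) (fun _ h => h)
      le_rfl
    · simp only [Program.Ok, Program.eff, Term.val]
      simp [hk]
      exact ite_lt_two_pow hΛ _
    · intro hB''
      refine ⟨hB'', ?_⟩
      simp only [Program.eff, Term.val]
      subst hxb
      by_cases hlt : x < s.arr 2 k
      · simp +contextual [hk, hlt]
      · simp +contextual [hk, hlt]
  set Z : Finset (Fin (2 ^ (Term.reg 10).val s)) :=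
    Finset.univ.filter fun x => decide (x.val < s.arr 2 k) = b with hZ
  have hr := Hoare.rand (T := T) (O := O) (x := 13)
    (Q := fun s' => ∃ x < 2 ^ i, decide (x < s.arr 2 k) = b ∧ s' = s.setReg 13 x) Z
    (fun v hv => ⟨v.1, lt_of_lt_of_eq v.2 (congrArg (2 ^ ·) hval), (Finset.mem_filter.1 hv).2, rfl⟩)
  refine (hr.seq (p' := 1) (t' := 30 * Λ) ?_).mono ?_ (fun _ h => h) ?_
  · rintro s' ⟨x, hx, hxb, rfl⟩
    exact hrest x hx hxb
  · rw [hval]; omega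
  · rw [mul_one]
    have e2 : 2 ^ (Term.reg 10).val s = 2 ^ i := congrArg (2 ^ ·) hval
    have h1 := card_filter_fin_lt (2 ^ (Term.reg 10).val s) (s.arr 2 k)
    have hcard : Z.card = if b then min (2 ^ i) (s.arr 2 k) else 2 ^ i - min (2 ^ i) (s.arr 2 k) := by
      cases b
      · have h2 := Finset.card_filter_add_card_filter_not (s := Finset.univ)
          fun v : Fin (2 ^ (Term.reg 10).val s) => v.val < s.arr 2 k
        rw [h1, Finset.card_univ, Fintype.card_fin] at h2
        simp only [Bool.false_eq_true, if_false]
        have : Z = Finset.univ.filter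
            fun v : Fin (2 ^ (Term.reg 10).val s) => ¬ v.val < s.arr 2 k := by
          rw [hZ]; ext v; simp
        rw [this]
        omega
      · have : Z = Finset.univ.filter
            fun v : Fin (2 ^ (Term.reg 10).val s) => v.val < s.arr 2 k := by
          rw [hZ]; ext v; simp
        rw [this, h1, e2, if_pos rfl]
    rw [hcard, hval]
    cases b
    · simp [ofReal_one_sub_inclProb]
    · simp [ofReal_inclProb]

/-- For one fixed sample Q the probabilities of the bits multiply to `sampleProb`. Different samples
exclude each other, so their probabilities add up by `Hoare.sum`. -/
theorem hoare_sampleLoop {Λ i : ℕ} (hΛ : 1 ≤ Λ) {s : State} (hB : Bdd Λ s) (hn : s.reg 0 = n)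
    (hwt : ∀ v : Fin n, s.arr 2 v = w v) (hi : s.reg 10 = i) (hiΛ : i ≤ Λ)
    (F : Finset (Finset (Fin n))) :
    Hoare T O (forLoop 11 0 sampleBody) s ((n + 1) * (60 * Λ))
      (fun s' => ∃ Q ∈ F, Bdd Λ s' ∧ SameOff [11, 13] [4, 5, 7] s s' ∧ Bits s' 4 Q ∧ Bits s' 5 Q ∧
        Bits s' 7 (∅ : Finset (Fin n)))
      (∑ Q ∈ F, ENNReal.ofReal (sampleProb (fun v => inclProb i (w v)) Q)) := by
  refine Hoare.sum F _ _ (fun Q _ => ?_)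
    (fun Q _ Q' _ s' h h' => Bits.injective h.2.2.1 h'.2.2.1)
  let q : ℕ → Bool := fun k => if h : k < n then decide (⟨k, h⟩ ∈ Q) else false
  let p : ℕ → ℝ≥0∞ := fun k =>
    ENNReal.ofReal (if q k then inclProb i (s.arr 2 k) else 1 - inclProb i (s.arr 2 k))
  refine (Hoare.forLoop hΛ (t := 40 * Λ) (N := n)
    (fun k s' => ∀ j < k, s'.arr 4 j = (q j).toNat ∧ s'.arr 5 j = (q j).toNat ∧ s'.arr 7 j = 0) p
    hB hn (by decide) (by decide) (by decide) (fun j hj => by omega) ?_).mono ?_ ?_ ?_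
  · intro k hk s' hks hBs hF hI
    have h10 : s'.reg 10 = i := (hF.1 10 (by decide)).trans hi
    have h2 : s'.arr 2 = s.arr 2 := hF.2 2 (by decide)
    have := hoare_sampleBody (T := T) (O := O) hΛ hBs h10 hiΛ hks (q k)
    rw [h2] at this
    refine this.post fun s'' ⟨hB', h4, h5, h7, hj⟩ => ⟨hB', fun j hjk => ?_⟩
    rcases Nat.lt_succ_iff_lt_or_eq.1 hjk with h | rfl
    · obtain ⟨e4, e5, e7⟩ := hj j h.ne
      simpa [e4, e5, e7] using hI j h
    · exact ⟨h4, h5, h7⟩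
  · nlinarith
  · rintro s' ⟨h1, h2, h3⟩
    refine ⟨h1, h2.mono (by decide) (by decide), fun v => ?_, fun v => ?_, fun v => ?_⟩
    · rw [(h3 v v.2).1]; simp [q, Bool.toNat]
    · rw [(h3 v v.2).2.1]; simp [q, Bool.toNat]
    · rw [(h3 v v.2).2.2]; simp
  · rw [Finset.prod_range, sampleProb, ENNReal.ofReal_prod_of_nonneg]
    · refine (Finset.prod_congr rfl fun v _ => ?_).le
      simp only [p, q, v.2, dif_pos, decide_eq_true_eq, hwt]
    · intro v _
      split_ifs
      · exact inclProb_nonneg _ _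
      · exact sub_nonneg.2 (inclProb_le_one _ _)

/-- Remove the larger end of edge `reg 12` from the terminals if both ends are sampled. -/
def thinBody : Program :=
  .branch (.mul (.cell 4 (.cell 8 (.reg 12))) (.cell 4 (.cell 9 (.reg 12))))
    (.branch (.lt (.cell 8 (.reg 12)) (.cell 9 (.reg 12)))
      (.store 5 (.cell 9 (.reg 12)) (.const 0)) (.store 5 (.cell 8 (.reg 12)) (.const 0)))
    .skip

-- A new edge removes the larger of its ends if both are in Q. The test refers to the whole sample
-- and not to what is left of it, so the edges may be treated in any order.
open Classical in
theorem thin_ofList_append {l : List (Fin n × Fin n)} {x y : Fin n} (hxy : x ≠ y)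
    (Q : Finset (Fin n)) : thin (ofList (l ++ [(x, y)])) Q =
      if x ∈ Q ∧ y ∈ Q then (thin (ofList l) Q).erase (max x y) else thin (ofList l) Q := by
  ext v
  split_ifs with h
  · rw [Finset.mem_erase, mem_thin, mem_thin]
    simp only [ofList, List.mem_append, List.mem_singleton, Prod.mk.injEq]
    constructor
    · rintro ⟨h1, h2⟩
      refine ⟨?_, h1, fun u hu huv hadj => h2 u hu huv (by tauto)⟩
      rintro rfl
      rcases lt_or_gt_of_ne hxy with h3 | h3
      · rw [max_eq_right h3.le] at h2
        exact h2 x h.1 h3 (by tauto)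
      · rw [max_eq_left h3.le] at h2
        exact h2 y h.2 h3 (by tauto)
    · rintro ⟨h1, h2, h3⟩
      refine ⟨h2, fun u hu huv hadj => ?_⟩
      obtain ⟨hne, (h4 | ⟨rfl, rfl⟩) | (h4 | ⟨rfl, rfl⟩)⟩ := hadj
      · exact h3 u hu huv ⟨hne, Or.inl h4⟩
      · exact h1 (max_eq_right huv.le).symm
      · exact h3 u hu huv ⟨hne, Or.inr h4⟩
      · exact h1 (max_eq_left huv.le).symm
  · rw [mem_thin, mem_thin]
    simp only [ofList, List.mem_append, List.mem_singleton, Prod.mk.injEq]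
    constructor
    · rintro ⟨h1, h2⟩
      exact ⟨h1, fun u hu huv hadj => h2 u hu huv (by tauto)⟩
    · rintro ⟨h1, h2⟩
      refine ⟨h1, fun u hu huv hadj => ?_⟩
      obtain ⟨hne, (h4 | ⟨rfl, rfl⟩) | (h4 | ⟨rfl, rfl⟩)⟩ := hadj
      · exact h2 u hu huv ⟨hne, Or.inl h4⟩
      · exact h ⟨hu, h1⟩
      · exact h2 u hu huv ⟨hne, Or.inr h4⟩
      · exact h ⟨h1, hu⟩

theorem hoare_thinLoop {Λ : ℕ} (hΛ : 1 ≤ Λ) {s : State} (hB : Bdd Λ s) (hH : Holds s w es)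
    (hes : ∀ e ∈ es, e.1 ≠ e.2) {Q : Finset (Fin n)} (h4 : Bits s 4 Q) (h5 : Bits s 5 Q) :
    Hoare T O (forLoop 12 18 thinBody) s ((es.length + 1) * (100 * Λ))
      (fun s' => Bdd Λ s' ∧ SameOff [12] [5] s s' ∧ Bits s' 5 (thin (ofList es) Q)) 1 := by
  refine (Hoare.forLoop_one hΛ (t := thinBody.cw * Λ) (N := es.length)
    (fun k s' => Bits s' 5 (thin (ofList (es.take k)) Q))
    hB hH.reg_m (by decide) (by decide) (by decide) ?_ ?_).mono ?_ ?_ le_rfl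
  · have : thin (ofList (es.take 0)) Q = Q := by
      ext v; simp [mem_thin, ofList]
    rw [this]
    exact h5
  · intro k hk s' hks hBs hF hI
    have e4 : Bits s' 4 Q := h4.congr (hF.2 4 (by decide))
    have e8 : s'.arr 8 k = (es[k].1 : ℕ) := by rw [hF.2 8 (by decide)]; exact hH.src k hk
    have e9 : s'.arr 9 k = (es[k].2 : ℕ) := by rw [hF.2 9 (by decide)]; exact hH.dst k hk
    have hne := hes _ (List.getElem_mem hk)
    refine Hoare.straight hΛ hBs ?_ fun hB' => ⟨hB', ?_⟩
    · simp only [thinBody, Program.Ok, Term.val]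
      split_ifs <;> simp
    · rw [List.take_add_one, List.getElem?_eq_getElem hk, Option.toList_some]
      rw [show es[k] = (es[k].1, es[k].2) from rfl, thin_ofList_append hne]
      intro v
      simp only [thinBody, Program.eff, Term.val, hks, e8, e9, e4 es[k].1, e4 es[k].2]
      by_cases h1 : es[k].1 ∈ Q <;> by_cases h2 : es[k].2 ∈ Q
      · rcases lt_or_gt_of_ne hne with h3 | h3
        · have h3' : (es[k].1 : ℕ) < es[k].2 := h3
          simp only [h1, h2, h3', max_eq_right h3.le]
          simp [Fin.val_inj, Finset.mem_erase, hI v]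
          split_ifs <;> tauto
        · have h3' : ¬ (es[k].1 : ℕ) < es[k].2 := not_lt.2 h3.le
          simp only [h1, h2, h3', max_eq_left h3.le]
          simp [Fin.val_inj, Finset.mem_erase, hI v]
          split_ifs <;> tauto
      all_goals simp [h1, h2, hI v]
  · exact loop_time_le (by decide)
  · rintro s' ⟨h1, h2, h3⟩
    rw [List.take_length] at h3
    exact ⟨h1, h2.mono (by decide) (by decide), h3⟩

/-- Mark the end of edge `reg 12` outside the answer if the other end is inside. -/
def boundaryBody : Program :=
  .branch (.eq (.cell 6 (.cell 8 (.reg 12))) (.cell 6 (.cell 9 (.reg 12)))) .skip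
    (.branch (.cell 6 (.cell 8 (.reg 12)))
      (.store 7 (.cell 9 (.reg 12)) (.const 1)) (.store 7 (.cell 8 (.reg 12)) (.const 1)))

theorem mem_boundary_ofList {l : List (Fin n × Fin n)} {A : Finset (Fin n)} {v : Fin n} :
    v ∈ boundary (ofList l) A ↔ v ∉ A ∧ ∃ u ∈ A, (u, v) ∈ l ∨ (v, u) ∈ l := by
  rw [mem_boundary]
  refine and_congr_right fun hv => exists_congr fun u => and_congr_right fun hu => ?_
  refine ⟨fun h => h.2, fun h => ⟨?_, h⟩⟩
  rintro rfl
  exact hv hu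

open Classical in
theorem boundary_ofList_append {l : List (Fin n × Fin n)} {x y : Fin n} (A : Finset (Fin n)) :
    boundary (ofList (l ++ [(x, y)])) A =
      if x ∈ A ∧ y ∉ A then insert y (boundary (ofList l) A)
      else if y ∈ A ∧ x ∉ A then insert x (boundary (ofList l) A) else boundary (ofList l) A := by
  have key : ∀ v, v ∈ boundary (ofList (l ++ [(x, y)])) A ↔
      v ∈ boundary (ofList l) A ∨ (v = y ∧ x ∈ A ∧ y ∉ A) ∨ (v = x ∧ y ∈ A ∧ x ∉ A) := by
    intro v
    simp only [mem_boundary_ofList, List.mem_append, List.mem_singleton, Prod.mk.injEq]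
    constructor
    · rintro ⟨hv, u, hu, (h | ⟨rfl, rfl⟩) | (h | ⟨rfl, rfl⟩)⟩
      · exact Or.inl ⟨hv, u, hu, Or.inl h⟩
      · exact Or.inr (Or.inl ⟨rfl, hu, hv⟩)
      · exact Or.inl ⟨hv, u, hu, Or.inr h⟩
      · exact Or.inr (Or.inr ⟨rfl, hu, hv⟩)
    · rintro (⟨hv, u, hu, h⟩ | ⟨rfl, h1, h2⟩ | ⟨rfl, h1, h2⟩)
      · exact ⟨hv, u, hu, h.imp Or.inl Or.inl⟩
      · exact ⟨h2, x, h1, Or.inl (Or.inr ⟨rfl, rfl⟩)⟩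
      · exact ⟨h2, y, h1, Or.inr (Or.inr ⟨rfl, rfl⟩)⟩
  ext v
  rw [key]
  split_ifs with h1 h2
  · rw [Finset.mem_insert]; tauto
  · rw [Finset.mem_insert]; tauto
  · tauto

theorem hoare_boundaryLoop {Λ : ℕ} (hΛ : 1 ≤ Λ) {s : State} (hB : Bdd Λ s) (hH : Holds s w es)
    {A : Finset (Fin n)} (h6 : Bits s 6 A) (h7 : Bits s 7 (∅ : Finset (Fin n))) :
    Hoare T O (forLoop 12 18 boundaryBody) s ((es.length + 1) * (100 * Λ))
      (fun s' => Bdd Λ s' ∧ SameOff [12] [7] s s' ∧ Bits s' 7 (boundary (ofList es) A)) 1 := by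
  refine (Hoare.forLoop_one hΛ (t := boundaryBody.cw * Λ) (N := es.length)
    (fun k s' => Bits s' 7 (boundary (ofList (es.take k)) A))
    hB hH.reg_m (by decide) (by decide) (by decide) ?_ ?_).mono ?_ ?_ le_rfl
  · have : boundary (ofList (es.take 0)) A = ∅ := by
      ext v; simp [mem_boundary_ofList]
    rw [this]
    exact h7
  · intro k hk s' hks hBs hF hI
    have e6 : Bits s' 6 A := h6.congr (hF.2 6 (by decide))
    have e8 : s'.arr 8 k = (es[k].1 : ℕ) := by rw [hF.2 8 (by decide)]; exact hH.src k hk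
    have e9 : s'.arr 9 k = (es[k].2 : ℕ) := by rw [hF.2 9 (by decide)]; exact hH.dst k hk
    refine Hoare.straight hΛ hBs ?_ fun hB' => ⟨hB', ?_⟩
    · have : 1 < 2 ^ Λ := Nat.one_lt_two_pow (by omega)
      simp only [boundaryBody, Program.Ok, Term.val]
      split_ifs <;> simp [this]
    · rw [List.take_add_one, List.getElem?_eq_getElem hk, Option.toList_some]
      rw [show es[k] = (es[k].1, es[k].2) from rfl, boundary_ofList_append]
      intro v
      simp only [boundaryBody, Program.eff, Term.val, hks, e8, e9, e6 es[k].1, e6 es[k].2]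
      by_cases h1 : es[k].1 ∈ A <;> by_cases h2 : es[k].2 ∈ A
      · simp [h1, h2, hI v]
      · simp [h1, h2, hI v, Fin.val_inj]
        split_ifs <;> tauto
      · simp [h1, h2, hI v, Fin.val_inj]
        split_ifs <;> tauto
      · simp [h1, h2, hI v]
  · exact loop_time_le (by decide)
  · rintro s' ⟨h1, h2, h3⟩
    rw [List.take_length] at h3
    exact ⟨h1, h2.mono (by decide) (by decide), h3⟩

end Iteration

/-! ### Weighing the separator of an answer and keeping the best cut -/

section Evaluation

variable {n : ℕ} {w : Fin n → ℕ} {es : List (Fin n × Fin n)}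

/-- Add vertex `reg 11` to the counts of the separator weight, the answer and the covered part. -/
def countBody : Program :=
  .seq (.assign 14 (.add (.reg 14) (.mul (.cell 7 (.reg 11)) (.cell 2 (.reg 11)))))
    (.seq (.assign 15 (.add (.reg 15) (.cell 6 (.reg 11))))
      (.assign 16 (.add (.reg 16) (.add (.cell 6 (.reg 11)) (.cell 7 (.reg 11))))))

theorem Bits.sum_mul {s : State} {a : ℕ} {S : Finset (Fin n)} (h : Bits s a S) (f : ℕ → ℕ) :
    ∑ j ∈ Finset.range n, s.arr a j * f j = ∑ v ∈ S, f v := by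
  rw [Finset.sum_range, ← Finset.sum_filter_add_sum_filter_not Finset.univ (· ∈ S)]
  rw [Finset.sum_eq_zero (s := Finset.univ.filter (· ∉ S)), add_zero]
  · refine Finset.sum_congr (by ext v; simp) fun v hv => ?_
    rw [h v, if_pos hv, one_mul]
  · intro v hv
    rw [h v, if_neg (Finset.mem_filter.1 hv).2, zero_mul]

theorem Bits.sum_eq {s : State} {a : ℕ} {S : Finset (Fin n)} (h : Bits s a S) :
    ∑ j ∈ Finset.range n, s.arr a j = S.card := by
  simpa using h.sum_mul fun _ => 1

theorem hoare_countLoop {Λ : ℕ} (hΛ : 1 ≤ Λ) {s : State} (hB : Bdd Λ s) (hn : s.reg 0 = n)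
    (hwt : ∀ v : Fin n, s.arr 2 v = w v) {A N : Finset (Fin n)} (h6 : Bits s 6 A)
    (h7 : Bits s 7 N) (h14 : s.reg 14 = 0) (h15 : s.reg 15 = 0) (h16 : s.reg 16 = 0)
    (hW : weight w Finset.univ < 2 ^ Λ) (hnΛ : 2 * n < 2 ^ Λ) :
    Hoare T O (forLoop 11 0 countBody) s ((n + 1) * (100 * Λ))
      (fun s' => Bdd Λ s' ∧ SameOff [11, 14, 15, 16] [] s s' ∧ s'.reg 14 = weight w N ∧
        s'.reg 15 = A.card ∧ s'.reg 16 = A.card + N.card) 1 := by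
  have hle : ∀ f : ℕ → ℕ, ∀ k < n,
      ∑ j ∈ Finset.range k, f j + f k ≤ ∑ j ∈ Finset.range n, f j := by
    intro f k hk
    rw [← Finset.sum_range_succ]
    exact Finset.sum_le_sum_of_subset (Finset.range_mono hk)
  have s14 : ∑ j ∈ Finset.range n, s.arr 7 j * s.arr 2 j = weight w N := by
    rw [h7.sum_mul fun j => s.arr 2 j]
    exact Finset.sum_congr rfl fun v _ => hwt v
  have s16 : ∑ j ∈ Finset.range n, (s.arr 6 j + s.arr 7 j) = A.card + N.card := by
    rw [Finset.sum_add_distrib, h6.sum_eq, h7.sum_eq]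
  have hA : A.card ≤ n := by simpa using A.card_le_univ
  have hN : N.card ≤ n := by simpa using N.card_le_univ
  have hNW : weight w N ≤ weight w Finset.univ := weight_mono (Finset.subset_univ _)
  refine (Hoare.forLoop_one hΛ (t := countBody.cw * Λ) (N := n)
    (fun k s' => s'.reg 14 = ∑ j ∈ Finset.range k, s.arr 7 j * s.arr 2 j ∧
      s'.reg 15 = ∑ j ∈ Finset.range k, s.arr 6 j ∧
      s'.reg 16 = ∑ j ∈ Finset.range k, (s.arr 6 j + s.arr 7 j))
    hB hn (by decide) (by decide) (by decide) (by simp [h14, h15, h16]) ?_).mono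
    (loop_time_le (by decide)) ?_ le_rfl
  · intro k hk s' hks hBs hF hI
    have e6 : s'.arr 6 = s.arr 6 := hF.2 6 (by decide)
    have e7 : s'.arr 7 = s.arr 7 := hF.2 7 (by decide)
    have e2 : s'.arr 2 = s.arr 2 := hF.2 2 (by decide)
    obtain ⟨i14, i15, i16⟩ := hI
    have l14 := hle (fun j => s.arr 7 j * s.arr 2 j) k hk
    have l15 := hle (fun j => s.arr 6 j) k hk
    have l16 := hle (fun j => s.arr 6 j + s.arr 7 j) k hk
    rw [s14] at l14
    rw [h6.sum_eq] at l15
    rw [s16] at l16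
    refine Hoare.straight hΛ hBs ?_ fun hB' => ⟨hB', ?_⟩
    · simp only [countBody, Program.Ok, Program.eff, Term.val]
      simp [e6, e7, e2, hks, i14, i15, i16]
      refine ⟨?_, ?_, ?_⟩ <;> omega
    · simp only [countBody, Program.eff, Term.val, Finset.sum_range_succ]
      simp [e6, e7, e2, hks, i14, i15, i16]
  · rintro s' ⟨h1, h2, h3, h4, h5⟩
    rw [s14] at h3
    rw [h6.sum_eq] at h4
    rw [s16] at h5
    exact ⟨h1, h2.mono (by decide) (by decide), h3, h4, h5⟩

/-- Append vertex `reg 11` to the output if it belongs to the separator. -/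
def outBody : Program :=
  .branch (.cell 7 (.reg 11))
    (.seq (.store 3 (.reg 2) (.reg 11)) (.assign 2 (.add (.reg 2) (.const 1)))) .skip

theorem hoare_outLoop {Λ : ℕ} (hΛ : 1 ≤ Λ) {s : State} (hB : Bdd Λ s) (hn : s.reg 0 = n)
    {N : Finset (Fin n)} (h7 : Bits s 7 N) (h2 : s.reg 2 = 0) (hnΛ : 2 * n < 2 ^ Λ) :
    Hoare T O (forLoop 11 0 outBody) s ((n + 1) * (100 * Λ))
      (fun s' => Bdd Λ s' ∧ SameOff [11, 2] [3] s s' ∧ s'.output = N.map Fin.valEmbedding) 1 := by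
  refine (Hoare.forLoop_one hΛ (t := outBody.cw * Λ) (N := n)
    (fun k s' => s'.reg 2 ≤ k ∧
      s'.output = (Finset.range k).filter fun j => s.arr 7 j ≠ 0)
    hB hn (by decide) (by decide) (by decide) (by simp [h2, State.output]) ?_).mono
    (loop_time_le (by decide)) ?_ le_rfl
  · intro k hk s' hks hBs hF hI
    have e7 : s'.arr 7 = s.arr 7 := hF.2 7 (by decide)
    obtain ⟨i2, i3⟩ := hI
    refine Hoare.straight hΛ hBs ?_ fun hB' => ⟨hB', ?_⟩
    · have := hBs.1 11
      simp only [outBody, Program.Ok, Program.eff, Term.val]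
      by_cases h : s'.arr 7 (s'.reg 11) = 0
      · simp [h]
      · simp [h]
        omega
    · simp only [outBody, Program.eff, Term.val, e7, hks]
      rw [Finset.range_add_one, Finset.filter_insert]
      by_cases h : s.arr 7 k = 0
      · simp only [h, if_true, ne_eq, not_true_eq_false, if_false]
        exact ⟨by simp; omega, i3⟩
      · simp only [h, if_false, ne_eq, not_false_eq_true, if_true]
        refine ⟨by simpa using i2, ?_⟩
        rw [← i3]
        simp only [State.output]
        simp only [setReg_reg, setReg_arr, setCell_reg]
        rw [if_neg (by decide), if_pos trivial, Finset.range_add_one, Finset.image_insert]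
        congr 1
        · simp
        · refine Finset.image_congr fun j hj => ?_
          have : j ≠ s'.reg 2 := by
            rw [Finset.mem_coe, Finset.mem_range] at hj; exact hj.ne
          simp [this]
  · rintro s' ⟨h1, h3, -, h4⟩
    refine ⟨h1, h3.mono (by decide) (by decide), ?_⟩
    rw [h4]
    ext j
    simp only [Finset.mem_filter, Finset.mem_range, Finset.mem_map, Fin.valEmbedding_apply]
    constructor
    · rintro ⟨hj, h⟩
      refine ⟨⟨j, hj⟩, ?_, rfl⟩
      have := h7 ⟨j, hj⟩
      by_contra hN
      rw [if_neg hN] at this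
      exact h this
    · rintro ⟨v, hv, rfl⟩
      refine ⟨v.2, ?_⟩
      rw [h7 v, if_pos hv]
      norm_num

/-- The answer is a proper side, its separator is affordable and better than the best so far. -/
def acceptCond : Term :=
  .mul (.mul (.lt (.const 0) (.reg 15)) (.lt (.reg 16) (.reg 0)))
    (.mul
      (.add (.lt (.mul (.reg 14) (.reg 14)) (.add (.reg 7) (.const 1)))
        (.lt (.mul (.reg 14) (.reg 3))
          (.add (.mul (.reg 7) (.sub (.reg 3) (.reg 14))) (.const 1))))
      (.add (.eq (.reg 17) (.const 0)) (.lt (.add (.reg 14) (.const 1)) (.reg 17))))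

theorem ite_one_zero_eq_zero {p : Prop} {_ : Decidable p} : (if p then 1 else 0) = 0 ↔ ¬ p := by
  split_ifs <;> simp_all

/-- Products of truth values are conjunctions, sums are disjunctions, and `<` against a successor
expresses `≤`. -/
theorem acceptCond_val_ne_zero (s : State) : acceptCond.val s ≠ 0 ↔
    0 < s.reg 15 ∧ s.reg 16 < s.reg 0 ∧ Acc (s.reg 3) (s.reg 7) (s.reg 14) ∧
      (s.reg 17 = 0 ∨ s.reg 14 + 1 < s.reg 17) := by
  simp only [acceptCond, Term.val, Acc, Nat.lt_succ_iff]
  simp only [ne_eq, mul_eq_zero, Nat.add_eq_zero_iff, ite_one_zero_eq_zero,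
    not_or, not_and, not_not]
  generalize (s.reg 14 * s.reg 3 ≤ s.reg 7 * (s.reg 3 - s.reg 14)) = p
  generalize (s.reg 14 * s.reg 14 ≤ s.reg 7) = q
  by_cases h1 : 0 < s.reg 15 <;> by_cases h2 : s.reg 16 < s.reg 0 <;>
    by_cases h3 : s.reg 17 = 0 <;> by_cases h4 : s.reg 14 + 1 < s.reg 17 <;>
    simp only [h1, h2, h3, h4, if_true, if_false] <;> simp <;> tauto

/-- Evaluate the answer of the subroutine. -/
def evalProg : Program :=
  .seq (.seq (.assign 14 (.const 0)) (.seq (.assign 15 (.const 0)) (.assign 16 (.const 0))))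
    (.seq (forLoop 12 18 boundaryBody)
      (.seq (forLoop 11 0 countBody)
        (.branch acceptCond
          (.seq (.seq (.assign 17 (.add (.reg 14) (.const 1))) (.assign 2 (.const 0)))
            (forLoop 11 0 outBody))
          .skip)))

/-- The answer `A` is a side of a vertex cut that improves on the best so far. -/
def Improves (w : Fin n → ℕ) (H : SimpleGraph (Fin n)) (s : State) (A : Finset (Fin n)) : Prop :=
  A.Nonempty ∧ (∃ v, v ∉ A ∧ v ∉ boundary H A) ∧
    Acc (s.reg 3) (s.reg 7) (weight w (boundary H A)) ∧
    (s.reg 17 = 0 ∨ weight w (boundary H A) + 1 < s.reg 17)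

/-- The effect of evaluating the answer `A`. -/
def Outcome (w : Fin n → ℕ) (H : SimpleGraph (Fin n)) (A : Finset (Fin n)) (s s' : State) : Prop :=
  (Improves w H s A ∧ s'.reg 17 = weight w (boundary H A) + 1 ∧
      s'.output = (boundary H A).map Fin.valEmbedding) ∨
    (¬ Improves w H s A ∧ s'.reg 17 = s.reg 17 ∧ s'.output = s.output)

/-- Turns the existence of a vertex on the far side into a count that the program compares with n.
-/
theorem exists_outside_iff {H : SimpleGraph (Fin n)} {A : Finset (Fin n)} :
    (∃ v, v ∉ A ∧ v ∉ boundary H A) ↔ A.card + (boundary H A).card < n := by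
  have hd : Disjoint A (boundary H A) :=
    Finset.disjoint_left.2 fun v hv hv' => (mem_boundary.1 hv').1 hv
  rw [← Finset.card_union_of_disjoint hd]
  constructor
  · rintro ⟨v, h1, h2⟩
    have : A ∪ boundary H A ⊂ Finset.univ :=
      Finset.ssubset_univ_iff.2 fun h => by
        have := Finset.mem_univ v
        rw [← h, Finset.mem_union] at this
        tauto
    simpa using Finset.card_lt_card this
  · intro h
    by_contra hc
    push Not at hc
    have : A ∪ boundary H A = Finset.univ := by
      ext v
      simp only [Finset.mem_union, Finset.mem_univ, iff_true]
      by_cases hv : v ∈ A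
      · exact Or.inl hv
      · exact Or.inr (hc v hv)
    rw [this] at h
    simp at h

/-- Nothing is assumed about the answer A: the boundary and its weight are computed afresh, and the
new cut replaces the best one only if `Improves` holds. -/
theorem hoare_evalProg {Λ : ℕ} (hΛ : 1 ≤ Λ) {s : State} (hB : Bdd Λ s) (hH : Holds s w es)
    {A : Finset (Fin n)} (h6 : Bits s 6 A) (h7 : Bits s 7 (∅ : Finset (Fin n)))
    (hW : weight w Finset.univ + 1 < 2 ^ Λ) (hnΛ : 2 * n < 2 ^ Λ) :
    Hoare T O evalProg s ((es.length + n + 1) * (600 * Λ))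
      (fun s' => Bdd Λ s' ∧ Outcome w (ofList es) A s s') 1 := by
  have hNW : weight w (boundary (ofList es) A) ≤ weight w Finset.univ := weight_mono (Finset.subset_univ _)
  have step1 := Hoare.straight' (T := T) (O := O) hΛ (.seq (.assign 14 (.const 0))
    (.seq (.assign 15 (.const 0)) (.assign 16 (.const 0)))) hB (by simp [Program.Ok, Term.val])
  refine (step1.seq_one (t' := (es.length + 1) * (100 * Λ) + ((n + 1) * (100 * Λ) +
    (100 * Λ + (20 * Λ + (n + 1) * (100 * Λ))))) ?_).mono ?_ (fun _ h => h) le_rfl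
  · rintro s1 ⟨rfl, hB1⟩
    set s1 := Program.eff _ s with hs1
    have hH1 : Holds s1 w es := hH.congr rfl rfl rfl rfl rfl
    have h61 : Bits s1 6 A := h6.congr rfl
    have h71 : Bits s1 7 (∅ : Finset (Fin n)) := h7.congr rfl
    refine (hoare_boundaryLoop hΛ hB1 hH1 h61 h71).seq_one ?_
    rintro s2 ⟨hB2, hF2, h72⟩
    have r2 : ∀ x, x ≠ 12 → s2.reg x = s1.reg x := fun x hx => hF2.1 x (by simpa using hx)
    have a2 : ∀ x, x ≠ 7 → s2.arr x = s1.arr x := fun x hx => hF2.2 x (by simpa using hx)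
    refine (hoare_countLoop (w := w) hΛ hB2 ((r2 0 (by decide)).trans hH1.reg_n)
      (fun v => by rw [a2 2 (by decide)]; exact hH1.wt v) (h61.congr (a2 6 (by decide))) h72
      (r2 14 (by decide)) (r2 15 (by decide)) (r2 16 (by decide)) (by omega) hnΛ).seq_one ?_
    rintro s3 ⟨hB3, hF3, h14, h15, h16⟩
    have r3 : ∀ x ∉ [11, 14, 15, 16, 12], s3.reg x = s1.reg x := fun x hx => by
      rw [hF3.1 x (fun h => hx (by simp at h ⊢; tauto)), r2 x (fun h => hx (by simp [h]))]
    have a3 : ∀ x, x ≠ 7 → s3.arr x = s1.arr x := fun x hx => by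
      rw [hF3.2 x (by simp), a2 x hx]
    have e0 : s3.reg 0 = n := (r3 0 (by decide)).trans hH1.reg_n
    have e3 : s3.reg 3 = s.reg 3 := r3 3 (by decide)
    have e7 : s3.reg 7 = s.reg 7 := r3 7 (by decide)
    have e17 : s3.reg 17 = s.reg 17 := r3 17 (by decide)
    have hcost := acceptCond.cost_le hΛ hB3
    have hcw : acceptCond.cw ≤ 90 := by decide
    have hcost' := hcost.trans (Nat.mul_le_mul_right Λ hcw)
    have hcond : acceptCond.val s3 ≠ 0 ↔ Improves w (ofList es) s A := by
      rw [acceptCond_val_ne_zero, h14, h15, h16, e0, e3, e7, e17, Improves, exists_outside_iff,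
        Finset.card_pos]
    by_cases hc : acceptCond.val s3 ≠ 0
    · have := Hoare.straight' (T := T) (O := O) hΛ
        (.seq (.assign 17 (.add (.reg 14) (.const 1))) (.assign 2 (.const 0))) hB3
        (by simp [Program.Ok, Term.val, h14]; omega)
      refine (Hoare.branch_pos hc ((this.mono (t' := 20 * Λ) (Nat.mul_le_mul_right Λ (by decide))
        (fun _ h => h) le_rfl).seq_one (t' := (n + 1) * (100 * Λ)) ?_)).mono (by omega)
        (fun _ h => h) le_rfl
      rintro s4 ⟨rfl, hB4⟩
      have h74 : Bits _ 7 (boundary (ofList es) A) := (h72.congr (hF3.2 7 (by decide)))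
      refine (hoare_outLoop hΛ hB4 (by simpa [Program.eff] using e0) (h74.congr rfl)
        (by simp [Program.eff, Term.val]) hnΛ).post ?_
      rintro s5 ⟨hB5, hF5, h5⟩
      refine ⟨hB5, Or.inl ⟨hcond.1 hc, ?_, h5⟩⟩
      rw [hF5.1 17 (by decide)]
      simp [Program.eff, Term.val, h14]
    · rw [not_not] at hc
      refine (Hoare.branch_neg hc (Hoare.skip (s := s3) ⟨hB3, Or.inr ⟨?_, e17, ?_⟩⟩)).mono
        (by omega) (fun _ h => h) le_rfl
      · rw [← hcond]; simpa using hc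
      · simp only [State.output]
        rw [r3 2 (by decide), a3 3 (by decide)]
        rfl
  · have : (Program.seq (.assign 14 (.const 0))
      (.seq (.assign 15 (.const 0)) (.assign 16 (.const 0)))).cw ≤ 10 := by decide
    have := Nat.mul_le_mul_right Λ this
    nlinarith

/-- Ask the subroutine for a minimum isolating cut and evaluate its answer. -/
def askProg : Program := .seq (forLoop 12 18 thinBody) (.seq (.ivc 0 18 8 9 2 5 6) evalProg)

theorem Holds.query_eq {s : State} (hH : Holds s w es) {R : Finset (Fin n)} (h5 : Bits s 5 R) :
    s.query 0 18 8 9 2 5 = Query.of es w R := by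
  unfold State.query Query.of
  rw [hH.reg_n, hH.reg_m]
  congr 1
  · refine List.ext_getElem (by simp) fun i h1 h2 => ?_
    simp only [List.length_map, List.length_range] at h1
    simp [hH.src i h1, hH.dst i h1]
  · refine List.ext_getElem (by simp) fun i h1 h2 => ?_
    simp only [List.length_map, List.length_range] at h1
    simpa using hH.wt ⟨i, h1⟩
  · ext j
    simp only [Finset.mem_filter, Finset.mem_range, Finset.mem_map, Fin.valEmbedding_apply]
    constructor
    · rintro ⟨hj, h⟩
      refine ⟨⟨j, hj⟩, ?_, rfl⟩
      have := h5 ⟨j, hj⟩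
      by_contra hN
      rw [if_neg hN] at this
      exact h this
    · rintro ⟨v, hv, rfl⟩
      refine ⟨v.2, ?_⟩
      rw [h5 v, if_pos hv]
      norm_num

open Classical in
/-- The vertices in a set of natural numbers. -/
noncomputable def toFin (n : ℕ) (A : Finset ℕ) : Finset (Fin n) :=
  Finset.univ.filter fun v => v.val ∈ A

/-- `E` is an arbitrary event on answers. As `toFin` ignores the numbers from n on, just as
`setBits` does, every answer of the subroutine has an outcome, a malformed one too. -/
theorem hoare_askProg {Λ : ℕ} (hΛ : 1 ≤ Λ) {s : State} (hB : Bdd Λ s) (hH : Holds s w es)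
    (hes : ∀ e ∈ es, e.1 ≠ e.2) {Q : Finset (Fin n)} (h4 : Bits s 4 Q) (h5 : Bits s 5 Q)
    (h7 : Bits s 7 (∅ : Finset (Fin n)))
    (hW : weight w Finset.univ + 1 < 2 ^ Λ) (hnΛ : 2 * n < 2 ^ Λ) (E : Set (Finset (Fin n))) :
    Hoare T O askProg s ((es.length + n + 1) * (700 * Λ) + (1 + T es.length n))
      (fun s' => Bdd Λ s' ∧ ∃ A ∈ E, Outcome w (ofList es) A s s')
      ((O (Query.of es w (thin (ofList es) Q))).toOuterMeasure {A | toFin n A ∈ E}) := by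
  refine ((hoare_thinLoop hΛ hB hH hes h4 h5).seq_one
    (t' := (1 + T es.length n) + (es.length + n + 1) * (600 * Λ)) ?_).mono
    (by nlinarith) (fun _ h => h) le_rfl
  rintro s1 ⟨hB1, hF1, h51⟩
  have r1 : ∀ x, x ≠ 12 → s1.reg x = s.reg x := fun x hx => hF1.1 x (by simpa using hx)
  have a1 : ∀ x, x ≠ 5 → s1.arr x = s.arr x := fun x hx => hF1.2 x (by simpa using hx)
  have hH1 : Holds s1 w es := hH.congr (r1 0 (by decide)) (r1 18 (by decide)) (a1 8 (by decide))
    (a1 9 (by decide)) (a1 2 (by decide))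
  have hivc := Hoare.ivc (T := T) (O := O) (s := s1) (n := 0) (m := 18) (src := 8) (dst := 9)
    (wt := 2) (term := 5) (ans := 6) (Q := fun s2 => ∃ A : Finset ℕ, toFin n A ∈ E ∧
      s2 = s1.setBits 6 n A) {A | toFin n A ∈ E}
    (fun A hA => ⟨A, hA, by rw [hH1.reg_n]⟩)
  rw [hH1.query_eq h51, hH1.reg_n, hH1.reg_m] at hivc
  refine (hivc.seq (p' := 1) ?_).mono le_rfl (fun _ h => h) (by rw [mul_one])
  rintro s2 ⟨A, hA, rfl⟩
  have hB2 := hB1.setBits hΛ 6 n A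
  have hH2 : Holds (s1.setBits 6 n A) w es := by
    refine hH1.congr rfl rfl ?_ ?_ ?_ <;> · ext v; simp
  refine (hoare_evalProg (A := toFin n A) hΛ hB2 hH2 (fun v => ?_) (fun v => ?_) hW hnΛ).post ?_
  · simp [toFin]
  · have := h7 v
    rw [← a1 7 (by decide)] at this
    simpa using this
  · rintro s3 ⟨hB3, ho⟩
    refine ⟨hB3, _, hA, ?_⟩
    have e3 : (s1.setBits 6 n A).arr 3 = s.arr 3 := by
      ext v; simp [a1]
    simpa [Outcome, Improves, r1, State.output, e3] using ho

/-- One iteration of the search. -/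
def iterBody : Program := .seq (.rand 10 (.reg 6)) (.seq (forLoop 11 0 sampleBody) askProg)

/-- The three random choices multiply: a scale in `Z`, a sample in `F` given the scale, an answer in
`E Q` given the sample. The events are arbitrary in order to cover both what always happens and what
happens in a successful iteration. -/
theorem hoare_iterBody {Λ t : ℕ} (hΛ : 1 ≤ Λ) {s : State} (hB : Bdd Λ s) (hH : Holds s w es)
    (hes : ∀ e ∈ es, e.1 ≠ e.2) (ht : s.reg 6 = t) (htΛ : 2 ^ t ≤ Λ)
    (hW : weight w Finset.univ + 1 < 2 ^ Λ) (hnΛ : 2 * n < 2 ^ Λ)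
    (Z : Finset (Fin (2 ^ t))) (F : Finset (Finset (Fin n)))
    (E : Finset (Fin n) → Set (Finset (Fin n))) {pS pE : ℝ≥0∞}
    (hS : ∀ i ∈ Z, pS ≤
      ∑ Q ∈ F, ENNReal.ofReal (sampleProb (fun v => inclProb i.val (w v)) Q))
    (hE : ∀ Q ∈ F, pE ≤
      (O (Query.of es w (thin (ofList es) Q))).toOuterMeasure {A | toFin n A ∈ E Q}) :
    Hoare T O iterBody s ((es.length + n + 1) * (900 * Λ) + (1 + T es.length n))
      (fun s' => Bdd Λ s' ∧ ∃ Q ∈ F, ∃ A ∈ E Q, Outcome w (ofList es) A s s')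
      (Z.card / 2 ^ t * (pS * pE)) := by
  subst ht
  have hc := (Term.reg 6).cost_le hΛ hB
  simp only [Term.cw] at hc
  have htl : s.reg 6 ≤ Λ := (Nat.lt_two_pow_self (n := s.reg 6)).le.trans htΛ
  have hr := Hoare.rand (T := T) (O := O) (s := s) (x := 10) (k := .reg 6)
    (Q := fun s' => ∃ i : Fin (2 ^ s.reg 6), i ∈ Z ∧ s' = s.setReg 10 i) Z
    (fun v hv => ⟨v, hv, rfl⟩)
  refine (hr.seq (p' := pS * pE) (t' := (n + 1) * (60 * Λ) +
    ((es.length + n + 1) * (700 * Λ) + (1 + T es.length n))) ?_).mono ?_ (fun _ h => h) le_rfl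
  · rintro s1 ⟨i, hi, rfl⟩
    have hiΛ : (i : ℕ) < Λ := i.2.trans_le htΛ
    have hB1 : Bdd Λ (s.setReg 10 i) := hB.setReg (hiΛ.trans Nat.lt_two_pow_self)
    refine ((hoare_sampleLoop (w := w) (i := i) hΛ hB1 (by simpa using hH.reg_n) hH.wt (by simp)
      hiΛ.le F).mono le_rfl (fun _ h => h) (hS i hi)).seq ?_
    rintro s2 ⟨Q, hQ, hB2, hF2, h4, h5, h7⟩
    have r2 : ∀ x ∉ [10, 11, 13], s2.reg x = s.reg x := fun x hx => by
      simp only [List.mem_cons, not_or] at hx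
      rw [hF2.1 x (by simp; tauto)]
      simp [hx.1]
    have a2 : ∀ x ∉ [4, 5, 7], s2.arr x = s.arr x := fun x hx => hF2.2 x hx
    have hH2 : Holds s2 w es := hH.congr (r2 0 (by decide)) (r2 18 (by decide)) (a2 8 (by decide))
      (a2 9 (by decide)) (a2 2 (by decide))
    refine (hoare_askProg hΛ hB2 hH2 hes h4 h5 h7 hW hnΛ (E Q)).mono le_rfl ?_ (hE Q hQ)
    rintro s3 ⟨hB3, A, hA, ho⟩
    refine ⟨hB3, Q, hQ, A, hA, ?_⟩
    simpa [Outcome, Improves, r2, State.output, a2] using ho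
  · have : (Term.reg 6).val s ≤ Λ := htl
    nlinarith

end Evaluation

/-! ### Repeating the iteration -/

section Search

variable {n : ℕ} {G H : SimpleGraph (Fin n)} {w : Fin n → ℕ} {es : List (Fin n × Fin n)} {κ : ℕ}

/-- The output is a vertex cut of weight `reg 17 - 1 ≥ κ`, or nothing was found yet. -/
def Found (G : SimpleGraph (Fin n)) (w : Fin n → ℕ) (κ : ℕ) (s : State) : Prop :=
  s.reg 17 = 0 ∨ ∃ S, s.reg 17 = weight w S + 1 ∧ κ ≤ weight w S ∧ IsVertexCut G S ∧
    s.output = S.map Fin.valEmbedding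

/-- The output is a vertex cut of weight `κ`. -/
def Optimal (G : SimpleGraph (Fin n)) (w : Fin n → ℕ) (κ : ℕ) (s : State) : Prop :=
  s.reg 17 = κ + 1 ∧ ∃ S, weight w S = κ ∧ IsVertexCut G S ∧ s.output = S.map Fin.valEmbedding

theorem Optimal.found {s : State} (h : Optimal G w κ s) : Found G w κ s := by
  obtain ⟨h1, S, rfl, h3, h4⟩ := h
  exact Or.inr ⟨S, h1, le_rfl, h3, h4⟩

theorem Improves.isVertexCut {s : State} {A : Finset (Fin n)} (h : Improves w H s A) :
    IsVertexCut H (boundary H A) :=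
  (isSplit_boundary h.1 h.2.1).isVertexCut

/-- The hypothesis `hcut` is all that is needed from a sparsified graph H: its affordable cuts are
cuts of G, of weight at least κ. -/
theorem Outcome.found {W X : ℕ}
    (hcut : ∀ S, IsVertexCut H S → Acc W X (weight w S) → κ ≤ weight w S ∧ IsVertexCut G S)
    {s s' : State} (h3 : s.reg 3 = W) (h7 : s.reg 7 = X) {A : Finset (Fin n)}
    (h : Outcome w H A s s') (hs : Found G w κ s) : Found G w κ s' := by
  rcases h with ⟨hi, h17, ho⟩ | ⟨-, h17, ho⟩
  · have := hcut _ hi.isVertexCut (by have := hi.2.2.1; rwa [h3, h7] at this)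
    exact Or.inr ⟨_, h17, this.1, this.2, ho⟩
  · unfold Found at hs ⊢
    rwa [h17, ho]

/-- A cut of weight κ is never replaced, since a replacement would be an affordable cut of smaller
weight. -/
theorem Outcome.optimal {W X : ℕ}
    (hcut : ∀ S, IsVertexCut H S → Acc W X (weight w S) → κ ≤ weight w S ∧ IsVertexCut G S)
    {s s' : State} (h3 : s.reg 3 = W) (h7 : s.reg 7 = X) {A : Finset (Fin n)}
    (h : Outcome w H A s s') (hs : Optimal G w κ s) : Optimal G w κ s' := by
  rcases h with ⟨hi, h17, ho⟩ | ⟨-, h17, ho⟩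
  · have := hcut _ hi.isVertexCut (by have := hi.2.2.1; rwa [h3, h7] at this)
    have h5 := hi.2.2.2
    rw [hs.1] at h5
    omega
  · unfold Optimal at hs ⊢
    rwa [h17, ho]

/-- The weight of such an answer is affordable together with κ, hence equal to κ. The answer is
rejected only if the best cut so far is not heavier, and then that cut has weight κ. -/
theorem Outcome.optimal_of_le {W X : ℕ} (hacc : Acc W X κ)
    (hcut : ∀ S, IsVertexCut H S → Acc W X (weight w S) → κ ≤ weight w S ∧ IsVertexCut G S)
    {s s' : State} (h3 : s.reg 3 = W) (h7 : s.reg 7 = X) {A : Finset (Fin n)}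
    (h : Outcome w H A s s') (hs : Found G w κ s) (hA : A.Nonempty)
    (hout : ∃ v, v ∉ A ∧ v ∉ boundary H A) (hle : weight w (boundary H A) ≤ κ) :
    Optimal G w κ s' := by
  have hac := hacc.anti hle
  have hc := hcut _ (isSplit_boundary hA hout).isVertexCut hac
  have heq : weight w (boundary H A) = κ := le_antisymm hle hc.1
  rcases h with ⟨hi, h17, ho⟩ | ⟨hi, h17, ho⟩
  · exact ⟨by rw [h17, heq], _, heq, hc.2, ho⟩
  · have hni : ¬ (s.reg 17 = 0 ∨ weight w (boundary H A) + 1 < s.reg 17) := fun h' =>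
      hi ⟨hA, hout, by rw [h3, h7]; exact hac, h'⟩
    rw [not_or] at hni
    rcases hs with h0 | ⟨S, h1, h2, h4, h5⟩
    · exact (hni.1 h0).elim
    · have : weight w S = κ := by omega
      exact ⟨by rw [h17, h1, this], S, this, h4, by rw [ho, h5]⟩

/-- The environment of an iteration. -/
structure Env (Λ W X t : ℕ) (w : Fin n → ℕ) (es : List (Fin n × Fin n)) (s : State) : Prop where
  bdd : Bdd Λ s
  holds : Holds s w es
  reg_W : s.reg 3 = W
  reg_t : s.reg 6 = t
  reg_X : s.reg 7 = X

/-- Run `reg 9` iterations. -/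
def iterLoop : Program :=
  .loop (.reg 9) (.seq iterBody (.assign 9 (.sub (.reg 9) (.const 1))))

/-- With r = (1 - q)^N the right-hand side is (1 - r) + qr = 1 - (1 - q)r. -/
theorem one_sub_pow_succ_le {q : ℝ≥0∞} (hq : q ≤ 1) (N : ℕ) :
    1 - (1 - q) ^ (N + 1) ≤ 1 * (1 - (1 - q) ^ N) + q * (1 - (1 - (1 - q) ^ N)) := by
  have hr : (1 - q) ^ N ≤ 1 := pow_le_one₀ zero_le tsub_le_self
  rw [ENNReal.sub_sub_cancel ENNReal.one_ne_top hr, one_mul, tsub_le_iff_right, pow_succ, add_assoc,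
    mul_comm _ (1 - q), ← add_mul, add_tsub_cancel_of_le hq, one_mul, tsub_add_cancel_of_le hr]

/-- From an iteration that preserves `I` and `J`, and establishes `J` from `I` with probability
`q`, to a loop of `N` iterations. -/
theorem hoare_iterLoop {Λ W X t q_time N : ℕ} (hΛ : 1 ≤ Λ) {I J : State → Prop} {q : ℝ≥0∞}
    (hq : q ≤ 1) (hJI : ∀ s, J s → I s)
    (hI9 : ∀ s x, I s → I (s.setReg 9 x)) (hJ9 : ∀ s x, J s → J (s.setReg 9 x))
    (hI : ∀ s, Env Λ W X t w es s → I s → Hoare T O iterBody s q_time (fun s' => Bdd Λ s' ∧ I s') 1)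
    (hJ : ∀ s, Env Λ W X t w es s → J s → Hoare T O iterBody s q_time (fun s' => Bdd Λ s' ∧ J s') 1)
    (hIJ : ∀ s, Env Λ W X t w es s → I s →
      Hoare T O iterBody s q_time (fun s' => Bdd Λ s' ∧ J s') q) :
    ∀ s, Env Λ W X t w es s → s.reg 9 = N →
      (I s → Hoare T O iterLoop s (N * (q_time + 20 * Λ) + 5 * Λ)
        (fun s' => Env Λ W X t w es s' ∧ J s') (1 - (1 - q) ^ N)) ∧
      (I s → Hoare T O iterLoop s (N * (q_time + 20 * Λ) + 5 * Λ)
        (fun s' => Env Λ W X t w es s' ∧ I s') 1) ∧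
      (J s → Hoare T O iterLoop s (N * (q_time + 20 * Λ) + 5 * Λ)
        (fun s' => Env Λ W X t w es s' ∧ J s') 1) := by
  -- One round including the decrement of the counter, for either of the two invariants.
  have hstep : ∀ (K : State → Prop) (p : ℝ≥0∞) (N : ℕ) (s : State),
      (∀ s x, K s → K (s.setReg 9 x)) → Env Λ W X t w es s → s.reg 9 = N + 1 →
      Hoare T O iterBody s q_time (fun s' => Bdd Λ s' ∧ K s') p →
      Hoare T O (.seq iterBody (.assign 9 (.sub (.reg 9) (.const 1)))) s (q_time + 15 * Λ)
        (fun s' => (Env Λ W X t w es s' ∧ s'.reg 9 = N) ∧ K s') p := by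
    intro K p N s hK9 hE h9 hb
    refine (hb.and_frame.seq (p' := 1) (t' := 15 * Λ) ?_).mono le_rfl (fun _ h => h) (by simp)
    rintro s1 ⟨⟨hB1, hK1⟩, hF1⟩
    have h9' : s1.reg 9 = N + 1 := (hF1.1 9 (by decide)).trans h9
    have hc := (Term.sub (.reg 9) (.const 1)).cost_le hΛ hB1
    have hcw : (Term.sub (.reg 9) (.const 1)).cw ≤ 10 := by decide
    have hc' := hc.trans (Nat.mul_le_mul_right Λ hcw)
    have hv : (Term.sub (.reg 9) (.const 1)).val s1 = N := by simp [Term.val, h9']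
    refine (Hoare.assign ?_).mono (by omega) (fun _ h => h) le_rfl
    rw [hv]
    have hB2 : Bdd Λ (s1.setReg 9 N) := hB1.setReg (by
      have := hB1.1 9; omega)
    refine ⟨⟨⟨hB2, ?_, ?_, ?_, ?_⟩, by simp⟩, hK9 _ _ hK1⟩
    · refine hE.holds.congr ?_ ?_ ?_ ?_ ?_
      · simpa using hF1.1 0 (by decide)
      · simpa using hF1.1 18 (by decide)
      · exact hF1.2 8 (by decide)
      · exact hF1.2 9 (by decide)
      · exact hF1.2 2 (by decide)
    · simpa using (hF1.1 3 (by decide)).trans hE.reg_W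
    · simpa using (hF1.1 6 (by decide)).trans hE.reg_t
    · simpa using (hF1.1 7 (by decide)).trans hE.reg_X
  induction N with
  | zero =>
    intro s hE h9
    have hc := (Term.reg 9).cost_le hΛ hE.bdd
    simp only [Term.cw] at hc
    have hd : ∀ K : State → Prop, K s → Hoare T O iterLoop s (0 * (q_time + 20 * Λ) + 5 * Λ)
        (fun s' => Env Λ W X t w es s' ∧ K s') 1 := fun K hK =>
      (Hoare.loop_done (by simpa [Term.val] using h9) ⟨hE, hK⟩).mono (by omega) (fun _ h => h) le_rfl
    exact ⟨fun _ => by simpa using Hoare.zero _ _ _ _, hd I, hd J⟩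
  | succ N ih =>
    intro s hE h9
    have hc := (Term.reg 9).cost_le hΛ hE.bdd
    simp only [Term.cw] at hc
    have he : (Term.reg 9).val s ≠ 0 := by simp [Term.val, h9]
    have ht : 1 + (Term.reg 9).cost s + (q_time + 15 * Λ + (N * (q_time + 20 * Λ) + 5 * Λ)) ≤
        (N + 1) * (q_time + 20 * Λ) + 5 * Λ := by
      have : (N + 1) * (q_time + 20 * Λ) = N * (q_time + 20 * Λ) + (q_time + 20 * Λ) := by ring
      omega
    refine ⟨fun hs => ?_, fun hs => ?_, fun hs => ?_⟩
    -- The round always keeps `I`, from where the remaining rounds succeed with probability 1 - (1 -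
    -- q)^N; with probability q it reaches `J`, from where success is certain. `Hoare.seq_mix`
    -- combines the two.
    · refine (Hoare.loop_step he ((hstep I 1 N s hI9 hE h9 (hI s hE hs)).seq_mix
        (d := 1 - (1 - (1 - q) ^ N)) (hstep J q N s hJ9 hE h9 (hIJ s hE hs))
        (fun s' h => ⟨h.1, hJI s' h.2⟩)
        (fun s' h => (ih s' h.1.1 h.1.2).1 h.2)
        (fun s' h => ?_))).mono ht (fun _ h => h) (one_sub_pow_succ_le hq N)
      rw [add_tsub_cancel_of_le tsub_le_self]
      exact (ih s' h.1.1 h.1.2).2.2 h.2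
    · exact (Hoare.loop_step he ((hstep I 1 N s hI9 hE h9 (hI s hE hs)).seq_one
        (fun s' h => (ih s' h.1.1 h.1.2).2.1 h.2))).mono ht (fun _ h => h) le_rfl
    · exact (Hoare.loop_step he ((hstep J 1 N s hJ9 hE h9 (hJ s hE hs)).seq_one
        (fun s' h => (ih s' h.1.1 h.1.2).2.2 h.2))).mono ht (fun _ h => h) le_rfl

theorem sum_sampleProb_univ (p : Fin n → ℝ) (hp : ∀ v, 0 ≤ p v ∧ p v ≤ 1) :
    1 ≤ ∑ Q : Finset (Fin n), ENNReal.ofReal (sampleProb p Q) := by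
  rw [← ENNReal.ofReal_sum_of_nonneg]
  · rw [← ENNReal.ofReal_one]
    refine ENNReal.ofReal_le_ofReal ?_
    have := sum_powerset_nonempty Finset.univ p
    have h2 := Finset.add_sum_erase (Finset.univ : Finset (Fin n)).powerset
      (fun Q => sampleProb p Q) (Finset.empty_mem_powerset _)
    unfold sampleProb at h2 ⊢
    rw [this] at h2
    simp only [Finset.notMem_empty, if_false, add_sub_cancel, Finset.powerset_univ] at h2
    exact h2.le
  · intro Q _
    refine Finset.prod_nonneg fun v _ => ?_
    split_ifs
    · exact (hp v).1
    · exact sub_nonneg.2 (hp v).2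

/-- An iteration has some outcome. -/
theorem hoare_iterBody_all {Λ W X t : ℕ} (hΛ : 1 ≤ Λ) (hes : ∀ e ∈ es, e.1 ≠ e.2)
    (htΛ : 2 ^ t ≤ Λ) (hW : weight w Finset.univ + 1 < 2 ^ Λ) (hnΛ : 2 * n < 2 ^ Λ) {s : State}
    (hE : Env Λ W X t w es s) :
    Hoare T O iterBody s ((es.length + n + 1) * (900 * Λ) + (1 + T es.length n))
      (fun s' => Bdd Λ s' ∧ ∃ A, Outcome w (ofList es) A s s') 1 := by
  -- All scales, samples and answers are admitted, so the three probabilities are 1.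
  refine (hoare_iterBody (pS := 1) (pE := 1) hΛ hE.bdd hE.holds hes hE.reg_t htΛ hW hnΛ Finset.univ
    Finset.univ (fun _ => Set.univ) (fun i _ => sum_sampleProb_univ _ fun v =>
      ⟨inclProb_nonneg _ _, inclProb_le_one _ _⟩) (fun Q _ => ?_)).mono le_rfl ?_ ?_
  · rw [(PMF.toOuterMeasure_apply_eq_one_iff _ _).2]
    exact fun _ _ => Set.mem_univ _
  · rintro s' ⟨h1, Q, -, A, -, h2⟩
    exact ⟨h1, A, h2⟩
  · simp [ENNReal.div_self]

/-- The probability of success of an iteration. -/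
noncomputable def succProb (t X : ℕ) : ℝ≥0∞ := ENNReal.ofReal (1 / (768 * 2 ^ t * X : ℝ))

/-- An iteration finds a cut of weight at most `κ` with probability `succProb`. -/
theorem hoare_iterBody_succ {Λ X t U : ℕ} (hΛ : 1 ≤ Λ) (hes : IsEdgeList (ofList es) es)
    (htΛ : 2 ^ t ≤ Λ) (hW : weight w Finset.univ + 1 < 2 ^ Λ) (hnΛ : 2 * n < 2 ^ Λ)
    (hO : SolvesIsolatingCut U O) (hw : ∀ v, 1 ≤ w v ∧ w v ≤ U)
    (ht : 8 * weight w Finset.univ < 2 ^ 2 ^ t)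
    (hX : 1 ≤ X) {S : Finset (Fin n)} (hS : IsVertexCut (ofList es) S) (hκ : weight w S = κ)
    (hacc : Acc (weight w Finset.univ) X κ) {s : State}
    (hE : Env Λ (weight w Finset.univ) X t w es s) :
    Hoare T O iterBody s ((es.length + n + 1) * (900 * Λ) + (1 + T es.length n))
      (fun s' => Bdd Λ s' ∧ ∃ A, Outcome w (ofList es) A s s' ∧ A.Nonempty ∧
        (∃ v, v ∉ A ∧ v ∉ boundary (ofList es) A) ∧ weight w (boundary (ofList es) A) ≤ κ)
      (succProb t X) := by
  -- The lighter side is the one to be isolated.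
  obtain ⟨A, B, hsp, hAB⟩ : ∃ A B, IsSplit (ofList es) A S B ∧ weight w A ≤ weight w B := by
    obtain ⟨A, B, h⟩ := hS.exists_split
    rcases le_total (weight w A) (weight w B) with h' | h'
    · exact ⟨A, B, h, h'⟩
    · exact ⟨B, A, h.symm, h'⟩
  obtain ⟨i, hi1, hi2⟩ := hsp.exists_scale (fun v => (hw v).1) hAB hX (hκ ▸ hacc)
  -- The good scale satisfies 2^i ≤ 8W < 2^(2^t), so it is one of the 2^t scales that are drawn.
  have hit : i < 2 ^ t := (Nat.pow_lt_pow_iff_right (by norm_num : 1 < 2)).1 (hi1.trans_lt ht)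
  refine (hoare_iterBody (pS := ENNReal.ofReal (1 / (512 * X : ℝ))) (pE := 2 / 3) hΛ hE.bdd hE.holds
    (fun e he => hes.ne he) hE.reg_t htΛ hW hnΛ {⟨i, hit⟩} (goodSamples A S B)
    (fun Q => {A | IsMinIsolating (ofList es) w (thin (ofList es) Q) A}) ?_ ?_).mono le_rfl ?_ ?_
  · intro j hj
    rw [Finset.mem_singleton] at hj
    subst hj
    rw [← ENNReal.ofReal_sum_of_nonneg]
    · exact ENNReal.ofReal_le_ofReal hi2
    · intro Q _
      refine Finset.prod_nonneg fun v _ => ?_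
      split_ifs
      · exact inclProb_nonneg _ _
      · exact sub_nonneg.2 (inclProb_le_one _ _)
  · intro Q hQ
    obtain ⟨⟨r, hr⟩, hQS, hQB⟩ := mem_goodSamples.1 hQ
    refine (hO n (ofList es) es w (thin (ofList es) Q) hes hw (isIndepSet_thin Q)
      (hsp.two_le_card_thin hr hQS hQB)).trans ((O _).toOuterMeasure.mono ?_)
    rintro _ ⟨A', rfl, hA'⟩
    have : toFin n (A'.map Fin.valEmbedding) = A' := by
      ext v; simp [toFin, Fin.val_inj]
    show IsMinIsolating _ _ _ _
    rwa [this]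
  · rintro s' ⟨h1, Q, hQ, A', hA', h2⟩
    obtain ⟨⟨r, hr⟩, hQS, hQB⟩ := mem_goodSamples.1 hQ
    obtain ⟨h3, h4⟩ := hA'.1.outside (hsp.two_le_card_thin hr hQS hQB)
    -- The answer is minimum among isolating sides, and A is one of them with boundary inside S.
    exact ⟨h1, A', h2, h3, h4, (hA'.2 A (hsp.isIsolating hr hQS)).trans
      ((weight_mono hsp.boundary_subset).trans hκ.le)⟩
  -- The product 1/2^t · 1/(512X) · 2/3 is 1/(768 · 2^t · X).
  · have e1 : (1 : ℝ≥0∞) / 2 ^ t = ENNReal.ofReal (1 / 2 ^ t) := by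
      rw [ENNReal.ofReal_div_of_pos (by positivity), ENNReal.ofReal_pow (by norm_num)]
      norm_num
    have e2 : (2 : ℝ≥0∞) / 3 = ENNReal.ofReal (2 / 3) := by
      rw [ENNReal.ofReal_div_of_pos (by positivity)]
      norm_num
    rw [Finset.card_singleton, Nat.cast_one, e1, e2, ← ENNReal.ofReal_mul (by positivity),
      ← ENNReal.ofReal_mul (by positivity), succProb]
    refine ENNReal.ofReal_le_ofReal (le_of_eq ?_)
    have : (X : ℝ) ≠ 0 := by positivity
    field_simp
    norm_num

theorem succProb_le_one {t X : ℕ} (hX : 1 ≤ X) : succProb t X ≤ 1 := by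
  rw [succProb, ← ENNReal.ofReal_one]
  refine ENNReal.ofReal_le_ofReal ?_
  have h1 : (1 : ℝ) ≤ X := by exact_mod_cast hX
  have h2 : (1 : ℝ) ≤ 2 ^ t := one_le_pow₀ (by norm_num)
  rw [div_le_one (by positivity)]
  nlinarith

end Search

/-! ### The stages of the search -/

section Stages

variable {n : ℕ} {G : SimpleGraph (Fin n)} {w : Fin n → ℕ} {es : List (Fin n × Fin n)}
  {ℓ : Fin n × Fin n → ℕ} {κ : ℕ}

/-- The edges with label at most `K`. -/
def lowEdges (es : List (Fin n × Fin n)) (ℓ : Fin n × Fin n → ℕ) (K : ℕ) : List (Fin n × Fin n) :=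
  es.filter fun e => decide (ℓ e ≤ K)

/-- The arrays hold the input graph, its weights and edge labels. -/
structure Loaded (s : State) (w : Fin n → ℕ) (es : List (Fin n × Fin n)) (ℓ : Fin n × Fin n → ℕ) :
    Prop where
  reg_n : s.reg 0 = n
  reg_m : s.reg 1 = es.length
  src : ∀ i (h : i < es.length), s.arr 0 i = es[i].1
  dst : ∀ i (h : i < es.length), s.arr 1 i = es[i].2
  lab : ∀ i (h : i < es.length), s.arr 10 i = ℓ es[i]
  wt : ∀ v : Fin n, s.arr 2 v = w v

theorem Loaded.congr {s s' : State} (h : Loaded s w es ℓ) (h0 : s'.reg 0 = s.reg 0)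
    (h1 : s'.reg 1 = s.reg 1) (a0 : s'.arr 0 = s.arr 0) (a1 : s'.arr 1 = s.arr 1)
    (a2 : s'.arr 2 = s.arr 2) (a10 : s'.arr 10 = s.arr 10) : Loaded s' w es ℓ :=
  ⟨h0.trans h.reg_n, h1.trans h.reg_m, fun i hi => by rw [a0]; exact h.src i hi,
    fun i hi => by rw [a1]; exact h.dst i hi, fun i hi => by rw [a10]; exact h.lab i hi,
    fun v => by rw [a2]; exact h.wt v⟩

/-- Copy edge `reg 12` if its label is at most `reg 19`. -/
def copyBody : Program :=
  .branch (.lt (.cell 10 (.reg 12)) (.add (.reg 19) (.const 1)))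
    (.seq (.store 8 (.reg 18) (.cell 0 (.reg 12)))
      (.seq (.store 9 (.reg 18) (.cell 1 (.reg 12)))
        (.assign 18 (.add (.reg 18) (.const 1))))) .skip

theorem hoare_copyLoop {Λ K : ℕ} (hΛ : 1 ≤ Λ) {s : State} (hB : Bdd Λ s)
    (hs : Loaded s w es ℓ) (hK : s.reg 19 = K) (h18 : s.reg 18 = 0)
    (hm : es.length + 1 < 2 ^ Λ) :
    Hoare T O (forLoop 12 1 copyBody) s ((es.length + 1) * (100 * Λ))
      (fun s' => Bdd Λ s' ∧ SameOff [12, 18] [8, 9] s s' ∧ Holds s' w (lowEdges es ℓ K)) 1 := by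
  refine (Hoare.forLoop_one hΛ (t := copyBody.cw * Λ) (N := es.length)
    (fun k s' => s'.reg 18 = (lowEdges (es.take k) ℓ K).length ∧
      ∀ i (h : i < (lowEdges (es.take k) ℓ K).length),
        s'.arr 8 i = (lowEdges (es.take k) ℓ K)[i].1 ∧
        s'.arr 9 i = (lowEdges (es.take k) ℓ K)[i].2)
    hB hs.reg_m (by decide) (by decide) (by decide) ?_ ?_).mono (loop_time_le (by decide)) ?_ le_rfl
  · simp [lowEdges, h18]
  · intro k hk s' hks hBs hF hI
    obtain ⟨i18, iarr⟩ := hI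
    have e0 : s'.arr 0 k = (es[k].1 : ℕ) := by rw [hF.2 0 (by decide)]; exact hs.src k hk
    have e1 : s'.arr 1 k = (es[k].2 : ℕ) := by rw [hF.2 1 (by decide)]; exact hs.dst k hk
    have e10 : s'.arr 10 k = ℓ es[k] := by rw [hF.2 10 (by decide)]; exact hs.lab k hk
    have e19 : s'.reg 19 = K := (hF.1 19 (by decide)).trans hK
    have htake : lowEdges (es.take (k + 1)) ℓ K =
        lowEdges (es.take k) ℓ K ++ if ℓ es[k] ≤ K then [es[k]] else [] := by
      unfold lowEdges
      rw [List.take_add_one, List.getElem?_eq_getElem hk, Option.toList_some, List.filter_append]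
      congr 1
      split_ifs with h <;> simp [h]
    have hlen : (lowEdges (es.take k) ℓ K).length ≤ es.length := by
      unfold lowEdges
      exact (List.length_filter_le _ _).trans (by simp)
    have b0 := hBs.2 0 k
    have b1 := hBs.2 1 k
    rw [e0] at b0
    rw [e1] at b1
    by_cases h : ℓ es[k] ≤ K
    · have h' : ℓ es[k] < K + 1 := by omega
      refine Hoare.straight hΛ hBs ?_ fun hB' => ⟨hB', ?_⟩
      · simp only [copyBody, Program.Ok, Program.eff, Term.val]
        simp [hks, e0, e1, e10, e19, h', i18, b0, b1]
        omega
      · rw [htake, if_pos h]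
        simp only [copyBody, Program.eff, Term.val]
        simp [hks, e0, e1, e10, e19, h', i18]
        intro i hi
        rcases hi.lt_or_eq with h1 | rfl
        · rw [List.getElem_append_left h1]
          simp [h1.ne, iarr i h1]
        · simp
    · have h' : ¬ ℓ es[k] < K + 1 := by omega
      refine Hoare.straight hΛ hBs ?_ fun hB' => ⟨hB', ?_⟩
      · simp only [copyBody, Program.Ok, Program.eff, Term.val]
        simp [hks, e10, e19, h']
      · rw [htake, if_neg h, List.append_nil]
        simp only [copyBody, Program.eff, Term.val]
        simpa [hks, e10, e19, h', i18] using iarr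
  · rintro s' ⟨h1, h2, h3, h4⟩
    rw [List.take_length] at h3 h4
    refine ⟨h1, h2.mono (by decide) (by decide), (h2.1 0 (by decide)).trans hs.reg_n, h3,
      fun i hi => (h4 i hi).1, fun i hi => (h4 i hi).2, fun v => ?_⟩
    rw [h2.2 2 (by decide)]
    exact hs.wt v

/-- `K` exceeds all affordable weights, but not by far. -/
def Cap (W X K : ℕ) : Prop := ¬ Acc W X K ∧ (K = 2 ∨ ∃ K', K = 2 * K' ∧ Acc W X K')

-- As K is out of reach of X, by `Acc.half` 2K is out of reach of 2X; so one doubling of the cap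
-- suffices.
open Classical in
theorem Cap.step {W X K : ℕ} (h : Cap W X K) :
    Cap W (2 * X) (if Acc W (2 * X) K then 2 * K else K) := by
  split_ifs with hacc
  · exact ⟨fun h' => h.1 h'.half, Or.inr ⟨K, rfl, hacc⟩⟩
  · refine ⟨hacc, h.2.imp_right ?_⟩
    rintro ⟨K', h1, h2⟩
    exact ⟨K', h1, h2.mono (by omega)⟩

/-- `Xs` is the first power of two that suffices for the weight `κ`. -/
structure FirstAcc (W Xs κ : ℕ) : Prop where
  pow : ∃ J, Xs = 2 ^ J
  acc : Acc W Xs κ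
  first : ∀ Y, 2 * Y = Xs → ¬ Acc W Y κ

/-- If half the cap were at least 2κ and affordable with Xs, then κ would be affordable with Xs/2 by
`Acc.half`, against the choice of Xs. -/
theorem Cap.le {W X Xs K : ℕ} (h : Cap W X K) (hXs : FirstAcc W Xs κ) (hX : X ≤ Xs) (hW : 0 < W) :
    K ≤ 4 * max κ 1 := by
  rcases h.2 with rfl | ⟨K', rfl, h'⟩
  · omega
  · have h'' := h'.mono hX
    by_contra hc
    have h2 : 2 * κ ≤ K' := by omega
    obtain ⟨J, hJ⟩ := hXs.pow
    rcases J with _ | J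
    -- For Xs = 1 there is no half, but then only weights at most 1 are affordable.
    · rw [hJ] at h''
      rcases h'' with h3 | h3
      · have : K' ≤ 1 := by nlinarith
        omega
      · rw [pow_zero, one_mul] at h3
        have hK' : 2 ≤ K' := by omega
        have : 2 * W ≤ K' * W := Nat.mul_le_mul_right _ hK'
        omega
    · rw [pow_succ, mul_comm] at hJ
      rw [hJ] at h''
      exact hXs.first (2 ^ J) hJ.symm (h''.anti h2).half

/-- The data and the assumptions of the search. -/
structure Setup (T : ℕ → ℕ → ℕ) (O : Subroutine) (G : SimpleGraph (Fin n)) (w : Fin n → ℕ)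
    (es : List (Fin n × Fin n)) (ℓ : Fin n × Fin n → ℕ) (κ U t L Λ Xs Tm : ℕ) : Prop where
  edge : IsEdgeList G es
  wt : ∀ v, 1 ≤ w v ∧ w v ≤ U
  conn : IsVertexConnectivity G w κ
  cert : ∀ K S, weight w S < K → IsVertexCut (ofList (lowEdges es ℓ K)) S → IsVertexCut G S
  solves : SolvesIsolatingCut U O
  one_le : 1 ≤ Λ
  scale : 8 * weight w Finset.univ < 2 ^ 2 ^ t
  t_le : 2 ^ t ≤ Λ
  big : 16 * (weight w Finset.univ + 1) < 2 ^ Λ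
  big_m : es.length + 1 < 2 ^ Λ
  big_X : 2 * Xs < 2 ^ Λ
  big_LX : L * Xs < 2 ^ Λ
  first : FirstAcc (weight w Finset.univ) Xs κ
  time : ∀ m n, m + n ≤ T m n
  time_le : ∀ K ≤ 4 * max κ 1, T (lowEdges es ℓ K).length n ≤ Tm

theorem card_le_weight (hw : ∀ v, 1 ≤ w v) : n ≤ weight w Finset.univ := by
  have := Finset.sum_le_sum fun v (_ : v ∈ (Finset.univ : Finset (Fin n))) => hw v
  simpa [weight] using this

theorem IsVertexConnectivity.lt_weight (h : IsVertexConnectivity G w κ) (hw : ∀ v, 1 ≤ w v) :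
    κ + 2 ≤ weight w Finset.univ := by
  obtain ⟨S, hS, rfl⟩ := h.1
  obtain ⟨A, B, hsp⟩ := hS.exists_split
  have one_le : ∀ {C : Finset (Fin n)}, C.Nonempty → 1 ≤ weight w C := by
    intro C hC
    obtain ⟨v, hv⟩ := hC
    exact (hw v).trans (Finset.single_le_sum (f := w) (fun _ _ => Nat.zero_le _) hv)
  have := hsp.weight_univ (w := w)
  have := one_le hsp.left
  have := one_le hsp.right
  omega

/-- Deleting edges keeps all cuts, so the minimum cut is still there to be found in the sparsified
graph. -/
theorem lowEdges_cut {K : ℕ} (hes : IsEdgeList G es) {S : Finset (Fin n)}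
    (h : IsVertexCut G S) : IsVertexCut (ofList (lowEdges es ℓ K)) S := by
  obtain ⟨A, B, hsp⟩ := h.exists_split
  refine IsSplit.isVertexCut (A := A) (B := B) { hsp with not_adj := ?_ }
  rintro a ha b hb ⟨-, hab⟩
  refine hsp.not_adj a ha b hb (hes.adj_iff.2 (hab.imp ?_ ?_)) <;> exact List.mem_of_mem_filter

variable {U t L Λ Xs Tm : ℕ}

theorem Setup.pos (h : Setup T O G w es ℓ κ U t L Λ Xs Tm) :
    κ + 2 ≤ weight w Finset.univ := h.conn.lt_weight fun v => (h.wt v).1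

/-- The cap K is not affordable, so affordable cuts are lighter than K and fall under the
certificate property. -/
theorem Setup.cut_of_acc (h : Setup T O G w es ℓ κ U t L Λ Xs Tm) {X K : ℕ}
    (hcap : Cap (weight w Finset.univ) X K) (S : Finset (Fin n))
    (hS : IsVertexCut (ofList (lowEdges es ℓ K)) S)
    (hacc : Acc (weight w Finset.univ) X (weight w S)) : κ ≤ weight w S ∧ IsVertexCut G S := by
  have hlt : weight w S < K := by
    by_contra hc
    exact hcap.1 (hacc.anti (not_lt.1 hc))
  have := h.cert K S hlt hS
  exact ⟨h.conn.2 ⟨S, this, rfl⟩, this⟩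

/-- The state between two stages. -/
structure AtStage (w : Fin n → ℕ) (es : List (Fin n × Fin n)) (ℓ : Fin n × Fin n → ℕ)
    (t L Λ X K : ℕ) (s : State) : Prop where
  bdd : Bdd Λ s
  loaded : Loaded s w es ℓ
  reg_W : s.reg 3 = weight w Finset.univ
  reg_t : s.reg 6 = t
  reg_L : s.reg 8 = L
  reg_X : s.reg 7 = X
  reg_K : s.reg 19 = K

/-- Whether the weight `reg 19` is affordable. -/
def accTerm : Term :=
  .add (.lt (.mul (.reg 19) (.reg 19)) (.add (.reg 7) (.const 1)))
    (.lt (.mul (.reg 19) (.reg 3)) (.add (.mul (.reg 7) (.sub (.reg 3) (.reg 19))) (.const 1)))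

theorem accTerm_val_eq_zero (s : State) :
    accTerm.val s = 0 ↔ ¬ Acc (s.reg 3) (s.reg 7) (s.reg 19) := by
  simp only [accTerm, Term.val, Acc, Nat.lt_succ_iff]
  split_ifs with h1 h2 h2 <;> simp [h1, h2]

theorem Program.eff_branch_pos {e : Term} {p q : Program} {s : State} (h : e.val s ≠ 0) :
    (Program.branch e p q).eff s = p.eff s := by simp [Program.eff, h]

theorem Program.eff_branch_neg {e : Term} {p q : Program} {s : State} (h : e.val s = 0) :
    (Program.branch e p q).eff s = q.eff s := by simp [Program.eff, h]

theorem Program.Ok_branch_pos {Λ : ℕ} {e : Term} {p q : Program} {s : State} (h : e.val s ≠ 0) :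
    (Program.branch e p q).Ok Λ s ↔ p.Ok Λ s := by simp [Program.Ok, h]

theorem Program.Ok_branch_neg {Λ : ℕ} {e : Term} {p q : Program} {s : State} (h : e.val s = 0) :
    (Program.branch e p q).Ok Λ s ↔ q.Ok Λ s := by simp [Program.Ok, h]

/-- Double the number of iterations and adjust the sparsification. -/
def advance : Program :=
  .seq (.assign 7 (.mul (.const 2) (.reg 7)))
    (.branch accTerm (.assign 19 (.mul (.const 2) (.reg 19))) .skip)

/-- Collect the edges of low label, then search. -/
def stage : Program :=
  .seq (.assign 18 (.const 0))
    (.seq (forLoop 12 1 copyBody)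
      (.seq (.assign 9 (.mul (.reg 8) (.reg 7))) (.seq iterLoop advance)))

/-- The time of one iteration. -/
def stepTime (Λ Tm : ℕ) : ℕ := (Tm + 1) * (1000 * Λ)

/-- The assertion `R` about the result is arbitrary: the same lemma serves the stages that find
nothing and the decisive one. -/
theorem hoare_stage (h : Setup T O G w es ℓ κ U t L Λ Xs Tm) {X K : ℕ} {s : State}
    (hs : AtStage w es ℓ t L Λ X K s) (hcap : Cap (weight w Finset.univ) X K) (hX : X ≤ Xs)
    {R : State → Prop} {p : ℝ≥0∞} (h17 : s.reg 17 = 0)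
    (hR : ∀ s s', R s → s'.reg 17 = s.reg 17 → s'.output = s.output → R s')
    (hloop : ∀ s1, Env Λ (weight w Finset.univ) X t w (lowEdges es ℓ K) s1 → s1.reg 9 = L * X →
      s1.reg 17 = 0 → Hoare T O iterLoop s1 (L * X * stepTime Λ Tm + 5 * Λ)
        (fun s' => Env Λ (weight w Finset.univ) X t w (lowEdges es ℓ K) s' ∧ R s') p) :
    Hoare T O stage s ((es.length + 1) * (100 * Λ) + L * X * stepTime Λ Tm + 300 * Λ)
      (fun s' => (∃ K', Cap (weight w Finset.univ) (2 * X) K' ∧ AtStage w es ℓ t L Λ (2 * X) K' s') ∧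
        R s') p := by
  have hΛ := h.one_le
  have h0 := Hoare.straight' (T := T) (O := O) hΛ (.assign 18 (.const 0)) hs.bdd
    (by simp [Program.Ok, Term.val])
  refine (h0.seq_one (t' := (es.length + 1) * (100 * Λ) + (30 * Λ +
    ((L * X * stepTime Λ Tm + 5 * Λ) + 200 * Λ))) ?_).mono ?_ (fun _ h => h) le_rfl
  swap
  · have : (Program.assign 18 (.const 0)).cw ≤ 10 := by decide
    have := Nat.mul_le_mul_right Λ this
    omega
  rintro s1 ⟨rfl, hB1⟩
  refine (hoare_copyLoop (K := K) hΛ hB1 (hs.loaded.congr rfl rfl rfl rfl rfl rfl) hs.reg_K rfl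
    h.big_m).seq_one ?_
  rintro s2 ⟨hB2, hF2, hH2⟩
  have r2 : ∀ x ∉ [12, 18], s2.reg x = s.reg x := fun x hx => by
    rw [hF2.1 x hx]
    simp only [List.mem_cons, not_or] at hx
    simp [Program.eff, hx.2.1]
  have a2 : ∀ x ∉ [8, 9], s2.arr x = s.arr x := fun x hx => hF2.2 x hx
  have hLX : L * X < 2 ^ Λ := (Nat.mul_le_mul_left L hX).trans_lt h.big_LX
  have e8 : s2.reg 8 = L := (r2 8 (by decide)).trans hs.reg_L
  have e7 : s2.reg 7 = X := (r2 7 (by decide)).trans hs.reg_X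
  have h3 := Hoare.straight' (T := T) (O := O) hΛ (.assign 9 (.mul (.reg 8) (.reg 7))) hB2
    (by simpa [Program.Ok, Term.val, e8, e7] using hLX)
  refine (h3.mono (t' := 30 * Λ) (Nat.mul_le_mul_right Λ (by decide))
    (fun _ h => h) le_rfl).seq_one ?_
  rintro s3 ⟨rfl, hB3⟩
  have hE : Env Λ (weight w Finset.univ) X t w (lowEdges es ℓ K)
      ((Program.assign 9 (.mul (.reg 8) (.reg 7))).eff s2) := by
    refine ⟨hB3, hH2.congr rfl rfl rfl rfl rfl, ?_, ?_, ?_⟩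
    · exact (r2 3 (by decide)).trans hs.reg_W
    · exact (r2 6 (by decide)).trans hs.reg_t
    · exact e7
  have h4 := (hloop _ hE (by simp [Program.eff, Term.val, e8, e7])
    (by simpa [Program.eff] using (r2 17 (by decide)).trans h17))
  refine (Hoare.seq (p' := 1) (t' := 200 * Λ) (h4.and_frame) ?_).mono le_rfl (fun _ h => h) (by simp)
  rintro s4 ⟨⟨hE4, hR4⟩, hF4⟩
  have r4 : ∀ x ∉ [12, 18, 9] ++ iterLoop.wregs, s4.reg x = s.reg x := fun x hx => by
    simp only [List.mem_append, List.mem_cons, not_or] at hx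
    rw [hF4.1 x hx.2]
    simp only [Program.eff, setReg_reg, if_neg hx.1.2.2.1]
    exact r2 x (by simp only [List.mem_cons, not_or]; tauto)
  have a4 : ∀ x ∉ [8, 9] ++ iterLoop.warrs, s4.arr x = s.arr x := fun x hx => by
    simp only [List.mem_append, not_or] at hx
    rw [hF4.2 x hx.2]
    exact a2 x hx.1
  have e19 : s4.reg 19 = K := (r4 19 (by decide)).trans hs.reg_K
  have hK : K ≤ 4 * max κ 1 := hcap.le h.first hX (by have := h.pos; omega)
  have hKΛ : 2 * K < 2 ^ Λ := by
    have := h.pos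
    have := h.big
    omega
  have hXΛ : 2 * X < 2 ^ Λ := by have := h.big_X; omega
  have hacc : accTerm.val (s4.setReg 7 (2 * s4.reg 7)) = 0 ↔
      ¬ Acc (weight w Finset.univ) (2 * X) K := by
    rw [accTerm_val_eq_zero]
    simp [e19, hE4.reg_W, hE4.reg_X]
  -- The program makes the case distinction of `Cap.step`.
  obtain ⟨K', hcap', hok, heff⟩ : ∃ K', Cap (weight w Finset.univ) (2 * X) K' ∧ advance.Ok Λ s4 ∧
      advance.eff s4 = (s4.setReg 7 (2 * X)).setReg 19 K' := by
    refine ⟨_, hcap.step, ?_⟩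
    have hok1 : (Program.assign 7 (.mul (.const 2) (.reg 7))).Ok Λ s4 := by
      simpa [Program.Ok, Term.val, hE4.reg_X] using hXΛ
    by_cases hc : Acc (weight w Finset.univ) (2 * X) K
    · have hv := fun h' => hacc.1 h' hc
      rw [if_pos hc]
      refine ⟨⟨hok1, (Program.Ok_branch_pos hv).2 ?_⟩, (Program.eff_branch_pos hv).trans ?_⟩
      · simp [Program.Ok, Term.val, e19, hKΛ]
      · simp [Program.eff, Term.val, e19, hE4.reg_X]
    · have hv := hacc.2 hc
      rw [if_neg hc, ← e19]
      refine ⟨⟨hok1, (Program.Ok_branch_neg hv).2 trivial⟩, (Program.eff_branch_neg hv).trans ?_⟩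
      simp [Program.eff, State.setReg, hE4.reg_X]
  have h5 := Hoare.straight' (T := T) (O := O) hΛ advance hE4.bdd hok
  refine h5.mono (Nat.mul_le_mul_right Λ (by decide)) ?_ le_rfl
  rintro s5 ⟨rfl, hB5⟩
  refine ⟨⟨K', hcap', hB5, ?_, ?_, ?_, ?_, ?_, ?_⟩, hR _ _ hR4 (by rw [heff]; simp) ?_⟩
  · rw [heff]
    exact hs.loaded.congr (r4 0 (by decide)) (r4 1 (by decide)) (a4 0 (by decide))
      (a4 1 (by decide)) (a4 2 (by decide)) (a4 10 (by decide))
  · rw [heff]; simpa using hE4.reg_W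
  · rw [heff]; simpa using hE4.reg_t
  · rw [heff]; simpa using (r4 8 (by decide)).trans hs.reg_L
  · rw [heff]; simp
  · rw [heff]; simp
  · rw [heff]; simp [State.output]

/-- The work outside the subroutine is linear in the size of the sparsified graph, up to a factor Λ,
and `T m n ≥ m + n` absorbs it. -/
theorem stepTime_le (h : Setup T O G w es ℓ κ U t L Λ Xs Tm) {K : ℕ} (hK : K ≤ 4 * max κ 1) :
    ((lowEdges es ℓ K).length + n + 1) * (900 * Λ) + (1 + T (lowEdges es ℓ K).length n) + 20 * Λ ≤
      stepTime Λ Tm := by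
  have h1 := h.time_le K hK
  have h2 := h.time (lowEdges es ℓ K).length n
  have h3 := h.one_le
  have h4 : ((lowEdges es ℓ K).length + n + 1) * (900 * Λ) ≤ (Tm + 1) * (900 * Λ) :=
    Nat.mul_le_mul_right _ (by omega)
  unfold stepTime
  nlinarith

/-- The setup provides what the loop needs. -/
theorem Setup.loop_spec (h : Setup T O G w es ℓ κ U t L Λ Xs Tm) {X K : ℕ}
    (hcap : Cap (weight w Finset.univ) X K) (hX : X ≤ Xs) (hX1 : 1 ≤ X) {s : State}
    (hE : Env Λ (weight w Finset.univ) X t w (lowEdges es ℓ K) s) (h9 : s.reg 9 = L * X)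
    (h17 : s.reg 17 = 0) :
    (¬ Acc (weight w Finset.univ) X κ → Hoare T O iterLoop s (L * X * stepTime Λ Tm + 5 * Λ)
      (fun s' => Env Λ (weight w Finset.univ) X t w (lowEdges es ℓ K) s' ∧ s'.reg 17 = 0) 1) ∧
    (Acc (weight w Finset.univ) X κ → Hoare T O iterLoop s (L * X * stepTime Λ Tm + 5 * Λ)
      (fun s' => Env Λ (weight w Finset.univ) X t w (lowEdges es ℓ K) s' ∧ Optimal G w κ s')
      (1 - (1 - succProb t X) ^ (L * X))) := by
  have hpos := h.pos
  have hbig := h.big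
  have hn := card_le_weight fun v => (h.wt v).1
  have hK : K ≤ 4 * max κ 1 := hcap.le h.first hX (by omega)
  have hel : IsEdgeList (ofList (lowEdges es ℓ K)) (lowEdges es ℓ K) := h.edge.filter _
  have hall := fun s (hE : Env Λ (weight w Finset.univ) X t w (lowEdges es ℓ K) s) =>
    hoare_iterBody_all (T := T) (O := O) h.one_le (fun e he => hel.ne he) h.t_le (by omega)
      (by omega) hE
  have hle : L * X * ((((lowEdges es ℓ K).length + n + 1) * (900 * Λ) +
      (1 + T (lowEdges es ℓ K).length n)) + 20 * Λ) + 5 * Λ ≤ L * X * stepTime Λ Tm + 5 * Λ :=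
    Nat.add_le_add_right (Nat.mul_le_mul_left _ (stepTime_le h hK)) _
  have hcut := h.cut_of_acc hcap
  constructor
  · intro hacc
    -- An accepted answer would be an affordable cut of weight at least κ, and κ would be
    -- affordable.
    have hno : ∀ s A, Env Λ (weight w Finset.univ) X t w (lowEdges es ℓ K) s →
        ¬ Improves w (ofList (lowEdges es ℓ K)) s A := by
      intro s A hE hi
      have h1 := hi.2.2.1
      rw [hE.reg_W, hE.reg_X] at h1
      exact hacc (h1.anti (hcut _ hi.isVertexCut h1).1)
    have hz : ∀ s, Env Λ (weight w Finset.univ) X t w (lowEdges es ℓ K) s → s.reg 17 = 0 →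
        Hoare T O iterBody s (((lowEdges es ℓ K).length + n + 1) * (900 * Λ) +
          (1 + T (lowEdges es ℓ K).length n)) (fun s' => Bdd Λ s' ∧ s'.reg 17 = 0) 1 := by
      intro s hE h17
      refine (hall s hE).post ?_
      rintro s' ⟨h1, A, ho⟩
      rcases ho with ⟨hi, -⟩ | ⟨-, h2, -⟩
      · exact (hno s A hE hi).elim
      · exact ⟨h1, h2.trans h17⟩
    refine ((hoare_iterLoop (q := 1) (J := fun s' => s'.reg 17 = 0) (I := fun s' => s'.reg 17 = 0)
      h.one_le le_rfl (fun _ h => h) (fun s x hs => by simpa using hs)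
      (fun s x hs => by simpa using hs) hz hz hz s hE h9).2.1 h17).mono hle (fun _ h => h) le_rfl
  · intro hacc
    obtain ⟨S, hS, hSκ⟩ := h.conn.1
    have hS' := lowEdges_cut (K := K) (ℓ := ℓ) h.edge hS
    refine ((hoare_iterLoop (q := succProb t X) (J := Optimal G w κ) (I := Found G w κ)
      h.one_le (succProb_le_one hX1) (fun _ h => h.found)
      (fun s x hs => by simpa [Found, State.output] using hs)
      (fun s x hs => by simpa [Optimal, State.output] using hs) (fun s hE hs => ?_)
      (fun s hE hs => ?_) (fun s hE hs => ?_) s hE h9).1 (Or.inl h17)).mono hle (fun _ h => h) le_rfl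
    · exact (hall s hE).post fun s' ⟨h1, A, ho⟩ => ⟨h1, ho.found hcut hE.reg_W hE.reg_X hs⟩
    · exact (hall s hE).post fun s' ⟨h1, A, ho⟩ => ⟨h1, ho.optimal hcut hE.reg_W hE.reg_X hs⟩
    · refine (hoare_iterBody_succ h.one_le hel h.t_le (by omega) (by omega) h.solves h.wt h.scale
        hX1 hS' hSκ hacc hE).post ?_
      rintro s' ⟨h1, A, ho, hA, hout, hle⟩
      exact ⟨h1, ho.optimal_of_le hacc hcut hE.reg_W hE.reg_X hs hA hout hle⟩

/-- Run stages until a vertex cut is found. -/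
def mainLoop : Program := .loop (.eq (.reg 17) (.const 0)) stage

/-- The number d counts the stages before the decisive one. The term with X on the right of the time
bound accounts for the stages already over: those still to come have total length X + 2X + ... + Xs
= 2Xs - X. -/
theorem hoare_mainLoop (h : Setup T O G w es ℓ κ U t L Λ Xs Tm) (d : ℕ) :
    ∀ (X K τ : ℕ) (s : State), AtStage w es ℓ t L Λ X K s → Cap (weight w Finset.univ) X K →
      X * 2 ^ d = Xs → s.reg 17 = 0 →
      (d + 1) * ((es.length + 1) * (100 * Λ) + 320 * Λ) + L * (2 * Xs) * stepTime Λ Tm + 10 * Λ ≤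
        τ + L * X * stepTime Λ Tm →
      Hoare T O mainLoop s τ (Optimal G w κ) (1 - (1 - succProb t Xs) ^ (L * Xs)) := by
  have hcost : ∀ s, Bdd Λ s → 1 + (Term.eq (.reg 17) (.const 0)).cost s ≤ 10 * Λ := by
    intro s hs
    have h1 := (Term.eq (.reg 17) (.const 0)).cost_le h.one_le hs
    have h2 : (Term.eq (.reg 17) (.const 0)).cw ≤ 8 := by decide
    have := Nat.mul_le_mul_right Λ h2
    have := h.one_le
    omega
  have hXs1 : 1 ≤ Xs := by
    obtain ⟨J, hJ⟩ := h.first.pow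
    rw [hJ]; exact Nat.one_le_two_pow
  induction d with
  | zero =>
    intro X K τ s hs hcap hXd h17 hτ
    rw [pow_zero, mul_one] at hXd
    subst hXd
    have hst := hoare_stage h hs hcap le_rfl h17 (R := Optimal G w κ)
      (fun s s' hs h1 h2 => by unfold Optimal at hs ⊢; rwa [h1, h2])
      (fun s1 hE h9 h17 => ((h.loop_spec hcap le_rfl hXs1 hE h9 h17).2 h.first.acc))
    refine (Hoare.loop_step (by simp [Term.val, h17]) ((hst.seq (p' := 1) (t' := 10 * Λ)
      (R := Optimal G w κ) ?_))).mono ?_ (fun _ h => h) (by simp)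
    · rintro s1 ⟨⟨K', -, h2⟩, h1⟩
      exact (Hoare.loop_done (by simp [Term.val, h1.1]) h1).mono (hcost s1 h2.bdd) (fun _ h => h)
        le_rfl
    · have := hcost s hs.bdd
      have e : L * (2 * X) * stepTime Λ Tm = 2 * (L * X * stepTime Λ Tm) := by ring
      rw [e] at hτ
      omega
  | succ d ih =>
    intro X K τ s hs hcap hXd h17 hτ
    have hX1 : 1 ≤ X := by
      rcases Nat.eq_zero_or_pos X with rfl | h'
      · simp at hXd; omega
      · exact h'
    have h2X : 2 * X ≤ Xs := by
      rw [← hXd, pow_succ]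
      have : 1 ≤ 2 ^ d := Nat.one_le_two_pow
      nlinarith
    -- Before the last stage X ≤ Xs/2, which does not suffice for κ.
    have hnacc : ¬ Acc (weight w Finset.univ) X κ := by
      intro hacc
      refine h.first.first (X * 2 ^ d) (by rw [← hXd]; ring) (hacc.mono ?_)
      exact Nat.le_mul_of_pos_right _ (by positivity)
    have hst := hoare_stage h hs hcap (by omega) h17 (R := fun s => s.reg 17 = 0)
      (fun s s' hs h1 h2 => by rw [h1]; exact hs)
      (fun s1 hE h9 h17 => ((h.loop_spec hcap (by omega) hX1 hE h9 h17).1 hnacc))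
    set A := (es.length + 1) * (100 * Λ) + 320 * Λ with hA
    have e1 : L * (2 * X) * stepTime Λ Tm = 2 * (L * X * stepTime Λ Tm) := by ring
    have e3 : L * (2 * X) * stepTime Λ Tm ≤ L * (2 * Xs) * stepTime Λ Tm :=
      Nat.mul_le_mul_right _ (Nat.mul_le_mul_left _ (by omega))
    have e2 : (d + 1 + 1) * A = (d + 1) * A + A := by ring
    rw [e2] at hτ
    have hge : A ≤ (d + 1) * A := Nat.le_mul_of_pos_left _ (by omega)
    have := hcost s hs.bdd
    refine (Hoare.loop_step (t := τ - 10 * Λ) (by simp [Term.val, h17]) ((hst.seq_one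
      (t' := τ - (A + L * X * stepTime Λ Tm)) (R := Optimal G w κ) ?_).mono ?_ (fun _ h => h)
        le_rfl)).mono ?_ (fun _ h => h) le_rfl
    · rintro s1 ⟨⟨K', h1, h2⟩, h3⟩
      refine ih (2 * X) K' _ s1 h2 h1 (by rw [← hXd]; ring) h3 ?_
      omega
    · omega
    · omega

end Stages

/-! ### The complete search -/

section Search

variable {n : ℕ} {G : SimpleGraph (Fin n)} {w : Fin n → ℕ} {es : List (Fin n × Fin n)}
  {ℓ : Fin n × Fin n → ℕ} {κ : ℕ}

/-- Store the total weight in register `3`. -/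
def weightLoop : Program :=
  .seq (.assign 3 (.const 0)) (forLoop 11 0 (.assign 3 (.add (.reg 3) (.cell 2 (.reg 11)))))

theorem hoare_weightLoop {Λ : ℕ} (hΛ : 1 ≤ Λ) {s : State} (hB : Bdd Λ s) (hs : Loaded s w es ℓ)
    (hW : weight w Finset.univ < 2 ^ Λ) :
    Hoare T O weightLoop s (10 * Λ + (n + 1) * (100 * Λ))
      (fun s' => Bdd Λ s' ∧ SameOff [3, 11] [] s s' ∧ s'.reg 3 = weight w Finset.univ) 1 := by
  have h0 := Hoare.straight' (T := T) (O := O) hΛ (.assign 3 (.const 0)) hB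
    (by simp [Program.Ok, Term.val])
  refine (h0.mono (t' := 10 * Λ) (Nat.mul_le_mul_right Λ (by decide)) (fun _ h => h)
    le_rfl).seq_one ?_
  rintro s1 ⟨rfl, hB1⟩
  have hsum : ∑ i ∈ Finset.range n, s.arr 2 i = weight w Finset.univ := by
    rw [Finset.sum_range]
    exact Finset.sum_congr rfl fun v _ => hs.wt v
  refine (Hoare.forLoop_one hΛ (t := (Program.assign 3 (.add (.reg 3) (.cell 2 (.reg 11)))).cw * Λ)
    (N := n) (fun k s' => s'.reg 3 = ∑ i ∈ Finset.range k, s.arr 2 i)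
    hB1 (by exact hs.reg_n) (by decide) (by decide) (by decide) ?_ ?_).mono (loop_time_le (by decide)) ?_ le_rfl
  · simp [Program.eff, Term.val]
  · intro k hk s' hks hBs hF hI
    have e2 : s'.arr 2 k = s.arr 2 k := by rw [hF.2 2 (by decide)]; rfl
    have hle : ∑ i ∈ Finset.range (k + 1), s.arr 2 i < 2 ^ Λ := by
      refine lt_of_le_of_lt ?_ (hsum.trans_lt hW)
      exact Finset.sum_le_sum_of_subset (by simpa using hk)
    rw [Finset.sum_range_succ] at hle
    refine Hoare.straight hΛ hBs ?_ fun hB' => ⟨hB', ?_⟩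
    · simpa [Program.Ok, Term.val, hks, hI, e2] using hle
    · simp [Program.eff, Term.val, hks, hI, e2, Finset.sum_range_succ]
  · rintro s' ⟨h1, h2, h3⟩
    refine ⟨h1, ⟨fun x hx => ?_, fun a ha => h2.2 a (by simp [Program.warrs])⟩, h3.trans hsum⟩
    simp only [List.mem_cons, not_or] at hx
    rw [h2.1 x (by simp [Program.wregs, hx.1, hx.2.1])]
    simp [Program.eff, hx.1]

/-- Store the least power of two that is at least `e` in register `5`, and its exponent in register
`x`. -/
def powLoop (x : ℕ) (e : Term) : Program :=
  .seq (.assign 5 (.const 1)) (.seq (.assign x (.const 0))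
    (.loop (.lt (.reg 5) e)
      (.seq (.assign 5 (.mul (.const 2) (.reg 5))) (.assign x (.add (.reg x) (.const 1))))))

theorem hoare_powLoop {Λ : ℕ} (hΛ : 1 ≤ Λ) {s : State} (hB : Bdd Λ s) {x N : ℕ} {e : Term}
    (hx : x ≠ 5) (he : ∀ s', SameOff [5, x] [] s s' → e.val s' = N) (hN : 2 * N < 2 ^ Λ)
    (hcw : e.cw ≤ 30) :
    Hoare T O (powLoop x e) s ((Λ + 2) * (100 * Λ))
      (fun s' => Bdd Λ s' ∧ SameOff [5, x] [] s s' ∧ s'.reg 5 = 2 ^ Nat.clog 2 N ∧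
        s'.reg x = Nat.clog 2 N) 1 := by
  have hpow : 2 ^ 1 ≤ 2 ^ Λ := Nat.pow_le_pow_right (by norm_num) hΛ
  have hclog : Nat.clog 2 N ≤ Λ := (Nat.clog_le_iff_le_pow (by norm_num)).2 (by omega)
  have h1 := Hoare.straight' (T := T) (O := O) hΛ (.assign 5 (.const 1)) hB
    (by simp only [Program.Ok, Term.val]; omega)
  refine (Hoare.seq_one (t' := 30 * Λ + (Λ * (1 + 34 * Λ + 40 * Λ) + (1 + 34 * Λ)))
    (h1.mono (t' := 30 * Λ) (Nat.mul_le_mul_right Λ (by decide)) (fun _ h => h) le_rfl) ?_).mono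
    ?_ (fun _ h => h) le_rfl
  swap
  · nlinarith
  rintro s1 ⟨rfl, hB1⟩
  have h2 := Hoare.straight' (T := T) (O := O) hΛ (.assign x (.const 0)) hB1
    (by simp [Program.Ok, Term.val])
  refine Hoare.seq_one (h2.mono (t' := 30 * Λ) (Nat.mul_le_mul_right Λ (by
    simp [Program.cw, Term.cw])) (fun _ h => h) le_rfl) ?_
  rintro s2 ⟨rfl, hB2⟩
  -- The loop test is stated in terms of the exponent, which makes the distance to the final
  -- exponent the decreasing bound.
  have hlog : ∀ k, 2 ^ k < N ↔ k < Nat.clog 2 N := fun k =>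
    (Nat.lt_clog_iff_pow_lt (by norm_num)).symm
  refine (Hoare.while (T := T) (O := O) (M := Nat.clog 2 N) (t := 40 * Λ) (ce := 34 * Λ)
    (fun M s' => Bdd Λ s' ∧ SameOff [5, x] [] s s' ∧ s'.reg 5 = 2 ^ s'.reg x ∧
      s'.reg x + M = Nat.clog 2 N) ?_ ?_ ?_).mono ?_ ?_ le_rfl
  · rintro M s' ⟨hB', -⟩
    refine ((Term.lt (.reg 5) e).cost_le hΛ hB').trans (Nat.mul_le_mul_right Λ ?_)
    simp only [Term.cw]; omega
  · rintro M s' ⟨hB', hF, h5, hM⟩ hlt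
    have hlt' : 2 ^ s'.reg x < N := by
      by_contra hc
      exact hlt (by simp [Term.val, h5, he s' hF, hc])
    have hk := (hlog _).1 hlt'
    have hxΛ : s'.reg x + 1 < 2 ^ Λ := by
      have := Nat.lt_two_pow_self (n := Λ)
      omega
    refine (Hoare.straight (T := T) (O := O) hΛ hB' (P := .seq (.assign 5 (.mul (.const 2) (.reg 5)))
      (.assign x (.add (.reg x) (.const 1)))) ?_ fun hB'' =>
        ⟨M - 1, by omega, hB'', hF.trans ⟨?_, ?_⟩, ?_, ?_⟩).mono ?_ (fun _ h => h) le_rfl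
    · simp [Program.Ok, Program.eff, Term.val, hx, h5, hxΛ]; omega
    · refine Nat.mul_le_mul_right Λ ?_
      have : Nat.size 1 = 1 := by decide
      have : Nat.size 2 = 2 := by decide
      simp [Program.cw, Term.cw, Term.bits, *]
    · intro y hy
      simp only [List.mem_cons, not_or] at hy
      simp [Program.eff, hy.1, hy.2.1]
    · intro a _
      rfl
    · simp [Program.eff, Term.val, hx, hx.symm, h5, pow_succ, mul_comm]
    · simp [Program.eff, Term.val, hx]; omega
  · refine ⟨hB2, ⟨?_, ?_⟩, ?_, ?_⟩
    · intro y hy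
      simp only [List.mem_cons, not_or] at hy
      simp [Program.eff, hy.1, hy.2.1]
    · intro a _
      rfl
    · simp [Program.eff, Term.val, hx.symm]
    · simp [Program.eff, Term.val]
  · gcongr
  · rintro s' ⟨h0, M, h1, h2, h3, h4⟩
    have : s'.reg x = Nat.clog 2 N := by
      by_contra hc
      have := (hlog (s'.reg x)).2 (by omega)
      rw [← h3] at this
      simp [Term.val, he s' h2, this] at h0
    exact ⟨h1, h2, by rw [h3, this], this⟩

/-- Search for a minimum weight vertex cut; the failure probability is at most `n ^ (-c)`. -/
def searchProg (c : ℕ) : Program :=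
  .seq weightLoop
    (.seq (powLoop 4 (.add (.reg 3) (.const 1)))
      (.seq (powLoop 6 (.add (.reg 4) (.const 4)))
        (.seq (.seq (.assign 8 (.mul (.const (768 * (c + 1))) (.mul (.reg 4) (.reg 5))))
            (.seq (.assign 7 (.const 1)) (.assign 19 (.const 2))))
          mainLoop)))

/-- The logarithm of the largest inverse sampling rate. -/
def scaleExp (W : ℕ) : ℕ := Nat.clog 2 (Nat.clog 2 (W + 1) + 4)

/-- The number of iterations per unit. -/
def repetitions (c W : ℕ) : ℕ := 768 * (c + 1) * (Nat.clog 2 (W + 1) * 2 ^ scaleExp W)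

theorem cap_one {W : ℕ} (hW : 2 ≤ W) : Cap W 1 2 := by
  refine ⟨?_, Or.inl rfl⟩
  rintro (h | h) <;> omega

theorem hoare_searchProg {U Λ Xs Tm c : ℕ}
    (h : Setup T O G w es ℓ κ U (scaleExp (weight w Finset.univ))
      (repetitions c (weight w Finset.univ)) Λ Xs Tm)
    (hc : Nat.size (768 * (c + 1)) ≤ Λ) {s : State} (hB : Bdd Λ s) (hs : Loaded s w es ℓ)
    (h17 : s.reg 17 = 0) :
    Hoare T O (searchProg c) s (3000 * Λ ^ 2 * (es.length + n + 1) +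
        2000 * Λ * (repetitions c (weight w Finset.univ) * Xs * (Tm + 1))) (Optimal G w κ)
      (1 - (1 - succProb (scaleExp (weight w Finset.univ)) Xs) ^
        (repetitions c (weight w Finset.univ) * Xs)) := by
  have hΛ := h.one_le
  have hbig := h.big
  have hpos := h.pos
  obtain ⟨d, hd⟩ := h.first.pow
  have hX := h.big_X
  -- The number of stages is logarithmic because Xs = 2^d fits into a word.
  have hdΛ : d ≤ Λ := by
    rw [hd] at hX
    exact ((Nat.pow_lt_pow_iff_right (by norm_num)).1 (lt_of_le_of_lt (by omega) hX)).le
  have hXs : 1 ≤ Xs := by rw [hd]; exact Nat.one_le_two_pow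
  have hL : repetitions c (weight w Finset.univ) < 2 ^ Λ :=
    (Nat.le_mul_of_pos_right _ hXs).trans_lt h.big_LX
  set W := weight w Finset.univ with hWdef
  set L := repetitions c W with hLdef
  have hlg : Nat.clog 2 (W + 1) ≤ W + 1 :=
    (Nat.clog_le_iff_le_pow (by norm_num)).2 (Nat.lt_two_pow_self).le
  set τ := (d + 1) * ((es.length + 1) * (100 * Λ) + 320 * Λ) + L * (2 * Xs) * stepTime Λ Tm + 10 * Λ
    with hτ
  have htime : 10 * Λ + (n + 1) * (100 * Λ) + ((Λ + 2) * (100 * Λ) + ((Λ + 2) * (100 * Λ) +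
      ((100 + 3 * Λ) * Λ + τ))) ≤ 3000 * Λ ^ 2 * (es.length + n + 1) +
        2000 * Λ * (L * Xs * (Tm + 1)) := by
    have e : L * (2 * Xs) * stepTime Λ Tm = 2000 * Λ * (L * Xs * (Tm + 1)) := by
      unfold stepTime; ring
    rw [hτ, e]
    have h1 : (d + 1) * ((es.length + 1) * (100 * Λ) + 320 * Λ) ≤
        (2 * Λ) * ((es.length + n + 1) * (420 * Λ)) := by
      refine Nat.mul_le_mul (by omega) ?_
      nlinarith
    have h2 : Λ ≤ Λ ^ 2 := by nlinarith
    have h3 : Λ ^ 2 ≤ Λ ^ 2 * (es.length + n + 1) := Nat.le_mul_of_pos_right _ (by omega)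
    have h4 : (n + 1) * (100 * Λ) ≤ 100 * (Λ ^ 2 * (es.length + n + 1)) := by
      calc (n + 1) * (100 * Λ) ≤ (es.length + n + 1) * (100 * Λ ^ 2) := by gcongr; omega
        _ = _ := by ring
    nlinarith
  refine ((hoare_weightLoop hΛ hB hs (by omega)).seq_one ?_).mono htime (fun _ h => h) le_rfl
  rintro s1 ⟨hB1, hF1, h31⟩
  refine (hoare_powLoop hΛ hB1 (N := W + 1) (by decide) (fun s' hs' => ?_) (by omega)
    (by decide)).seq_one ?_
  · simp [Term.val, hs'.1 3 (by decide), h31, hWdef]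
  rintro s2 ⟨hB2, hF2, -, h42⟩
  refine (hoare_powLoop hΛ hB2 (N := Nat.clog 2 (W + 1) + 4) (by decide) (fun s' hs' => ?_)
    (by omega) (by decide)).seq_one ?_
  · simp [Term.val, hs'.1 4 (by decide), h42]
  rintro s3 ⟨hB3, hF3, h53, h63⟩
  have h43 : s3.reg 4 = Nat.clog 2 (W + 1) := (hF3.1 4 (by decide)).trans h42
  have hF : SameOff [3, 4, 5, 6, 11] [] s s3 :=
    ((hF1.mono (by decide) (by decide)).trans (hF2.mono (by decide) (by decide))).trans
      (hF3.mono (by decide) (by decide))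
  have hpow : 2 < 2 ^ Λ := by omega
  have hinit := Hoare.straight' (T := T) (O := O) hΛ
    (.seq (.assign 8 (.mul (.const (768 * (c + 1))) (.mul (.reg 4) (.reg 5))))
      (.seq (.assign 7 (.const 1)) (.assign 19 (.const 2)))) hB3 (by
    simp only [Program.Ok, Term.val, h43, h53]
    exact ⟨hL, by omega, hpow⟩)
  refine (hinit.mono ?_ (fun _ h => h) le_rfl).seq_one ?_
  · refine Nat.mul_le_mul_right Λ ?_
    have : Nat.size 1 = 1 := by decide
    have : Nat.size 2 = 2 := by decide
    simp only [Program.cw, Term.cw, Term.bits, *]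
    omega
  rintro s4 ⟨rfl, hB4⟩
  refine hoare_mainLoop h d 1 2 τ _ ⟨hB4, ?_, ?_, ?_, ?_, ?_, ?_⟩ (cap_one (by omega))
    (by rw [hd, one_mul]) ?_ (by rw [hτ]; omega)
  · refine hs.congr ?_ ?_ ?_ ?_ ?_ ?_
    · simpa [Program.eff] using hF.1 0 (by decide)
    · simpa [Program.eff] using hF.1 1 (by decide)
    · simpa [Program.eff] using hF.2 0 (by decide)
    · simpa [Program.eff] using hF.2 1 (by decide)
    · simpa [Program.eff] using hF.2 2 (by decide)
    · simpa [Program.eff] using hF.2 10 (by decide)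
  · simpa [Program.eff] using (hF3.1 3 (by decide)).trans ((hF2.1 3 (by decide)).trans h31)
  · exact h63
  · simp [Program.eff, Term.val, h43, h53, hLdef, repetitions, scaleExp]
  · simp [Program.eff, Term.val]
  · simp [Program.eff, Term.val]
  · simpa [Program.eff, h17] using hF.1 17 (by decide)

end Search

/-! ### Success probability and running time of the search -/

section Bounds

variable {n : ℕ} {G : SimpleGraph (Fin n)} {w : Fin n → ℕ} {es : List (Fin n × Fin n)}
  {ℓ : Fin n × Fin n → ℕ} {κ : ℕ}

/-- The output is a vertex cut of weight `κ`. -/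
def Solved (G : SimpleGraph (Fin n)) (w : Fin n → ℕ) (κ : ℕ) (s : State) : Prop :=
  ∃ S, weight w S = κ ∧ IsVertexCut G S ∧ s.output = S.map Fin.valEmbedding

theorem Hoare.le_successProb {P : Program} {τ B : ℕ} {p : ℝ≥0∞}
    (hκ : IsVertexConnectivity G w κ)
    (h : Hoare T O P (input es w) τ (Solved G w κ) p) (hB : τ ≤ B) :
    p ≤ successProb T O P G es w B := by
  have := h (B - τ)
  rw [Nat.add_sub_cancel' hB] at this
  refine this.trans ((P.run T O (input es w) B).toOuterMeasure.mono ?_)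
  rintro r ⟨s, b, rfl, -, S, hS, hcut, hout⟩
  exact ⟨s, b, S, rfl, ⟨hcut, fun S' hS' => hS ▸ hκ.2 ⟨S', hS', rfl⟩⟩, hout⟩

/-- The number of rounds that the running time allows for. -/
noncomputable def rounds (W κ : ℕ) : ℝ :=
  (max κ 1 : ℕ) * min ((max κ 1 : ℕ) : ℝ) ((W : ℝ) / ((W : ℝ) - κ))

theorem one_le_rounds {W κ : ℕ} (h : κ < W) : 1 ≤ rounds W κ := by
  have h1 : (1 : ℝ) ≤ (max κ 1 : ℕ) := by exact_mod_cast le_max_right _ _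
  have h2 : (κ : ℝ) < W := by exact_mod_cast h
  have h3 : (1 : ℝ) ≤ W / ((W : ℝ) - κ) := by
    rw [one_le_div (by linarith)]
    have : (0 : ℝ) ≤ κ := by positivity
    linarith
  have h4 := le_min h1 h3
  unfold rounds
  nlinarith

/-- Half of the least suitable power of two violates both conditions of `Acc`, so it is below κ² and
below κW/(W - κ). If the power is 1, there is no half and `one_le_rounds` suffices. -/
theorem exists_firstAcc {W κ : ℕ} (h : κ < W) :
    ∃ Xs, FirstAcc W Xs κ ∧ Xs ≤ 2 * (max κ 1) ^ 2 ∧ (Xs : ℝ) ≤ 2 * rounds W κ := by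
  classical
  have hex : ∃ j, Acc W (2 ^ j) κ := ⟨κ * κ, Or.inl Nat.lt_two_pow_self.le⟩
  have hmax : 1 ≤ max κ 1 := le_max_right _ _
  refine ⟨2 ^ Nat.find hex, ⟨⟨_, rfl⟩, Nat.find_spec hex, ?_⟩, ?_⟩
  · intro Y hY hacc
    rcases hj : Nat.find hex with _ | j
    · rw [hj] at hY; omega
    · rw [hj, pow_succ] at hY
      obtain rfl : Y = 2 ^ j := by omega
      exact Nat.find_min hex (by omega : j < Nat.find hex) hacc
  · rcases hj : Nat.find hex with _ | j
    · have := one_le_rounds h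
      refine ⟨by nlinarith, ?_⟩
      norm_num
      linarith
    · have hn := Nat.find_min hex (by omega : j < Nat.find hex)
      simp only [Acc, not_or, not_le] at hn
      obtain ⟨h1, h2⟩ := hn
      have hκ : 1 ≤ κ := by
        by_contra hc
        obtain rfl : κ = 0 := by omega
        simp at h1
      have e : max κ 1 = κ := max_eq_left hκ
      have h3 : (0 : ℝ) < (W : ℝ) - κ := by
        have : (κ : ℝ) < W := by exact_mod_cast h
        linarith
      have h1' : (2 : ℝ) ^ j ≤ κ * κ := by exact_mod_cast h1.le
      have h2' : (2 : ℝ) ^ j ≤ κ * (W / ((W : ℝ) - κ)) := by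
        rw [← mul_div_assoc, le_div_iff₀ h3]
        have := h2.le
        have hc : ((2 ^ j * (W - κ) : ℕ) : ℝ) ≤ (κ * W : ℕ) := by exact_mod_cast this
        rw [Nat.cast_mul, Nat.cast_sub h.le] at hc
        push_cast at hc
        exact hc
      rw [pow_succ, e]
      refine ⟨by nlinarith, ?_⟩
      unfold rounds
      rw [e, mul_min_of_nonneg _ _ (by positivity)]
      push_cast
      have := le_min h1' h2'
      linarith

/-- The number of bits of all numbers in the search. -/
def wordSize (c N : ℕ) : ℕ := (Nat.size (c + 1) + 30) * Nat.size N

theorem two_pow_clog_lt {N : ℕ} (hN : 2 ≤ N) : 2 ^ Nat.clog 2 N < 2 * N := by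
  have h := Nat.pow_pred_clog_lt_self (b := 2) (by norm_num) (by omega : 1 < N)
  have h0 : 0 < Nat.clog 2 N := Nat.clog_pos (by norm_num) hN
  obtain ⟨k, hk⟩ : ∃ k, Nat.clog 2 N = k + 1 := ⟨Nat.clog 2 N - 1, by omega⟩
  rw [hk] at h ⊢
  rw [pow_succ]
  simp only [Nat.pred_eq_sub_one, Nat.add_sub_cancel] at h
  omega

theorem IsEdgeList.length_lt {σ : ℕ} (hes : IsEdgeList G es) (hn : n < 2 ^ σ) :
    es.length + 1 ≤ 2 ^ (2 * σ) := by
  have := hes.length_le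
  rw [two_mul, pow_add]
  nlinarith

/-! ### Bit lengths of the numbers in the search -/

section Sizes

variable {W σ c Xs : ℕ}

theorem clog_le_size (hW : W < 2 ^ σ) : Nat.clog 2 (W + 1) ≤ σ :=
  (Nat.clog_le_iff_le_pow (by norm_num)).2 hW

/-- Rounding up to a power of two at most doubles σ + 4, and 2(σ + 4) ≤ 10σ. -/
theorem two_pow_scaleExp_le (hW : W < 2 ^ σ) (hσ : 1 ≤ σ) : 2 ^ scaleExp W ≤ 10 * σ := by
  have := clog_le_size hW
  have := two_pow_clog_lt (N := Nat.clog 2 (W + 1) + 4) (by omega)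
  unfold scaleExp
  omega

theorem scale_lt (W : ℕ) : 8 * W < 2 ^ 2 ^ scaleExp W := by
  have h1 : Nat.clog 2 (W + 1) + 4 ≤ 2 ^ scaleExp W := Nat.le_pow_clog (by norm_num) _
  have h2 : W + 1 ≤ 2 ^ Nat.clog 2 (W + 1) := Nat.le_pow_clog (by norm_num) _
  calc 8 * W < 2 ^ (Nat.clog 2 (W + 1) + 4) := by rw [pow_add]; omega
    _ ≤ _ := Nat.pow_le_pow_right (by norm_num) h1

theorem repetitions_le (hW : W < 2 ^ σ) (hσ : 1 ≤ σ) :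
    repetitions c W ≤ 768 * (c + 1) * (10 * σ ^ 2) := by
  have h1 := clog_le_size hW
  have h2 := two_pow_scaleExp_le hW hσ
  calc repetitions c W ≤ 768 * (c + 1) * (σ * (10 * σ)) := by unfold repetitions; gcongr
    _ = _ := by ring

theorem repetitions_mul_lt (hW : W < 2 ^ σ) (hσ : 1 ≤ σ) (hX : Xs ≤ 2 * (2 ^ σ) ^ 2) :
    repetitions c W * Xs < 2 ^ (Nat.size (c + 1) + 30 * σ) := by
  have h1 := repetitions_le (c := c) hW hσ
  have h2 : σ < 2 ^ σ := Nat.lt_two_pow_self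
  have h3 := Nat.lt_size_self (c + 1)
  have h4 : σ ^ 2 < (2 ^ σ) ^ 2 := Nat.pow_lt_pow_left h2 (by norm_num)
  calc repetitions c W * Xs ≤ 768 * (c + 1) * (10 * σ ^ 2) * (2 * (2 ^ σ) ^ 2) :=
        Nat.mul_le_mul h1 hX
    _ ≤ 2 ^ 10 * 2 ^ Nat.size (c + 1) * (2 ^ 4 * (2 ^ σ) ^ 2) * (2 * (2 ^ σ) ^ 2) := by
        gcongr <;> omega
    _ = 2 ^ (Nat.size (c + 1) + (4 * σ + 15)) := by
        rw [pow_add, pow_add, mul_comm 4 σ, pow_mul 2 σ 4]; ring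
    _ < _ := Nat.pow_lt_pow_right (by norm_num) (by omega)

theorem size_mul_le (a b : ℕ) : Nat.size (a * b) ≤ Nat.size a + Nat.size b := by
  rw [Nat.size_le, pow_add]
  exact Nat.mul_lt_mul'' (Nat.lt_size_self a) (Nat.lt_size_self b)

theorem size_le_log {N : ℕ} (hN : 1 ≤ N) : (Nat.size N : ℝ) ≤ 2 * (1 + Real.log N) := by
  have h0 : 0 < Nat.size N := Nat.size_pos.2 hN
  have h1 : 2 ^ (Nat.size N - 1) ≤ N := Nat.lt_size.1 (by omega)
  have h2 : Real.log ((2 : ℝ) ^ (Nat.size N - 1)) ≤ Real.log N :=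
    Real.log_le_log (by positivity) (by exact_mod_cast h1)
  rw [Real.log_pow, Nat.cast_sub h0] at h2
  have h3 := Real.log_two_gt_d9
  have h4 : (1 : ℝ) ≤ Nat.size N := by exact_mod_cast h0
  push_cast at h2
  nlinarith

end Sizes

/-- With enough repetitions the failure probability is polynomially small. -/
theorem le_one_sub_pow {c W Xs : ℕ} (hn : 1 ≤ n) (hnW : n ≤ W) (hX : 1 ≤ Xs) :
    ENNReal.ofReal (1 - 1 / (n : ℝ) ^ c) ≤
      1 - (1 - succProb (scaleExp W) Xs) ^ (repetitions c W * Xs) := by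
  set t := scaleExp W
  have hX' : (1 : ℝ) ≤ Xs := by exact_mod_cast hX
  have ht : (1 : ℝ) ≤ 2 ^ t := one_le_pow₀ (by norm_num)
  set q : ℝ := 1 / (768 * 2 ^ t * Xs) with hq
  have hq0 : 0 ≤ q := by positivity
  have hq1 : q ≤ 1 := by
    rw [hq, div_le_one (by positivity)]
    nlinarith
  have hn' : (1 : ℝ) ≤ n := by exact_mod_cast hn
  have e : (1 : ℝ≥0∞) - (1 - succProb t Xs) ^ (repetitions c W * Xs) =
      ENNReal.ofReal (1 - (1 - q) ^ (repetitions c W * Xs)) := by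
    rw [ENNReal.ofReal_sub _ (by have := sub_nonneg.2 hq1; positivity),
      ENNReal.ofReal_pow (sub_nonneg.2 hq1), ENNReal.ofReal_sub _ hq0, ENNReal.ofReal_one]
    rfl
  rw [e]
  refine ENNReal.ofReal_le_ofReal (sub_le_sub_left ?_ _)
  have h1 : (1 - q) ^ (repetitions c W * Xs) ≤ Real.exp (-q) ^ (repetitions c W * Xs) :=
    pow_le_pow_left₀ (sub_nonneg.2 hq1) (by linarith [Real.add_one_le_exp (-q)]) _
  refine h1.trans ?_
  rw [← Real.exp_nat_mul, one_div, ← Real.exp_log (by linarith : (0 : ℝ) < n), ← Real.exp_nat_mul,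
    ← Real.exp_neg]
  refine Real.exp_le_exp.2 ?_
  -- The factors 768 · 2^t and Xs in the number of iterations cancel the denominator of q.
  have h2 : ((repetitions c W * Xs : ℕ) : ℝ) * -q = -((c + 1) * Nat.clog 2 (W + 1)) := by
    rw [hq]
    unfold repetitions
    push_cast
    field_simp
    rfl
  rw [h2]
  -- The natural logarithm is below the binary one, and n ≤ W because all weights are positive.
  have h3 : Real.log n ≤ Nat.clog 2 (W + 1) := by
    have h4 : n ≤ 2 ^ Nat.clog 2 (W + 1) :=
      (hnW.trans (Nat.le_succ _)).trans (Nat.le_pow_clog (by norm_num) _)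
    have h5 : Real.log n ≤ Real.log ((2 : ℝ) ^ Nat.clog 2 (W + 1)) :=
      Real.log_le_log (by linarith) (by exact_mod_cast h4)
    rw [Real.log_pow] at h5
    have h6 := Real.log_two_lt_d9
    have h7 : (0 : ℝ) ≤ Nat.clog 2 (W + 1) := by positivity
    nlinarith
  have h8 : 0 ≤ Real.log n := Real.log_nonneg hn'
  have h9 : (0 : ℝ) ≤ c := by positivity
  have : (c : ℝ) * Real.log n ≤ (c + 1) * Nat.clog 2 (W + 1) :=
    mul_le_mul (by linarith) h3 h8 (by linarith)
  linarith

theorem wordSize_le (c : ℕ) {N : ℕ} (hN : 1 ≤ N) :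
    (wordSize c N : ℝ) ≤ 2 * (Nat.size (c + 1) + 30) * (1 + Real.log N) := by
  have := size_le_log hN
  rw [wordSize]
  push_cast
  calc _ ≤ ((Nat.size (c + 1) : ℝ) + 30) * (2 * (1 + Real.log N)) := by gcongr
    _ = _ := by ring

/-- The constant in the running time of the search. -/
noncomputable def searchConst (c : ℕ) : ℝ :=
  2 * 10 ^ 7 * (c + 1) * (2 * (Nat.size (c + 1) + 30)) ^ 3

theorem searchTime_le {c N W M Y : ℕ} (hN : 1 ≤ N) (hW : W ≤ N) :
    ((3000 * wordSize c N ^ 2 * M + 2000 * wordSize c N * (repetitions c W * Y) : ℕ) : ℝ) ≤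
      searchConst c * (1 + Real.log N) ^ 3 * (M + Y) := by
  have hσ : 1 ≤ Nat.size N := Nat.size_pos.2 hN
  have hr := repetitions_le (c := c) (hW.trans_lt (Nat.lt_size_self N)) hσ
  have hle : Nat.size N ≤ wordSize c N := Nat.le_mul_of_pos_left _ (by omega)
  set Λ := wordSize c N
  have h1 : 1 ≤ Λ := hσ.trans hle
  have h2 : 3000 * Λ ^ 2 * M + 2000 * Λ * (repetitions c W * Y) ≤
      2 * 10 ^ 7 * (c + 1) * Λ ^ 3 * (M + Y) := by
    calc _ ≤ 3000 * Λ ^ 3 * M + 2000 * Λ * ((768 * (c + 1) * (10 * Λ ^ 2)) * Y) := by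
          have := hr.trans (Nat.mul_le_mul_left _ (Nat.mul_le_mul_left 10 (Nat.pow_le_pow_left hle 2)))
          gcongr
          norm_num
      _ = 3000 * (Λ ^ 3 * M) + 15360000 * ((c + 1) * Λ ^ 3 * Y) := by ring
      -- The coefficient 2000 · 768 · 10 = 15360000 will be rounded up to 2 · 10^7.
      _ ≤ 3000 * ((c + 1) * Λ ^ 3 * M) + 15360000 * ((c + 1) * Λ ^ 3 * Y) := by
          gcongr
          exact Nat.le_mul_of_pos_left _ (by omega)
      _ ≤ 2 * 10 ^ 7 * ((c + 1) * Λ ^ 3 * M) + 2 * 10 ^ 7 * ((c + 1) * Λ ^ 3 * Y) := by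
          gcongr <;> norm_num
      _ = _ := by ring
  refine (Nat.cast_le.2 h2).trans ?_
  have h3 : (Λ : ℝ) ≤ _ := wordSize_le c hN
  have h4 : (Λ : ℝ) ^ 3 ≤ (2 * (Nat.size (c + 1) + 30) * (1 + Real.log N)) ^ 3 :=
    pow_le_pow_left₀ (by positivity) h3 3
  have e : ((2 * 10 ^ 7 * (c + 1) * Λ ^ 3 * (M + Y) : ℕ) : ℝ) =
      2 * 10 ^ 7 * (c + 1) * (Λ : ℝ) ^ 3 * (M + Y) := by push_cast; ring
  rw [mul_pow] at h4
  rw [e, searchConst, mul_assoc (2 * 10 ^ 7 * ((c : ℝ) + 1)) _ ((1 + Real.log N) ^ 3)]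
  exact mul_le_mul_of_nonneg_right (mul_le_mul_of_nonneg_left h4 (by positivity)) (by positivity)

theorem le_mul_of_wt {U : ℕ} (hw : ∀ v, 1 ≤ w v ∧ w v ≤ U) : weight w Finset.univ ≤ n * U := by
  have := Finset.sum_le_sum fun v (_ : v ∈ (Finset.univ : Finset (Fin n))) => (hw v).2
  simpa [weight] using this

/-- The search finds a minimum weight vertex cut with high probability. -/
theorem search_spec {U Tm : ℕ} (c : ℕ) (hes : IsEdgeList G es) (hw : ∀ v, 1 ≤ w v ∧ w v ≤ U)
    (hκ : IsVertexConnectivity G w κ)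
    (hcert : ∀ K S, weight w S < K → IsVertexCut (ofList (lowEdges es ℓ K)) S → IsVertexCut G S)
    (hO : SolvesIsolatingCut U O) (hT : ∀ m n, m + n ≤ T m n)
    (hTm : ∀ K ≤ 4 * max κ 1, T (lowEdges es ℓ K).length n ≤ Tm) :
    ∃ τ Xs : ℕ, (Xs : ℝ) ≤ 2 * rounds (weight w Finset.univ) κ ∧
      (τ : ℝ) ≤ searchConst c * (1 + Real.log (n * U)) ^ 3 *
        ((es.length + n + 1 : ℕ) + (Xs * (Tm + 1) : ℕ)) ∧
      ∀ s, Bdd (wordSize c (n * U)) s → Loaded s w es ℓ → s.reg 17 = 0 →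
        Hoare T O (searchProg c) s τ (Solved G w κ) (ENNReal.ofReal (1 - 1 / (n : ℝ) ^ c)) := by
  have hpos := hκ.lt_weight fun v => (hw v).1
  set W := weight w Finset.univ with hWdef
  have hnW : n ≤ W := card_le_weight fun v => (hw v).1
  have hWN : W ≤ n * U := le_mul_of_wt hw
  have hN : 1 ≤ n * U := by omega
  have hn1 : 1 ≤ n := Nat.pos_of_mul_pos_right hN
  have hσ : 1 ≤ Nat.size (n * U) := Nat.size_pos.2 hN
  have hWσ := hWN.trans_lt (Nat.lt_size_self (n * U))
  obtain ⟨Xs, hfirst, hXκ, hXr⟩ := exists_firstAcc (show κ < W by omega)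
  have hX1 : 1 ≤ Xs := by
    obtain ⟨J, rfl⟩ := hfirst.pow
    exact Nat.one_le_two_pow
  set σ := Nat.size (n * U) with hσdef
  have hΛ : Nat.size (c + 1) + 30 * σ ≤ wordSize c (n * U) := by
    unfold wordSize
    rw [← hσdef]
    nlinarith
  have hpow : ∀ k, k ≤ Nat.size (c + 1) + 30 * σ → 2 ^ k ≤ 2 ^ wordSize c (n * U) := fun k hk =>
    Nat.pow_le_pow_right (by norm_num) (hk.trans hΛ)
  have hX2 : Xs ≤ 2 * (2 ^ σ) ^ 2 := by
    refine hXκ.trans (Nat.mul_le_mul_left 2 (Nat.pow_le_pow_left ?_ 2))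
    omega
  have hS : Setup T O G w es ℓ κ U (scaleExp W) (repetitions c W) (wordSize c (n * U)) Xs Tm :=
    { edge := hes
      wt := hw
      conn := hκ
      cert := hcert
      solves := hO
      one_le := by omega
      scale := scale_lt W
      t_le := (two_pow_scaleExp_le hWσ hσ).trans (by omega)
      big := by
        have := hpow (σ + 5) (by omega)
        rw [pow_add] at this
        omega
      big_m := by
        refine (hes.length_lt (hnW.trans_lt hWσ)).trans_lt ?_
        have := hpow (2 * σ + 1) (by omega)
        have : 2 ^ (2 * σ) < 2 ^ (2 * σ + 1) := Nat.pow_lt_pow_right (by norm_num) (by omega)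
        omega
      big_X := by
        have := hpow (2 * σ + 3) (by omega)
        have e : 2 ^ (2 * σ + 3) = 8 * (2 ^ σ) ^ 2 := by rw [pow_add, mul_comm 2, pow_mul]; ring
        have : 0 < (2 ^ σ) ^ 2 := by positivity
        omega
      big_LX := (repetitions_mul_lt hWσ hσ hX2).trans_le (hpow _ le_rfl)
      first := hfirst
      time := hT
      time_le := hTm }
  refine ⟨_, Xs, hXr, ?_, fun s hB hs h17 =>
    (hoare_searchProg hS ?_ hB hs h17).mono le_rfl (fun _ h => h.2) (le_one_sub_pow hn1 hnW hX1)⟩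
  · have := searchTime_le (c := c) (M := es.length + n + 1) (Y := Xs * (Tm + 1)) hN hWN
    rw [mul_assoc (repetitions c _), ← Nat.cast_mul n U]
    exact this
  · have h1 := size_mul_le 768 (c + 1)
    have h2 : Nat.size 768 = 10 := by decide
    omega

end Bounds

/-! ### Weighted graphs -/

section Input

variable {n : ℕ} {G : SimpleGraph (Fin n)} {w : Fin n → ℕ} {es : List (Fin n × Fin n)} {κ : ℕ}

/-- Array 10 is zero at the start, so all labels are 0 and no edge is ever discarded. Thus the
weighted search runs the general program without sparsification. -/
theorem loaded_input (es : List (Fin n × Fin n)) (w : Fin n → ℕ) :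
    Loaded (input es w) w es (fun _ => 0) where
  reg_n := rfl
  reg_m := rfl
  src i h := by simp [input, h]
  dst i h := by simp [input, h]
  lab i h := rfl
  wt v := by simp [input]

theorem getD_lt {B : ℕ} (hB : 0 < B) {l : List ℕ} (h : ∀ x ∈ l, x < B) (i : ℕ) :
    (l[i]?).getD 0 < B := by
  rcases hi : l[i]? with _ | x
  · simpa using hB
  · exact h x (List.mem_of_getElem? hi)

theorem bdd_input {Λ : ℕ} (hn : n < 2 ^ Λ) (hm : es.length < 2 ^ Λ) (hw : ∀ v, w v < 2 ^ Λ) :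
    Bdd Λ (input es w) := by
  have h0 : 0 < 2 ^ Λ := by positivity
  refine ⟨fun x => ?_, fun a i => ?_⟩
  · simp only [input]
    split_ifs <;> assumption
  · simp only [input]
    split_ifs
    · refine getD_lt h0 (fun x hx => ?_) i
      obtain ⟨e, -, rfl⟩ := List.mem_map.1 hx
      exact e.1.2.trans hn
    · refine getD_lt h0 (fun x hx => ?_) i
      obtain ⟨e, -, rfl⟩ := List.mem_map.1 hx
      exact e.2.2.trans hn
    · refine getD_lt h0 (fun x hx => ?_) i
      obtain ⟨v, rfl⟩ := List.mem_ofFn.1 hx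
      exact hw v
    · exact h0

/-- The word size suffices for numbers that are polynomial in `N`. -/
theorem pow_four_lt_wordSize {c N : ℕ} (hN : 1 ≤ N) : 64 * N ^ 4 < 2 ^ wordSize c N := by
  have h1 := Nat.lt_size_self N
  have h2 : 1 ≤ Nat.size N := Nat.size_pos.2 hN
  calc 64 * N ^ 4 ≤ 2 ^ 6 * (2 ^ Nat.size N) ^ 4 := by gcongr; norm_num
    _ = 2 ^ (6 + 4 * Nat.size N) := by rw [pow_add, mul_comm 4, pow_mul]
    _ < _ := Nat.pow_lt_pow_right (by norm_num) (by unfold wordSize; nlinarith)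

theorem bdd_input_wordSize {U : ℕ} (c : ℕ) (hes : IsEdgeList G es) (hN : 1 ≤ n * U)
    (hw : ∀ v, w v ≤ U) : Bdd (wordSize c (n * U)) (input es w) := by
  have h := pow_four_lt_wordSize (c := c) hN
  have h1 := Nat.pow_le_pow_right hN (by norm_num : 1 ≤ 4)
  rw [pow_one] at h1
  have h2 := Nat.pow_le_pow_right hN (by norm_num : 2 ≤ 4)
  have hn : 0 < n := Nat.pos_of_mul_pos_right hN
  have hU : 0 < U := Nat.pos_of_mul_pos_left hN
  have h3 : n ≤ n * U := Nat.le_mul_of_pos_right _ hU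
  have h4 : U ≤ n * U := Nat.le_mul_of_pos_left _ hn
  have h5 := hes.length_le
  have h6 : n * n ≤ (n * U) ^ 2 := by rw [sq]; exact Nat.mul_le_mul h3 h3
  exact bdd_input (by omega) (by omega) fun v => by have := hw v; omega

theorem lowEdges_zero (es : List (Fin n × Fin n)) (K : ℕ) : lowEdges es (fun _ => 0) K = es := by
  simp [lowEdges]

/-- The weighted case. -/
theorem weighted_vertexCut (c : ℕ) {U : ℕ} (hT : ∀ m n, m + n ≤ T m n)
    (hO : SolvesIsolatingCut U O) (hes : IsEdgeList G es) (hw : ∀ v, 1 ≤ w v ∧ w v ≤ U)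
    (hκ : IsVertexConnectivity G w κ) {B : ℕ}
    (hB : 6 * searchConst c * (1 + Real.log (n * U)) ^ 3 *
      ((max κ 1 : ℕ) * T es.length n *
        min ((max κ 1 : ℕ) : ℝ)
          ((weight w Finset.univ : ℝ) / ((weight w Finset.univ : ℝ) - κ))) ≤ B) :
    ENNReal.ofReal (1 - 1 / (n : ℝ) ^ c) ≤ successProb T O (searchProg c) G es w B := by
  have hpos := hκ.lt_weight fun v => (hw v).1
  have hN : 1 ≤ n * U := by have := le_mul_of_wt hw; omega
  have hn : 1 ≤ n := Nat.pos_of_mul_pos_right hN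
  obtain ⟨τ, Xs, hX, hτ, h⟩ := search_spec (T := T) (O := O) (ℓ := fun _ => 0) c hes hw hκ
    (fun K S _ hS => by rwa [lowEdges_zero, hes.ofList_eq] at hS) hO hT
    (fun K _ => by rw [lowEdges_zero])
  refine (h _ (bdd_input_wordSize c hes hN fun v => (hw v).2) (loaded_input es w)
    rfl).le_successProb hκ ?_
  have hρ := one_le_rounds (show κ < weight w Finset.univ by omega)
  have hTm : ((es.length + n : ℕ) : ℝ) ≤ T es.length n := by exact_mod_cast hT es.length n
  have hn' : (1 : ℝ) ≤ n := by exact_mod_cast hn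
  have hlog : 0 ≤ Real.log (n * U) := by
    rw [← Nat.cast_mul]
    exact Real.log_natCast_nonneg _
  have hsc : 0 ≤ searchConst c := by unfold searchConst; positivity
  -- Let t be the time of a call and ρ the value `rounds`, both at least 1. Then m + n + 1 ≤ 2t ≤
  -- 2ρt and Xs(t + 1) ≤ 2ρ · 2t, in total 6ρt.
  have key : (((es.length + n + 1 : ℕ) + (Xs * (T es.length n + 1) : ℕ) : ℝ)) ≤
      6 * (rounds (weight w Finset.univ) κ * T es.length n) := by
    push_cast at hTm ⊢
    have hm : (0 : ℝ) ≤ es.length := by positivity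
    set ρ := rounds (weight w Finset.univ) κ
    set t : ℝ := (T es.length n : ℝ)
    have h1 : (Xs : ℝ) * (t + 1) ≤ 2 * ρ * (2 * t) :=
      mul_le_mul hX (by linarith) (by linarith) (by linarith)
    have h2 : t ≤ ρ * t := le_mul_of_one_le_left (by linarith) hρ
    linarith
  have : (τ : ℝ) ≤ B := by
    refine hτ.trans (le_trans ?_ hB)
    calc _ ≤ searchConst c * (1 + Real.log (n * U)) ^ 3 *
          (6 * (rounds (weight w Finset.univ) κ * T es.length n)) := by gcongr
      _ = _ := by unfold rounds; ring
  exact_mod_cast this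

end Input

/-! ### Sparse certificates from maximum adjacency orders -/

section MaximumAdjacency

variable {n : ℕ} {G : SimpleGraph (Fin n)} {es : List (Fin n × Fin n)}
  {ℓ : Fin n × Fin n → ℕ} {κ : ℕ} {pos : Fin n → ℕ}

open Classical in
/-- The neighbours of `y` at a position before `p`; position `0` means that a vertex has not been
scanned. -/
noncomputable def backNbrs (G : SimpleGraph (Fin n)) (pos : Fin n → ℕ) (p : ℕ) (y : Fin n) :
    Finset (Fin n) :=
  Finset.univ.filter fun z => pos z ≠ 0 ∧ pos z < p ∧ G.Adj z y

theorem mem_backNbrs {p : ℕ} {y z : Fin n} :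
    z ∈ backNbrs G pos p y ↔ pos z ≠ 0 ∧ pos z < p ∧ G.Adj z y := by
  simp [backNbrs]

theorem backNbrs_mono {p q : ℕ} (h : p ≤ q) (y : Fin n) :
    backNbrs G pos p y ⊆ backNbrs G pos q y := fun z hz => by
  rw [mem_backNbrs] at hz ⊢
  exact ⟨hz.1, hz.2.1.trans_le h, hz.2.2⟩

theorem card_backNbrs_lt (p : ℕ) (y : Fin n) : (backNbrs G pos p y).card < n := by
  have h : backNbrs G pos p y ⊆ Finset.univ.erase y := fun z hz =>
    Finset.mem_erase.2 ⟨(mem_backNbrs.1 hz).2.2.ne, Finset.mem_univ z⟩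
  have := Finset.card_le_card h
  rw [Finset.card_erase_of_mem (Finset.mem_univ y), Finset.card_univ, Fintype.card_fin] at this
  have := y.pos
  omega

/-- `pos` is a maximum adjacency order: every vertex `x` has the largest number of neighbours
before it among all vertices from `x` on; `ℓ` numbers the edges to each vertex from the vertices
before it. -/
structure IsMaxAdjOrder (G : SimpleGraph (Fin n)) (es : List (Fin n × Fin n)) (pos : Fin n → ℕ)
    (ℓ : Fin n × Fin n → ℕ) : Prop where
  ne_zero : ∀ v, pos v ≠ 0
  inj : Function.Injective pos
  max : ∀ x y, pos x ≤ pos y → (backNbrs G pos (pos x) y).card ≤ (backNbrs G pos (pos x) x).card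
  lab : ∀ x y, pos x < pos y → ∀ e ∈ es, e = (x, y) ∨ e = (y, x) →
    ℓ e = (backNbrs G pos (pos x) y).card + 1

theorem backNbrs_succ_of_ne {p : ℕ} {y : Fin n} (h : ∀ z, pos z ≠ p) :
    backNbrs G pos (p + 1) y = backNbrs G pos p y := by
  ext z
  simp only [mem_backNbrs]
  have := h z
  constructor <;> rintro ⟨h1, h2, h3⟩ <;> exact ⟨h1, by omega, h3⟩

theorem card_backNbrs_succ_le (hinj : Function.Injective pos) (z y : Fin n) :
    (backNbrs G pos (pos z + 1) y).card ≤ (backNbrs G pos (pos z) y).card + 1 := by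
  refine (Finset.card_le_card (t := insert z (backNbrs G pos (pos z) y)) fun u hu => ?_).trans
    (Finset.card_insert_le _ _)
  rw [Finset.mem_insert, mem_backNbrs]
  rw [mem_backNbrs] at hu
  rcases Nat.lt_succ_iff_lt_or_eq.1 hu.2.1 with h | h
  · exact Or.inr ⟨hu.1, h, hu.2.2⟩
  · exact Or.inl (hinj h)

theorem backNbrs_succ_of_not_adj (hinj : Function.Injective pos) {z y : Fin n}
    (h : ¬ G.Adj z y) : backNbrs G pos (pos z + 1) y = backNbrs G pos (pos z) y := by
  ext u
  simp only [mem_backNbrs]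
  constructor
  · rintro ⟨h1, h2, h3⟩
    refine ⟨h1, ?_, h3⟩
    have : pos u ≠ pos z := fun h' => h (hinj h' ▸ h3)
    omega
  · rintro ⟨h1, h2, h3⟩
    exact ⟨h1, by omega, h3⟩

/-- The vertex x is counted only after its own position, so the labels of the edges into y grow
strictly along the order. -/
theorem backNbrs_ssubset (h : IsMaxAdjOrder G es pos ℓ) {x y : Fin n} {p : ℕ} (hxy : G.Adj x y)
    (hp : pos x < p) : (backNbrs G pos (pos x) y).card + 1 ≤ (backNbrs G pos p y).card := by
  refine Finset.card_lt_card ((Finset.ssubset_iff_of_subset (backNbrs_mono hp.le y)).2 ⟨x, ?_, ?_⟩)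
  · exact mem_backNbrs.2 ⟨h.ne_zero x, hp, hxy⟩
  · exact fun h' => (mem_backNbrs.1 h').2.1.false

open Classical in
/-- Vertices with many earlier neighbours cannot be separated by few vertices without removing an
edge of low label. -/
theorem IsMaxAdjOrder.same_side (h : IsMaxAdjOrder G es pos ℓ) (hes : IsEdgeList G es) {K : ℕ}
    {S : Finset (Fin n)} {P : Fin n → Prop}
    (hP : ∀ x y, x ∉ S → y ∉ S → (ofList (lowEdges es ℓ K)).Adj x y → (P x ↔ P y)) (p : ℕ) :
    ∀ (j : ℕ) (u u' : Fin n), j ≤ K → (S.filter fun v => pos v < p).card < j → u ∉ S → u' ∉ S →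
      p ≤ pos u → p ≤ pos u' → j ≤ (backNbrs G pos p u).card → j ≤ (backNbrs G pos p u').card →
      (P u ↔ P u') := by
  induction p with
  | zero =>
    -- No vertex has a neighbour before position 0, so j = 0, which is not larger than a number of
    -- vertices.
    intro j u u' _ hj _ _ _ _ hu
    have : backNbrs G pos 0 u = ∅ := by ext z; simp [mem_backNbrs]
    rw [this] at hu
    simp at hu hj
    omega
  | succ p ih =>
    intro j u u' hjK hj huS hu'S hpu hpu' hu hu'
    by_cases hz : ∃ z, pos z = p
    · obtain ⟨z, rfl⟩ := hz
      by_cases hzS : z ∈ S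
      -- If z is in S, stepping back over z removes one member of S and at most one neighbour of u
      -- and of u', so j - 1 takes the place of j.
      · have hS : (S.filter fun v => pos v < pos z).card + 1 ≤
            (S.filter fun v => pos v < pos z + 1).card := by
          refine Finset.card_lt_card ((Finset.ssubset_iff_of_subset ?_).2 ⟨z, ?_, ?_⟩)
          · intro v hv
            rw [Finset.mem_filter] at hv ⊢
            exact ⟨hv.1, by omega⟩
          · simpa using hzS
          · simp
        have h1 := card_backNbrs_succ_le (G := G) h.inj z u
        have h2 := card_backNbrs_succ_le (G := G) h.inj z u'
        exact ih (j - 1) u u' (by omega) (by omega) huS hu'S (by omega) (by omega) (by omega)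
          (by omega)
      · have hS : (S.filter fun v => pos v < pos z).card < j := by
          refine lt_of_le_of_lt (Finset.card_le_card fun v hv => ?_) hj
          rw [Finset.mem_filter] at hv ⊢
          exact ⟨hv.1, by omega⟩
        -- If z is not in S, both vertices are on the side of z. If v has j neighbours before z,
        -- then by maximality so has z, and induction applies to z and v. Otherwise z is the j-th
        -- earlier neighbour of v, and the edge between them has label j ≤ K and was kept.
        have key : ∀ v, v ∉ S → pos z + 1 ≤ pos v → j ≤ (backNbrs G pos (pos z + 1) v).card →
            (P z ↔ P v) := by
          intro v hvS hpv hv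
          rcases le_or_gt j (backNbrs G pos (pos z) v).card with h1 | h1
          · exact ih j z v hjK hS hzS hvS le_rfl (by omega) (h1.trans (h.max z v (by omega))) h1
          · have hadj : G.Adj z v := by
              by_contra hc
              rw [backNbrs_succ_of_not_adj h.inj hc] at hv
              omega
            refine hP z v hzS hvS ⟨hadj.ne, (hes.adj_iff.1 hadj).imp ?_ ?_⟩
            · intro he
              have := h.lab z v (by omega) _ he (Or.inl rfl)
              exact List.mem_filter.2 ⟨he, by simp; omega⟩
            · intro he
              have := h.lab z v (by omega) _ he (Or.inr rfl)
              exact List.mem_filter.2 ⟨he, by simp; omega⟩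
        exact (key u huS hpu hu).symm.trans (key u' hu'S hpu' hu')
    · have hz' : ∀ z, pos z ≠ p := fun z hzp => hz ⟨z, hzp⟩
      rw [backNbrs_succ_of_ne hz'] at hu hu'
      refine ih j u u' hjK (lt_of_le_of_lt (Finset.card_le_card fun v hv => ?_) hj) huS hu'S
        (by omega) (by omega) hu hu'
      rw [Finset.mem_filter] at hv ⊢
      exact ⟨hv.1, by omega⟩

/-- The edges of label at most `K` preserve all vertex cuts with fewer than `K` vertices. -/
theorem IsMaxAdjOrder.certificate (h : IsMaxAdjOrder G es pos ℓ) (hes : IsEdgeList G es) {K : ℕ}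
    {S : Finset (Fin n)} (hS : S.card < K) (hcut : IsVertexCut (ofList (lowEdges es ℓ K)) S) :
    IsVertexCut G S := by
  classical
  obtain ⟨A, B, hsp⟩ := hcut.exists_split
  have hA : ∀ {v}, v ∈ A → v ∉ S := fun hv => Finset.disjoint_left.1 hsp.disj_left hv
  have hB : ∀ {v}, v ∈ B → v ∉ S := fun hv => Finset.disjoint_left.1 hsp.disj_right hv
  have hP : ∀ x y, x ∉ S → y ∉ S → (ofList (lowEdges es ℓ K)).Adj x y → (x ∈ A ↔ y ∈ A) := by
    have key : ∀ x y, y ∉ S → (ofList (lowEdges es ℓ K)).Adj x y → x ∈ A → y ∈ A := by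
      intro x y hy hxy hx
      rcases hsp.cover y with h1 | h1 | h1
      · exact (hy h1).elim
      · exact h1
      · exact (hsp.not_adj x hx y h1 hxy).elim
    exact fun x y hx hy hxy => ⟨key x y hy hxy, key y x hx hxy.symm⟩
  -- No discarded edge joins the two sides: if its label exceeds K, then y has at least K neighbours
  -- before x, by maximality so has x, and `IsMaxAdjOrder.same_side` applies with j = K.
  have key : ∀ x y, x ∉ S → y ∉ S → pos x < pos y → G.Adj x y → (x ∈ A ↔ y ∈ A) := by
    intro x y hx hy hlt hadj
    by_cases hlow : (backNbrs G pos (pos x) y).card + 1 ≤ K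
    · refine hP x y hx hy ⟨hadj.ne, (hes.adj_iff.1 hadj).imp ?_ ?_⟩
      · intro he
        exact List.mem_filter.2 ⟨he, by simp [h.lab x y hlt _ he (Or.inl rfl), hlow]⟩
      · intro he
        exact List.mem_filter.2 ⟨he, by simp [h.lab x y hlt _ he (Or.inr rfl), hlow]⟩
    · exact h.same_side hes hP (pos x) K x y le_rfl
        ((Finset.card_le_card (Finset.filter_subset _ _)).trans_lt hS) hx hy le_rfl hlt.le
        (by have := h.max x y hlt.le; omega) (by omega)
  refine IsSplit.isVertexCut (A := A) (B := B) { hsp with not_adj := fun a ha b hb hab => ?_ }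
  have hbA : b ∉ A := fun h' => Finset.disjoint_left.1 hsp.disj h' hb
  rcases lt_trichotomy (pos a) (pos b) with hlt | heq | hlt
  · exact hbA ((key a b (hA ha) (hB hb) hlt hab).1 ha)
  · exact hab.ne (h.inj heq)
  · exact hbA ((key b a (hB hb) (hA ha) hlt hab.symm).2 ha)

/-- There are few edges of low label. -/
theorem IsMaxAdjOrder.length_lowEdges_le (h : IsMaxAdjOrder G es pos ℓ) (hes : IsEdgeList G es)
    (K : ℕ) : (lowEdges es ℓ K).length ≤ n * K := by
  classical
  let late : Fin n × Fin n → Fin n := fun e => if pos e.1 < pos e.2 then e.2 else e.1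
  have hlate : ∀ e ∈ es, ∃ x, pos x < pos (late e) ∧ G.Adj x (late e) ∧
      (e = (x, late e) ∨ e = (late e, x)) := by
    rintro ⟨a, b⟩ he
    have hadj : G.Adj a b := hes.adj_iff.2 (Or.inl he)
    by_cases hlt : pos a < pos b
    · exact ⟨a, by simp [late, hlt, hadj]⟩
    · have hne : pos a ≠ pos b := fun h' => hadj.ne (h.inj h')
      exact ⟨b, by simp [late, hlt, hadj.symm]; omega⟩
  -- Edges with the same later end have different labels, so the later end and the label determine
  -- the edge. With n ends and K labels the bound follows.
  have hinj : ∀ e ∈ es, ∀ e' ∈ es, late e = late e' → ℓ e = ℓ e' →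
      s(e.1, e.2) = s(e'.1, e'.2) := by
    intro e he e' he' h1 h2
    obtain ⟨x, hx, hadj, hex⟩ := hlate e he
    obtain ⟨x', hx', hadj', hex'⟩ := hlate e' he'
    rw [← h1] at hx' hadj' hex'
    have l1 := h.lab x _ hx e he hex
    have l2 := h.lab x' _ hx' e' he' hex'
    have hxx : x = x' := by
      rcases lt_trichotomy (pos x) (pos x') with hlt | heq | hlt
      · have := backNbrs_ssubset h hadj hlt
        omega
      · exact h.inj heq
      · have := backNbrs_ssubset h hadj' hlt
        omega
    rw [← hxx] at hex'
    have key : ∀ (f : Fin n × Fin n) (y : Fin n), f = (x, y) ∨ f = (y, x) →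
        s(f.1, f.2) = s(x, y) := by
      rintro f y (rfl | rfl)
      · rfl
      · exact Sym2.eq_swap
    rw [key e _ hex, key e' _ hex']
  have hpos : ∀ e ∈ es, 1 ≤ ℓ e := by
    intro e he
    obtain ⟨x, hx, -, hex⟩ := hlate e he
    have := h.lab x _ hx e he hex
    omega
  have hnodup : es.Nodup := hes.1.of_map _
  have hsub : ∀ e ∈ lowEdges es ℓ K, e ∈ es ∧ ℓ e ≤ K := by
    intro e he
    have := List.mem_filter.1 he
    exact ⟨this.1, by simpa using this.2⟩
  have hnodup' : (lowEdges es ℓ K).Nodup := hnodup.filter _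
  rw [← List.toFinset_card_of_nodup hnodup']
  have hcard : (Finset.univ ×ˢ Finset.Icc 1 K : Finset (Fin n × ℕ)).card = n * K := by
    simp
  rw [← hcard]
  refine Finset.card_le_card_of_injOn (fun e => (late e, ℓ e)) ?_ ?_
  · intro e he
    obtain ⟨h1, h2⟩ := hsub e (by simpa using he)
    simpa using ⟨hpos e h1, h2⟩
  · intro e he e' he' heq
    obtain ⟨h1, -⟩ := hsub e (by simpa using he)
    obtain ⟨h2, -⟩ := hsub e' (by simpa using he')
    simp only [Prod.mk.injEq] at heq
    exact List.inj_on_of_nodup_map hes.1 h1 h2 (hinj e h1 e' h2 heq.1 heq.2)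

/-- If v has no neighbour before it, then by maximality no vertex after v has a neighbour before v.
-/
theorem IsMaxAdjOrder.not_adj_of_root (h : IsMaxAdjOrder G es pos ℓ) {v x y : Fin n}
    (hv : backNbrs G pos (pos v) v = ∅) (hx : pos x < pos v) (hy : pos v ≤ pos y) :
    ¬ G.Adj x y := by
  intro hadj
  have h1 := h.max v y hy
  rw [hv, Finset.card_empty, Nat.le_zero, Finset.card_eq_zero] at h1
  have : x ∈ backNbrs G pos (pos v) y := mem_backNbrs.2 ⟨h.ne_zero x, hx, hadj⟩
  simp [h1] at this

/-- If two vertices have no earlier neighbour then the graph is disconnected. -/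
theorem IsMaxAdjOrder.isVertexCut_empty (h : IsMaxAdjOrder G es pos ℓ) {u v : Fin n} (huv : u ≠ v)
    (hu : backNbrs G pos (pos u) u = ∅) (hv : backNbrs G pos (pos v) v = ∅) :
    IsVertexCut G ∅ := by
  classical
  wlog hlt : pos u < pos v generalizing u v
  · have hne : pos u ≠ pos v := fun h' => huv (h.inj h')
    exact this huv.symm hv hu (by omega)
  refine IsSplit.isVertexCut (A := Finset.univ.filter fun x => pos x < pos v)
    (B := Finset.univ.filter fun x => pos v ≤ pos x) ⟨⟨u, by simpa using hlt⟩, ⟨v, by simp⟩, by simp,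
      by simp, ?_, fun x => ?_, fun x hx y hy => ?_⟩
  · rw [Finset.disjoint_left]
    intro x hx hx'
    simp only [Finset.mem_filter, Finset.mem_univ, true_and] at hx hx'
    omega
  · simpa using lt_or_ge _ _
  · exact h.not_adj_of_root hv (by simpa using hx) (by simpa using hy)

/-- If the graph is disconnected then two vertices have no earlier neighbour. -/
theorem exists_roots (pos : Fin n → ℕ) (hcut : IsVertexCut G ∅) :
    ∃ u v, u ≠ v ∧ backNbrs G pos (pos u) u = ∅ ∧ backNbrs G pos (pos v) v = ∅ := by
  obtain ⟨A, B, hsp⟩ := hcut.exists_split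
  have key : ∀ A B, IsSplit G A ∅ B → ∃ u ∈ A, backNbrs G pos (pos u) u = ∅ := by
    intro A B hsp
    -- The first vertex of a side has no earlier neighbour, as all its neighbours are on that side.
    obtain ⟨u, hu, hmin⟩ := A.exists_min_image pos hsp.left
    refine ⟨u, hu, Finset.eq_empty_of_forall_notMem fun z hz => ?_⟩
    obtain ⟨-, h1, h2⟩ := mem_backNbrs.1 hz
    rcases hsp.cover z with h3 | h3 | h3
    · simp at h3
    · exact absurd (hmin z h3) (by omega)
    · exact hsp.not_adj u hu z h3 h2.symm
  obtain ⟨u, hu, h1⟩ := key A B hsp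
  obtain ⟨v, hv, h2⟩ := key B A hsp.symm
  exact ⟨u, v, fun h => Finset.disjoint_left.1 hsp.disj hu (h ▸ hv), h1, h2⟩

end MaximumAdjacency

/-! ### The maximum adjacency scan -/

section Scanning

variable {n : ℕ} {G : SimpleGraph (Fin n)} {es : List (Fin n × Fin n)}

/-- The edges at `v`. -/
def incident (es : List (Fin n × Fin n)) (v : Fin n) : List (Fin n × Fin n) :=
  es.filter fun e => decide (e.1 = v ∨ e.2 = v)

theorem mem_incident {v : Fin n} {e : Fin n × Fin n} :
    e ∈ incident es v ↔ e ∈ es ∧ (e.1 = v ∨ e.2 = v) := by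
  simp [incident]

/-- `e` joins `x` and `y`. -/
def Joins (e : Fin n × Fin n) (x y : Fin n) : Prop := e = (x, y) ∨ e = (y, x)

theorem Joins.right_unique {e : Fin n × Fin n} {x y z : Fin n} (h : Joins e x y)
    (h' : Joins e x z) : y = z := by
  rcases h with rfl | rfl <;> rcases h' with h | h <;> simp only [Prod.mk.injEq] at h <;> grind

theorem Joins.adj {e : Fin n × Fin n} {x y : Fin n} (h : Joins e x y) (hes : IsEdgeList G es)
    (he : e ∈ es) : G.Adj x y := by
  rcases h with rfl | rfl
  · exact hes.adj_iff.2 (Or.inl he)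
  · exact hes.adj_iff.2 (Or.inr he)

theorem Joins.eq {e e' : Fin n × Fin n} {x y : Fin n} (h : Joins e x y) (h' : Joins e' x y)
    (hes : IsEdgeList G es) (he : e ∈ es) (he' : e' ∈ es) : e = e' := by
  refine List.inj_on_of_nodup_map hes.1 he he' ?_
  rcases h with rfl | rfl <;> rcases h' with rfl | rfl <;> simp [Sym2.eq_swap]

/-- The state of a scan: positions of the scanned vertices, numbers of scanned neighbours, edge
labels, buckets of vertices, the vertex that was scanned last and its remaining edges, and a bound
for the nonempty buckets. -/
structure Scan (n : ℕ) where
  pos : Fin n → ℕ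
  count : ℕ
  r : Fin n → ℕ
  lab : Fin n × Fin n → ℕ
  bkt : ℕ → List (Fin n)
  cur : Fin n
  rest : List (Fin n × Fin n)
  top : ℕ

/-- The edge between `y` and the current vertex has not been processed yet. -/
def Scan.Pend (A : Scan n) (y : Fin n) : Prop := ∃ e ∈ A.rest, Joins e A.cur y

/-- The invariants of the scan. -/
structure Scan.Inv (G : SimpleGraph (Fin n)) (es : List (Fin n × Fin n)) (A : Scan n) : Prop where
  pos_le : ∀ v, A.pos v ≤ A.count
  pos_inj : ∀ u v, A.pos u ≠ 0 → A.pos u = A.pos v → u = v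
  count_eq : A.count = (Finset.univ.filter fun v => A.pos v ≠ 0).card
  suffix : A.rest <:+ incident es A.cur
  cur_last : A.rest ≠ [] → A.pos A.cur = A.count ∧ A.pos A.cur ≠ 0
  r_pend : ∀ y, A.pos y = 0 → A.Pend y → A.r y + 1 = (backNbrs G A.pos (A.count + 1) y).card
  r_free : ∀ y, A.pos y = 0 → ¬ A.Pend y → A.r y = (backNbrs G A.pos (A.count + 1) y).card
  r_scanned : ∀ y, A.pos y ≠ 0 → A.r y = (backNbrs G A.pos (A.pos y) y).card
  lab_eq : ∀ x y, A.pos x ≠ 0 → A.pos y = 0 ∨ A.pos x < A.pos y → ∀ e ∈ es, Joins e x y →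
    ¬ (x = A.cur ∧ e ∈ A.rest) → A.lab e = (backNbrs G A.pos (A.pos x) y).card + 1
  max : ∀ x y, A.pos x ≠ 0 → A.pos y = 0 ∨ A.pos x ≤ A.pos y →
    (backNbrs G A.pos (A.pos x) y).card ≤ (backNbrs G A.pos (A.pos x) x).card
  mem_bkt : ∀ y, A.pos y = 0 → y ∈ A.bkt (A.r y)
  r_le_top : ∀ y, A.pos y = 0 → A.r y ≤ A.top
  bkt_le : ∀ b, ∀ v ∈ A.bkt b, b ≤ A.r v
  top_lt : A.top < n

namespace Scan.Inv

variable {A : Scan n}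

theorem mem_of_rest (h : A.Inv G es) {e : Fin n × Fin n} (he : e ∈ A.rest) :
    e ∈ es ∧ ∃ y, Joins e A.cur y := by
  obtain ⟨h1, h2⟩ := mem_incident.1 (h.suffix.mem he)
  refine ⟨h1, ?_⟩
  rcases h2 with h2 | h2
  · exact ⟨e.2, Or.inl (by rw [← h2])⟩
  · exact ⟨e.1, Or.inr (by rw [← h2])⟩

theorem rest_nodup (h : A.Inv G es) (hes : IsEdgeList G es) : A.rest.Nodup :=
  ((hes.1.of_map _).filter _ : (incident es A.cur).Nodup).sublist h.suffix.sublist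

theorem count_le (h : A.Inv G es) : A.count ≤ n := by
  rw [h.count_eq]
  exact (Finset.card_le_univ _).trans_eq (Fintype.card_fin n)

theorem r_lt (h : A.Inv G es) (y : Fin n) : A.r y < n := by
  by_cases hy : A.pos y = 0
  · by_cases hp : A.Pend y
    · have := h.r_pend y hy hp
      have := card_backNbrs_lt (G := G) (pos := A.pos) (A.count + 1) y
      omega
    · rw [h.r_free y hy hp]
      exact card_backNbrs_lt _ _
  · rw [h.r_scanned y hy]
    exact card_backNbrs_lt _ _

/-- Skip an edge to a scanned vertex. -/
theorem skip (h : A.Inv G es) {e : Fin n × Fin n} {rest : List (Fin n × Fin n)}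
    (hr : A.rest = e :: rest) {y : Fin n} (hy : Joins e A.cur y) (hpos : A.pos y ≠ 0) :
    ({ A with rest := rest } : Scan n).Inv G es := by
  have hpend : ∀ z, A.pos z = 0 → (A.Pend z ↔ ({ A with rest := rest } : Scan n).Pend z) := by
    intro z hz
    simp only [Scan.Pend, hr, List.mem_cons, exists_eq_or_imp]
    refine or_iff_right fun hz' => hpos ?_
    rw [hy.right_unique hz', hz]
  have hlast := h.cur_last (by rw [hr]; simp)
  exact
    { h with
      suffix := (List.suffix_cons e rest).trans (hr ▸ h.suffix)
      cur_last := fun _ => hlast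
      r_pend := fun z hz hp => h.r_pend z hz ((hpend z hz).2 hp)
      r_free := fun z hz hp => h.r_free z hz fun hp' => hp ((hpend z hz).1 hp')
      lab_eq := by
        rintro x z hx hz e' he' hj hn
        refine h.lab_eq x z hx hz e' he' hj fun ⟨h1, h2⟩ => ?_
        rw [hr, List.mem_cons] at h2
        rcases h2 with rfl | h2
        -- The skipped edge needs no new label: its other end y is scanned and does not come after
        -- the current vertex, which is the last one.
        · subst h1
          obtain rfl := hy.right_unique hj
          have := h.pos_le y
          have h1 := hlast.1
          dsimp only at *
          omega
        · exact hn ⟨h1, h2⟩ }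

/-- Process an edge to an unscanned vertex. -/
theorem process (h : A.Inv G es) (hes : IsEdgeList G es) {e : Fin n × Fin n}
    {rest : List (Fin n × Fin n)} (hr : A.rest = e :: rest) {y : Fin n} (hy : Joins e A.cur y)
    (hpos : A.pos y = 0) :
    ({ A with
        rest := rest
        r := Function.update A.r y (A.r y + 1)
        lab := Function.update A.lab e (A.r y + 1)
        bkt := Function.update A.bkt (A.r y + 1) (A.bkt (A.r y + 1) ++ [y])
        top := Max.max A.top (A.r y + 1) } : Scan n).Inv G es := by
  have hlast := h.cur_last (by rw [hr]; simp)
  have hnd := h.rest_nodup hes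
  rw [hr, List.nodup_cons] at hnd
  have hees : e ∈ es := (h.mem_of_rest (by rw [hr]; simp)).1
  have hrest : ∀ e' ∈ rest, e' ∈ es := fun e' he' => (h.mem_of_rest (by rw [hr]; simp [he'])).1
  have hpy : A.Pend y := ⟨e, by rw [hr]; simp, hy⟩
  have hry := h.r_pend y hpos hpy
  -- The graph is simple, so no other edge joins y to the current vertex.
  have hnp : ∀ e' ∈ rest, ¬ Joins e' A.cur y := by
    intro e' he' hj
    exact hnd.1 ((hy.eq hj hes hees (hrest e' he')).symm ▸ he')
  have hpend : ∀ z, z ≠ y → ((∃ e' ∈ rest, Joins e' A.cur z) ↔ A.Pend z) := by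
    intro z hz
    simp only [Scan.Pend, hr, List.mem_cons, exists_eq_or_imp]
    exact (or_iff_right fun hz' => hz (hy.right_unique hz').symm).symm
  -- The current vertex was scanned last, so it is the only neighbour of y that is scanned but not
  -- before it. Hence the old value of r counts the neighbours before the current vertex, and the
  -- label is that value plus one.
  have hback : backNbrs G A.pos (A.pos A.cur) y = (backNbrs G A.pos (A.count + 1) y).erase A.cur := by
    ext z
    rw [Finset.mem_erase, mem_backNbrs, mem_backNbrs, hlast.1]
    constructor
    · rintro ⟨h1, h2, h3⟩
      refine ⟨?_, h1, by omega, h3⟩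
      rintro rfl
      omega
    · rintro ⟨h1, h2, h3, h4⟩
      refine ⟨h2, ?_, h4⟩
      have : A.pos z ≠ A.pos A.cur := fun h' => h1 (h.pos_inj z A.cur h2 h')
      omega
  have hcur : A.cur ∈ backNbrs G A.pos (A.count + 1) y :=
    mem_backNbrs.2 ⟨hlast.2, by omega, hy.adj hes hees⟩
  refine
    { h with
      suffix := (List.suffix_cons e rest).trans (hr ▸ h.suffix)
      cur_last := fun _ => hlast
      r_pend := ?_, r_free := ?_, r_scanned := ?_, lab_eq := ?_, mem_bkt := ?_, r_le_top := ?_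
      bkt_le := ?_, top_lt := ?_ }
  · intro z hz hp
    have hzy : z ≠ y := by
      rintro rfl
      obtain ⟨e', he', hj⟩ := hp
      exact hnp e' he' hj
    dsimp only
    rw [Function.update_of_ne hzy]
    exact h.r_pend z hz ((hpend z hzy).1 hp)
  · intro z hz hp
    dsimp only
    by_cases hzy : z = y
    · subst hzy
      rw [Function.update_self]
      exact hry
    · rw [Function.update_of_ne hzy]
      exact h.r_free z hz fun hp' => hp ((hpend z hzy).2 hp')
  · intro z hz
    have hzy : z ≠ y := by rintro rfl; exact hz hpos
    dsimp only
    rw [Function.update_of_ne hzy]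
    exact h.r_scanned z hz
  · intro x z hx hz e' he' hj hn
    dsimp only at *
    by_cases hee : e' = e
    · subst hee
      have hxy : x = A.cur ∧ z = y := by
        rcases hj with hj | hj <;> rcases hy with hy | hy <;> rw [hj, Prod.mk.injEq] at hy
        · exact hy
        · obtain ⟨rfl, -⟩ := hy; exact (hx hpos).elim
        · obtain ⟨-, rfl⟩ := hy; exact (hx hpos).elim
        · exact ⟨hy.2, hy.1⟩
      obtain ⟨rfl, rfl⟩ := hxy
      rw [Function.update_self, hback, Finset.card_erase_of_mem hcur]
      have := Finset.card_pos.2 ⟨_, hcur⟩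
      omega
    · rw [Function.update_of_ne hee]
      refine h.lab_eq x z hx hz e' he' hj fun ⟨h1, h2⟩ => ?_
      rw [hr, List.mem_cons] at h2
      exact hn ⟨h1, h2.resolve_left hee⟩
  · intro z hz
    dsimp only at *
    by_cases hzy : z = y
    · subst hzy
      simp
    · rw [Function.update_of_ne hzy]
      have := h.mem_bkt z hz
      by_cases hb : A.r z = A.r y + 1
      · rw [hb] at this ⊢
        simp [this]
      · rwa [Function.update_of_ne hb]
  · intro z hz
    dsimp only at *
    by_cases hzy : z = y
    · subst hzy
      simp
    · rw [Function.update_of_ne hzy]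
      exact (h.r_le_top z hz).trans (le_max_left _ _)
  · intro b v hv
    dsimp only at *
    have hle : ∀ u, A.r u ≤ Function.update A.r y (A.r y + 1) u := by
      intro u
      by_cases hu : u = y
      · subst hu; simp
      · rw [Function.update_of_ne hu]
    by_cases hb : b = A.r y + 1
    · subst hb
      rw [Function.update_self, List.mem_append, List.mem_singleton] at hv
      rcases hv with hv | rfl
      · exact (h.bkt_le _ v hv).trans (hle v)
      · simp
    · rw [Function.update_of_ne hb] at hv
      exact (h.bkt_le _ v hv).trans (hle v)
  · have := card_backNbrs_lt (G := G) (pos := A.pos) (A.count + 1) y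
    have := h.top_lt
    dsimp only
    omega

/-- Discard a scanned vertex from a bucket. -/
theorem discard (h : A.Inv G es) {b : ℕ} {l : List (Fin n)} {y : Fin n} (hb : A.bkt b = l ++ [y])
    (hpos : A.pos y ≠ 0) :
    ({ A with bkt := Function.update A.bkt b l } : Scan n).Inv G es := by
  refine { h with mem_bkt := fun z hz => ?_, bkt_le := fun b' v hv => ?_ }
  · dsimp only at *
    have hm := h.mem_bkt z hz
    by_cases hzb : A.r z = b
    · rw [hzb, Function.update_self]
      rw [hzb, hb, List.mem_append, List.mem_singleton] at hm
      exact hm.resolve_right fun hzy => hpos (hzy ▸ hz)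
    · rwa [Function.update_of_ne hzb]
  · dsimp only at *
    by_cases hbb : b' = b
    · subst hbb
      rw [Function.update_self] at hv
      exact h.bkt_le b' v (by rw [hb]; simp [hv])
    · rw [Function.update_of_ne hbb] at hv
      exact h.bkt_le b' v hv

/-- Scan an unscanned vertex of the top bucket. -/
theorem scan (h : A.Inv G es) (hes : IsEdgeList G es) (hrest : A.rest = []) {l : List (Fin n)}
    {y : Fin n} (hb : A.bkt A.top = l ++ [y]) (hpos : A.pos y = 0) :
    ({ A with
        bkt := Function.update A.bkt A.top l
        pos := Function.update A.pos y (A.count + 1)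
        count := A.count + 1
        cur := y
        rest := incident es y } : Scan n).Inv G es := by
  set pos' := Function.update A.pos y (A.count + 1) with hpos'
  have e1 : pos' y = A.count + 1 := Function.update_self ..
  have e2 : ∀ z, z ≠ y → pos' z = A.pos z := fun z hz => Function.update_of_ne hz ..
  have hnp : ∀ z, ¬ A.Pend z := by
    rintro z ⟨e, he, -⟩
    simp [hrest] at he
  have hple := h.pos_le
  -- Giving y the next position leaves all neighbourhoods up to that position unchanged.
  have hold : ∀ p ≤ A.count + 1, ∀ z, backNbrs G pos' p z = backNbrs G A.pos p z := by
    intro p hp z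
    ext u
    simp only [mem_backNbrs]
    by_cases hu : u = y
    · subst hu
      rw [e1, hpos]
      constructor
      · rintro ⟨h1, h2, -⟩; omega
      · rintro ⟨h1, -⟩; exact (h1 rfl).elim
    · rw [e2 u hu]
  have hz0 : ∀ z, pos' z = 0 → z ≠ y ∧ A.pos z = 0 := by
    intro z hz
    have hzy : z ≠ y := by rintro rfl; omega
    exact ⟨hzy, by rwa [e2 z hzy] at hz⟩
  have hrz : ∀ z, A.pos z = 0 → A.r z = (backNbrs G A.pos (A.count + 1) z).card := fun z hz =>
    h.r_free z hz (hnp z)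
  -- Entries are not removed when r grows, so outdated copies may remain in lower buckets, but never
  -- above r. An unscanned vertex in the top bucket thus attains the maximum of r over all unscanned
  -- vertices, which makes the order a maximum adjacency order.
  have hry : A.r y = A.top :=
    le_antisymm (h.r_le_top y hpos) (h.bkt_le A.top y (by rw [hb]; simp))
  have hpend : ∀ z, (∃ e ∈ incident es y, Joins e y z) ↔ G.Adj y z := by
    intro z
    constructor
    · rintro ⟨e, he, hj⟩
      exact hj.adj hes (mem_incident.1 he).1
    · intro hadj
      rcases hes.adj_iff.1 hadj with he | he
      · exact ⟨_, mem_incident.2 ⟨he, Or.inl rfl⟩, Or.inl rfl⟩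
      · exact ⟨_, mem_incident.2 ⟨he, Or.inr rfl⟩, Or.inr rfl⟩
  have hnew : ∀ z, G.Adj y z →
      backNbrs G pos' (A.count + 1 + 1) z = insert y (backNbrs G A.pos (A.count + 1) z) := by
    intro z hz
    ext u
    rw [Finset.mem_insert, mem_backNbrs, mem_backNbrs]
    by_cases hu : u = y
    · subst hu
      simp [e1, hz]
    · rw [e2 u hu]
      have := hple u
      simp only [hu, false_or]
      constructor <;> rintro ⟨h1, -, h3⟩ <;> exact ⟨h1, by omega, h3⟩
  have hnew' : ∀ z, ¬ G.Adj y z →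
      backNbrs G pos' (A.count + 1 + 1) z = backNbrs G A.pos (A.count + 1) z := by
    intro z hz
    ext u
    rw [mem_backNbrs, mem_backNbrs]
    by_cases hu : u = y
    · subst hu
      simp [hz]
    · rw [e2 u hu]
      have := hple u
      constructor <;> rintro ⟨h1, -, h3⟩ <;> exact ⟨h1, by omega, h3⟩
  refine
    { pos_le := ?_, pos_inj := ?_, count_eq := ?_, suffix := List.suffix_rfl, cur_last := ?_
      r_pend := ?_, r_free := ?_, r_scanned := ?_, lab_eq := ?_, max := ?_, mem_bkt := ?_
      r_le_top := ?_, bkt_le := ?_, top_lt := h.top_lt }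
  · intro v
    dsimp only
    by_cases hv : v = y
    · rw [hv, e1]
    · rw [e2 v hv]
      exact (hple v).trans (Nat.le_succ _)
  · intro u v hu huv
    dsimp only at *
    by_cases hu' : u = y <;> by_cases hv' : v = y
    · rw [hu', hv']
    · rw [hu', e1, e2 v hv'] at huv
      have := hple v
      omega
    · rw [hv', e1, e2 u hu'] at huv
      have := hple u
      omega
    · rw [e2 u hu'] at hu huv
      rw [e2 v hv'] at huv
      exact h.pos_inj u v hu huv
  · have : (Finset.univ.filter fun v => pos' v ≠ 0) =
        insert y (Finset.univ.filter fun v => A.pos v ≠ 0) := by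
      ext v
      simp only [Finset.mem_filter, Finset.mem_univ, true_and, Finset.mem_insert]
      by_cases hv : v = y
      · simp [hv, e1]
      · simp [hv, e2 v hv]
    dsimp only
    rw [this, Finset.card_insert_of_notMem (by simp [hpos]), ← h.count_eq]
  · intro _
    dsimp only
    rw [e1]
    exact ⟨rfl, by omega⟩
  · intro z hz hp
    obtain ⟨hzy, hz'⟩ := hz0 z hz
    have hadj := (hpend z).1 hp
    dsimp only
    rw [hnew z hadj, Finset.card_insert_of_notMem, hrz z hz']
    simp [mem_backNbrs, hpos]
  · intro z hz hp
    obtain ⟨hzy, hz'⟩ := hz0 z hz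
    have hadj : ¬ G.Adj y z := fun h' => hp ((hpend z).2 h')
    dsimp only
    rw [hnew' z hadj, hrz z hz']
  · intro z hz
    dsimp only at *
    by_cases hzy : z = y
    · rw [hzy, e1, hold _ le_rfl]
      exact hrz y hpos
    · rw [e2 z hzy] at hz ⊢
      rw [hold _ ((hple z).trans (Nat.le_succ _))]
      exact h.r_scanned z hz
  · intro x z hx hz e he hj hn
    dsimp only at *
    by_cases hxy : x = y
    · subst hxy
      refine (hn ⟨rfl, mem_incident.2 ⟨he, ?_⟩⟩).elim
      rcases hj with rfl | rfl
      · exact Or.inl rfl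
      · exact Or.inr rfl
    · rw [e2 x hxy] at hx hz ⊢
      rw [hold _ ((hple x).trans (Nat.le_succ _))]
      refine h.lab_eq x z hx ?_ e he hj (by simp [hrest])
      by_cases hzy : z = y
      · exact Or.inl (hzy ▸ hpos)
      · rwa [e2 z hzy] at hz
  · intro x z hx hz
    dsimp only at *
    by_cases hxy : x = y
    · rw [hxy, e1] at hz ⊢
      rw [hold _ le_rfl, hold _ le_rfl]
      have hz' : z = y ∨ A.pos z = 0 := by
        by_cases hzy : z = y
        · exact Or.inl hzy
        · rw [e2 z hzy] at hz
          have := hple z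
          exact Or.inr (by omega)
      rcases hz' with rfl | hz'
      · exact le_rfl
      · rw [← hrz y hpos, ← hrz z hz', hry]
        exact h.r_le_top z hz'
    · rw [e2 x hxy] at hx hz ⊢
      have hx' := (hple x).trans (Nat.le_succ A.count)
      rw [hold _ hx', hold _ hx']
      refine h.max x z hx ?_
      by_cases hzy : z = y
      · exact Or.inl (hzy ▸ hpos)
      · rwa [e2 z hzy] at hz
  · intro z hz
    obtain ⟨hzy, hz'⟩ := hz0 z hz
    dsimp only
    have hm := h.mem_bkt z hz'
    by_cases hzb : A.r z = A.top
    · rw [hzb, Function.update_self]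
      rw [hzb, hb, List.mem_append, List.mem_singleton] at hm
      exact hm.resolve_right hzy
    · rwa [Function.update_of_ne hzb]
  · intro z hz
    exact h.r_le_top z (hz0 z hz).2
  · intro b v hv
    dsimp only at *
    by_cases hbb : b = A.top
    · subst hbb
      rw [Function.update_self] at hv
      exact h.bkt_le _ v (by rw [hb]; simp [hv])
    · rw [Function.update_of_ne hbb] at hv
      exact h.bkt_le b v hv

/-- Go on to the next bucket. -/
theorem lower (h : A.Inv G es) (hb : A.bkt A.top = []) :
    ({ A with top := A.top - 1 } : Scan n).Inv G es := by
  refine { h with r_le_top := fun y hy => ?_, top_lt := ?_ }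
  · have h1 := h.r_le_top y hy
    have h2 : A.r y ≠ A.top := fun h' => by
      have := h.mem_bkt y hy
      rw [h', hb] at this
      simp at this
    dsimp only
    omega
  · have := h.top_lt
    dsimp only
    omega

/-- At the end all vertices have been scanned. -/
theorem pos_ne_zero (h : A.Inv G es) (hb : A.bkt A.top = []) (htop : A.top = 0) (v : Fin n) :
    A.pos v ≠ 0 := by
  intro hv
  have h1 := h.r_le_top v hv
  have h2 := h.mem_bkt v hv
  rw [show A.r v = A.top by omega, hb] at h2
  simp at h2

theorem isMaxAdjOrder (h : A.Inv G es) (hrest : A.rest = []) (hpos : ∀ v, A.pos v ≠ 0) :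
    IsMaxAdjOrder G es A.pos A.lab where
  ne_zero := hpos
  inj u v huv := h.pos_inj u v (hpos u) huv
  max x y hxy := h.max x y (hpos x) (Or.inr hxy)
  lab x y hxy e he hj := h.lab_eq x y (hpos x) (Or.inr hxy) e he hj (by simp [hrest])

end Scan.Inv

/-- The scan before its first step. -/
def Scan.start (hn : 0 < n) : Scan n where
  pos _ := 0
  count := 0
  r _ := 0
  lab _ := 0
  bkt b := if b = 0 then List.finRange n else []
  cur := ⟨0, hn⟩
  rest := []
  top := 0

theorem Scan.start_inv (hn : 0 < n) : (Scan.start hn).Inv G es := by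
  have hback : ∀ p y, backNbrs G (fun _ : Fin n => 0) p y = ∅ := by
    intro p y
    ext z
    simp [mem_backNbrs]
  refine ⟨fun _ => le_rfl, ?_, ?_, List.nil_suffix, ?_, ?_, ?_, ?_, ?_, ?_, ?_, ?_, ?_, hn⟩ <;>
    simp [Scan.start, Scan.Pend, hback]

end Scanning

/-! ### Families of stacks in arrays -/

section Stacks

/-- The arrays `sz` and `dat` hold the sizes and the members of `n` stacks; member `i` of stack `b`
is in cell `i * n + b`, where `R` relates stored numbers to members. -/
def Stacks {α : Type*} (R : ℕ → α → Prop) (n : ℕ) (sz dat : ℕ → ℕ) (f : ℕ → List α) : Prop :=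
  ∀ b < n, sz b = (f b).length ∧ ∀ i (h : i < (f b).length), R (dat (i * n + b)) (f b)[i]

/-- Division by n recovers i, so the interleaved stacks never share a cell and need no size limits.
-/
theorem stride_inj {n i j b c : ℕ} (hb : b < n) (hc : c < n) (h : i * n + b = j * n + c) :
    i = j ∧ b = c := by
  have hn : 0 < n := by omega
  have h1 : (i * n + b) / n = i := by
    rw [mul_comm, Nat.mul_add_div hn, Nat.div_eq_of_lt hb, add_zero]
  have h2 : (j * n + c) / n = j := by
    rw [mul_comm, Nat.mul_add_div hn, Nat.div_eq_of_lt hc, add_zero]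
  have h3 : i = j := by rw [← h1, ← h2, h]
  subst h3
  exact ⟨rfl, by omega⟩

theorem Stacks.push {α : Type*} {R : ℕ → α → Prop} {n : ℕ} {sz dat sz' dat' : ℕ → ℕ}
    {f : ℕ → List α} (h : Stacks R n sz dat f) {b x : ℕ} {a : α} (hb : b < n) (hR : R x a)
    (hsz : ∀ c, sz' c = if c = b then sz b + 1 else sz c)
    (hdat : ∀ i, dat' i = if i = sz b * n + b then x else dat i) :
    Stacks R n sz' dat' (Function.update f b (f b ++ [a])) := by
  obtain ⟨hl, hd⟩ := h b hb
  intro c hc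
  by_cases hcb : c = b
  · subst hcb
    rw [Function.update_self, hsz, if_pos rfl]
    refine ⟨by simp [hl], fun i hi => ?_⟩
    rw [hdat]
    rw [List.length_append, List.length_singleton] at hi
    rcases (Nat.lt_succ_iff_lt_or_eq.1 hi) with h1 | h1
    · rw [if_neg, List.getElem_append_left h1]
      · exact hd i h1
      · intro h2
        have := (stride_inj hc hc h2).1
        omega
    · subst h1
      rw [if_pos (by rw [hl])]
      simpa using hR
  · obtain ⟨hl', hd'⟩ := h c hc
    rw [Function.update_of_ne hcb, hsz, if_neg hcb]
    refine ⟨hl', fun i hi => ?_⟩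
    rw [hdat, if_neg]
    · exact hd' i hi
    · intro h2
      exact hcb (stride_inj hc hb h2).2

theorem Stacks.pop {α : Type*} {R : ℕ → α → Prop} {n : ℕ} {sz dat sz' : ℕ → ℕ}
    {f : ℕ → List α} (h : Stacks R n sz dat f) {b : ℕ} {l : List α} {a : α} (hb : b < n)
    (hf : f b = l ++ [a]) (hsz : ∀ c, sz' c = if c = b then sz b - 1 else sz c) :
    Stacks R n sz' dat (Function.update f b l) ∧ R (dat ((sz b - 1) * n + b)) a := by
  obtain ⟨hl, hd⟩ := h b hb
  have hl' : sz b = l.length + 1 := by rw [hl, hf]; simp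
  constructor
  · intro c hc
    by_cases hcb : c = b
    · subst hcb
      rw [Function.update_self, hsz, if_pos rfl]
      refine ⟨by omega, fun i hi => ?_⟩
      have := hd i (by rw [hf, List.length_append]; omega)
      simp only [hf] at this
      rwa [List.getElem_append_left hi] at this
    · rw [Function.update_of_ne hcb, hsz, if_neg hcb]
      exact h c hc
  · have := hd l.length (by rw [hf]; simp)
    simp only [hf, List.getElem_concat_length] at this
    rwa [hl', Nat.add_sub_cancel]

/-- For the potential of the scan; the additive form avoids truncated subtraction. -/
theorem sum_length_update {α : Type*} (f : ℕ → List α) {n b : ℕ} (hb : b < n) (l : List α) :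
    ∑ c ∈ Finset.range n, (Function.update f b l c).length + (f b).length =
      ∑ c ∈ Finset.range n, (f c).length + l.length := by
  have hb' := Finset.mem_range.2 hb
  rw [← Finset.add_sum_erase _ _ hb', ← Finset.add_sum_erase (Finset.range n) (fun c => (f c).length)
    hb', Function.update_self]
  have : ∑ c ∈ (Finset.range n).erase b, (Function.update f b l c).length =
      ∑ c ∈ (Finset.range n).erase b, (f c).length :=
    Finset.sum_congr rfl fun c hc => by rw [Function.update_of_ne (Finset.ne_of_mem_erase hc)]
  omega

theorem length_le_sum {α : Type*} (f : ℕ → List α) {n b : ℕ} (hb : b < n) :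
    (f b).length ≤ ∑ c ∈ Finset.range n, (f c).length :=
  Finset.single_le_sum (f := fun c => (f c).length) (fun _ _ => Nat.zero_le _)
    (Finset.mem_range.2 hb)

/-- Push `x` onto stack `b`. -/
def pushProg (sz dat : ℕ) (b x : Term) : Program :=
  .seq (.store dat (.add (.mul (.cell sz b) (.reg 0)) b) x)
    (.store sz b (.add (.cell sz b) (.const 1)))

/-- The address b is evaluated again after the first store, which is why it must not depend on
`dat`. -/
theorem pushProg_eff {sz dat : ℕ} {b x : Term} {s : State} (hne : sz ≠ dat)
    (hb : ∀ i v, b.val (s.setCell dat i v) = b.val s) :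
    (pushProg sz dat b x).eff s =
      (s.setCell dat (s.arr sz (b.val s) * s.reg 0 + b.val s) (x.val s)).setCell sz (b.val s)
        (s.arr sz (b.val s) + 1) := by
  simp [pushProg, Program.eff, Term.val, hb, hne]

theorem pushProg_ok {Λ sz dat : ℕ} {b x : Term} {s : State} (hne : sz ≠ dat)
    (hb : ∀ i v, b.val (s.setCell dat i v) = b.val s) (hx : x.val s < 2 ^ Λ)
    (hsz : s.arr sz (b.val s) + 1 < 2 ^ Λ) : (pushProg sz dat b x).Ok Λ s := by
  simp [pushProg, Program.Ok, Program.eff, Term.val, hb, hne, hx, hsz]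

theorem Stacks.push_eff {α : Type*} {R : ℕ → α → Prop} {n sz dat : ℕ} {f : ℕ → List α} {b x : Term}
    {s : State} {a : α} (h : Stacks R n (s.arr sz) (s.arr dat) f) (hne : sz ≠ dat)
    (hb : ∀ i v, b.val (s.setCell dat i v) = b.val s) (h0 : s.reg 0 = n) (hbn : b.val s < n)
    (hR : R (x.val s) a) :
    Stacks R n (((pushProg sz dat b x).eff s).arr sz) (((pushProg sz dat b x).eff s).arr dat)
      (Function.update f (b.val s) (f (b.val s) ++ [a])) := by
  rw [pushProg_eff hne hb]
  refine h.push hbn hR (fun c => ?_) (fun i => ?_)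
  · simp [hne]
  · simp [hne.symm, h0]

end Stacks

/-! ### Building the adjacency lists -/

section Build

variable {n : ℕ} {G : SimpleGraph (Fin n)} {w : Fin n → ℕ} {es : List (Fin n × Fin n)}
  {ℓ : Fin n × Fin n → ℕ}

/-- The edges at the vertex with number `v`. -/
def edgesAt (es : List (Fin n × Fin n)) (v : ℕ) : List (Fin n × Fin n) :=
  es.filter fun e => decide (e.1.val = v ∨ e.2.val = v)

theorem edgesAt_val (es : List (Fin n × Fin n)) (v : Fin n) : edgesAt es v = incident es v := by
  simp [edgesAt, incident, Fin.ext_iff]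

/-- The number `k` refers to the edge `e`. -/
def EdgeNo (es : List (Fin n × Fin n)) (k : ℕ) (e : Fin n × Fin n) : Prop := es[k]? = some e

/-- The adjacency lists of the edges `es`, with edge numbers from `es'`, are stored. -/
def AdjStored (s : State) (es' es : List (Fin n × Fin n)) : Prop :=
  Stacks (EdgeNo es') n (s.arr 11) (s.arr 12) (edgesAt es)

/-- Add the edge `reg 27` to two adjacency lists. -/
def linkBody : Program :=
  .seq (pushProg 11 12 (.cell 0 (.reg 27)) (.reg 27)) (pushProg 11 12 (.cell 1 (.reg 27)) (.reg 27))

theorem edgesAt_take_succ {k : ℕ} (hk : k < es.length) (hne : es[k].1 ≠ es[k].2) :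
    edgesAt (es.take (k + 1)) =
      Function.update (Function.update (edgesAt (es.take k)) es[k].1
        (edgesAt (es.take k) es[k].1 ++ [es[k]])) es[k].2
          (Function.update (edgesAt (es.take k)) es[k].1
            (edgesAt (es.take k) es[k].1 ++ [es[k]]) es[k].2 ++ [es[k]]) := by
  have hne' : (es[k].2 : ℕ) ≠ es[k].1 := fun h => hne (Fin.ext h.symm)
  have htake : es.take (k + 1) = es.take k ++ [es[k]] := by
    rw [List.take_add_one, List.getElem?_eq_getElem hk, Option.toList_some]
  funext v
  have h1 : edgesAt (es.take (k + 1)) v =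
      edgesAt (es.take k) v ++ if es[k].1.val = v ∨ es[k].2.val = v then [es[k]] else [] := by
    rw [htake]
    unfold edgesAt
    rw [List.filter_append]
    congr 1
    split_ifs with h <;> simp [h]
  rw [h1, Function.update_of_ne hne']
  by_cases hv2 : v = es[k].2
  · subst hv2
    rw [Function.update_self, if_pos (Or.inr rfl)]
  · rw [Function.update_of_ne hv2]
    by_cases hv1 : v = es[k].1
    · subst hv1
      rw [Function.update_self, if_pos (Or.inl rfl)]
    · rw [Function.update_of_ne hv1, if_neg, List.append_nil]
      rintro (h | h)
      · exact hv1 h.symm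
      · exact hv2 h.symm

theorem hoare_linkLoop {Λ : ℕ} (hΛ : 1 ≤ Λ) {s : State} (hB : Bdd Λ s) (hs : Loaded s w es ℓ)
    (hes : IsEdgeList G es) (h11 : ∀ v, s.arr 11 v = 0) (hm : es.length + 1 < 2 ^ Λ) :
    Hoare T O (forLoop 27 1 linkBody) s ((es.length + 1) * (100 * Λ))
      (fun s' => Bdd Λ s' ∧ SameOff [27] [11, 12] s s' ∧ AdjStored s' es es) 1 := by
  refine (Hoare.forLoop_one hΛ (t := linkBody.cw * Λ) (N := es.length)
    (fun k s' => AdjStored s' es (es.take k)) hB hs.reg_m (by decide) (by decide) (by decide) ?_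
      ?_).mono (loop_time_le (by decide)) ?_ le_rfl
  · intro b hb
    simp [edgesAt, h11]
  · intro k hk s' hks hBs hF hI
    have e0 : s'.arr 0 k = (es[k].1 : ℕ) := by rw [hF.2 0 (by decide)]; exact hs.src k hk
    have e1 : s'.arr 1 k = (es[k].2 : ℕ) := by rw [hF.2 1 (by decide)]; exact hs.dst k hk
    have er : s'.reg 0 = n := (hF.1 0 (by decide)).trans hs.reg_n
    have hb0 : ∀ i v, (Term.cell 0 (.reg 27)).val (s'.setCell 12 i v) =
        (Term.cell 0 (.reg 27)).val s' := fun i v => by simp [Term.val]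
    have v0 : (Term.cell 0 (.reg 27)).val s' = es[k].1 := by simp [Term.val, hks, e0]
    have hno : EdgeNo es k es[k] := List.getElem?_eq_getElem hk
    have hlen : ∀ (v : ℕ) (l : List (Fin n × Fin n)), (edgesAt l v).length ≤ l.length :=
      fun v l => List.length_filter_le _ _
    have hsz1 := (hI es[k].1 es[k].1.2).1
    have hP1 := Stacks.push_eff (x := .reg 27) (a := es[k]) hI (by decide) hb0 er
      (by rw [v0]; exact es[k].1.2) (by simpa [Term.val, hks] using hno)
    rw [v0] at hP1
    set s1 := (pushProg 11 12 (.cell 0 (.reg 27)) (.reg 27)).eff s' with hs1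
    have hs1' := pushProg_eff (sz := 11) (x := .reg 27) (s := s') (by decide) hb0
    rw [← hs1] at hs1'
    have r27 : s1.reg 27 = k := by rw [hs1']; simpa using hks
    have hb1 : ∀ i v, (Term.cell 1 (.reg 27)).val (s1.setCell 12 i v) =
        (Term.cell 1 (.reg 27)).val s1 := fun i v => by simp [Term.val]
    have v1 : (Term.cell 1 (.reg 27)).val s1 = es[k].2 := by
      rw [Term.val, Term.val, r27, hs1']
      simp [e1]
    have hne : es[k].1 ≠ es[k].2 := hes.ne (List.getElem_mem hk)
    have hne' : (es[k].2 : ℕ) ≠ es[k].1 := fun h => hne (Fin.ext h.symm)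
    have hsz2 := (hP1 es[k].2 es[k].2.2).1
    rw [Function.update_of_ne hne'] at hsz2
    have l1 := hlen es[k].1 (es.take k)
    have l2 := hlen es[k].2 (es.take k)
    rw [List.length_take] at l1 l2
    have hP2 := Stacks.push_eff (x := .reg 27) (a := es[k]) hP1 (by decide) hb1
      (by rw [hs1']; exact er) (by rw [v1]; exact es[k].2.2) (by simpa [Term.val, r27] using hno)
    rw [v1, ← edgesAt_take_succ hk hne] at hP2
    refine Hoare.straight hΛ hBs ⟨pushProg_ok (by decide) hb0 ?_ ?_, pushProg_ok (by decide) hb1 ?_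
      ?_⟩ fun hB' => ⟨hB', hP2⟩
    · exact hBs.1 27
    · rw [v0, hsz1]; omega
    · change s1.reg 27 < _
      rw [r27]; omega
    · change s1.arr 11 ((Term.cell 1 (.reg 27)).val s1) + 1 < _
      rw [v1, hsz2]; omega
  · rintro s' ⟨h1, h2, h3⟩
    rw [List.take_length] at h3
    exact ⟨h1, h2.mono (by decide) (by decide), h3⟩

/-- The stored numbers refer to vertices. -/
def VertexNo (k : ℕ) (v : Fin n) : Prop := k = v

/-- Put all vertices in bucket `0`. -/
def fillProg : Program :=
  .seq (forLoop 27 0 (.store 14 (.mul (.reg 27) (.reg 0)) (.reg 27))) (.store 13 (.const 0) (.reg 0))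

theorem hoare_fillProg {Λ : ℕ} (hΛ : 1 ≤ Λ) {s : State} (hB : Bdd Λ s) (h0 : s.reg 0 = n)
    (h13 : ∀ v, s.arr 13 v = 0) :
    Hoare T O fillProg s ((n + 1) * (100 * Λ) + 10 * Λ)
      (fun s' => Bdd Λ s' ∧ SameOff [27] [13, 14] s s' ∧
        Stacks (VertexNo (n := n)) n (s'.arr 13) (s'.arr 14)
          fun b => if b = 0 then List.finRange n else []) 1 := by
  refine ((Hoare.forLoop_one hΛ
    (t := (Program.store 14 (.mul (.reg 27) (.reg 0)) (.reg 27)).cw * Λ) (N := n)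
    (fun k s' => ∀ i < k, s'.arr 14 (i * n) = i) hB h0 (by decide) (by decide) (by decide) ?_
      ?_).mono (loop_time_le (by decide)) (fun _ h => h) le_rfl).seq_one ?_
  · simp
  · intro k hk s' hks hBs hF hI
    have er : s'.reg 0 = n := (hF.1 0 (by decide)).trans h0
    refine Hoare.straight hΛ hBs ?_ fun hB' => ⟨hB', fun i hi => ?_⟩
    · simpa [Program.Ok, Term.val] using hBs.1 27
    · have hn : 0 < n := by omega
      rcases Nat.lt_succ_iff_lt_or_eq.1 hi with h1 | rfl
      · have : i * n ≠ k * n := fun h => by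
          have := Nat.eq_of_mul_eq_mul_right hn h
          omega
        simp [Program.eff, Term.val, hks, er, this, hI i h1]
      · simp [Program.eff, Term.val, hks, er]
  · rintro s1 ⟨hB1, hF1, hI⟩
    have er : s1.reg 0 = n := (hF1.1 0 (by decide)).trans h0
    refine (Hoare.straight hΛ hB1 (P := .store 13 (.const 0) (.reg 0)) ?_ fun hB' =>
      ⟨hB', ?_, ?_⟩).mono (Nat.mul_le_mul_right Λ (by decide)) (fun _ h => h) le_rfl
    · exact hB1.1 0
    · refine (hF1.mono (R' := [27]) (A' := [13, 14]) (by decide) (by decide)).trans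
        ⟨fun x _ => rfl, fun a ha => ?_⟩
      simp only [List.mem_cons, not_or] at ha
      funext i
      simp [Program.eff, ha.1]
    · intro b hb
      by_cases hb0 : b = 0
      · subst hb0
        refine ⟨by simp [Program.eff, Term.val, er], fun i hi => ?_⟩
        simp only [if_true, List.length_finRange] at hi
        simp [Program.eff, VertexNo, Term.val, hI i hi]
      · have : s1.arr 13 b = 0 := by rw [hF1.2 13 (by decide)]; exact h13 b
        simp [Program.eff, Term.val, hb0, this]

end Build

/-! ### The scanning program -/

section ScanProgram

variable {n : ℕ} {G : SimpleGraph (Fin n)} {w : Fin n → ℕ} {es : List (Fin n × Fin n)}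
  {A : Scan n} {s : State}

/-- The state `s` represents the scan `A`. -/
structure Rep (s : State) (w : Fin n → ℕ) (es : List (Fin n × Fin n)) (A : Scan n) : Prop where
  loaded : Loaded s w es A.lab
  adj : AdjStored s es es
  bkt : Stacks VertexNo n (s.arr 13) (s.arr 14) A.bkt
  pos : ∀ v : Fin n, s.arr 15 v = A.pos v
  r : ∀ v : Fin n, s.arr 16 v = A.r v
  cur : s.reg 20 = A.cur
  rest : A.rest = (incident es A.cur).drop (s.reg 21)
  top : s.reg 22 = A.top
  count : s.reg 26 = A.count

/-- A bound for the number of remaining steps. -/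
def Scan.pot (es : List (Fin n × Fin n)) (A : Scan n) : ℕ :=
  3 * (∑ v ∈ Finset.univ.filter (fun v => A.pos v = 0), (incident es v).length + A.rest.length) +
    ∑ b ∈ Finset.range n, (A.bkt b).length + A.top

theorem AdjStored.length (h : AdjStored s es es) (v : Fin n) :
    s.arr 11 v = (incident es v).length := by
  rw [← edgesAt_val]
  exact (h v v.2).1

theorem AdjStored.get (h : AdjStored s es es) (v : Fin n) {i : ℕ} (hi : i < (incident es v).length) :
    ∃ hk : s.arr 12 (i * n + v) < es.length, es[s.arr 12 (i * n + v)] = (incident es v)[i] := by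
  rw [← edgesAt_val] at hi
  have h1 := (h v v.2).2 i hi
  simp only [edgesAt_val] at h1
  exact List.getElem?_eq_some_iff.1 h1

theorem AdjStored.congr {s' : State} (h : AdjStored s es es) (h1 : s'.arr 11 = s.arr 11)
    (h2 : s'.arr 12 = s.arr 12) : AdjStored s' es es := by
  unfold AdjStored
  rw [h1, h2]
  exact h

/-- Load the next edge of the current vertex and its other end. -/
def fetchProg : Program :=
  .seq (.assign 24 (.cell 12 (.add (.mul (.reg 21) (.reg 0)) (.reg 20))))
    (.seq (.assign 21 (.add (.reg 21) (.const 1)))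
      (.assign 25 (.sub (.add (.cell 0 (.reg 24)) (.cell 1 (.reg 24))) (.reg 20))))

/-- Process the edge `reg 24` to the unscanned vertex `reg 25`. -/
def visitProg : Program :=
  .seq (.assign 28 (.add (.cell 16 (.reg 25)) (.const 1)))
    (.seq (.store 16 (.reg 25) (.reg 28))
      (.seq (.store 10 (.reg 24) (.reg 28))
        (.seq (pushProg 13 14 (.reg 28) (.reg 25))
          (.assign 22 (.add (.reg 22) (.sub (.reg 28) (.reg 22)))))))

/-- Process an edge. -/
def edgeProg : Program := .seq fetchProg (.branch (.cell 15 (.reg 25)) .skip visitProg)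

/-- Consuming an edge frees 3 units of potential. If its other end is unscanned, one new bucket
entry and a growth of the top by at most one, since r ≤ top before, cost at most 2 units. -/
theorem edgeProg_spec {Λ : ℕ} (hes : IsEdgeList G es) (hR : Rep s w es A) (hI : A.Inv G es)
    (hB : Bdd Λ s) (hpot : A.pot es + 1 < 2 ^ Λ) (hne : A.rest ≠ []) :
    edgeProg.Ok Λ s ∧ ∃ A' : Scan n, Rep (edgeProg.eff s) w es A' ∧ A'.Inv G es ∧
      A'.pot es < A.pot es ∧ (edgeProg.eff s).reg 23 = s.reg 23 := by
  have hi : s.reg 21 < (incident es A.cur).length := by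
    by_contra hc
    exact hne (by rw [hR.rest, List.drop_eq_nil_of_le (not_lt.1 hc)])
  set e := (incident es A.cur)[s.reg 21] with he
  have hrest : A.rest = e :: (incident es A.cur).drop (s.reg 21 + 1) := by
    rw [hR.rest, List.drop_eq_getElem_cons hi]
  obtain ⟨hk, hke⟩ := hR.adj.get A.cur hi
  set k := s.arr 12 (s.reg 21 * n + A.cur) with hkdef
  rw [← he] at hke
  obtain ⟨hees, y, hy⟩ := hI.mem_of_rest (show e ∈ A.rest by rw [hrest]; simp)
  -- The other end is the sum of both ends minus the current vertex, whatever the orientation of the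
  -- edge.
  have hyval : (e.1 : ℕ) + e.2 - A.cur = y := by
    rcases hy with h | h <;> rw [h] <;> simp
  have hm := hB.1 1
  rw [hR.loaded.reg_m] at hm
  have hn := hB.1 0
  rw [hR.loaded.reg_n] at hn
  have hinc : (incident es A.cur).length ≤ es.length := List.length_filter_le _ _
  set s1 := ((s.setReg 24 k).setReg 21 (s.reg 21 + 1)).setReg 25 y with hs1
  have hsum : s.arr 0 k + s.arr 1 k - A.cur = y := by
    rw [hR.loaded.src k hk, hR.loaded.dst k hk, hke, hyval]
  have hfetch : fetchProg.eff s = s1 := by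
    simp [fetchProg, Program.eff, Term.val, hR.loaded.reg_n, hR.cur, ← hkdef, hsum, hs1]
  have hfetch_ok : fetchProg.Ok Λ s := by
    simp [fetchProg, Program.Ok, Program.eff, Term.val, hR.loaded.reg_n, hR.cur, ← hkdef, hsum]
    omega
  have hval : (Term.cell 15 (.reg 25)).val s1 = A.pos y := by
    simp [Term.val, hs1, hR.pos]
  have heff : edgeProg.eff s = (Program.branch (.cell 15 (.reg 25)) .skip visitProg).eff s1 := by
    rw [← hfetch]; rfl
  have hok : (Program.branch (.cell 15 (.reg 25)) .skip visitProg).Ok Λ s1 → edgeProg.Ok Λ s :=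
    fun h => ⟨hfetch_ok, by rw [hfetch]; exact h⟩
  by_cases hpos : A.pos y = 0
  · rw [heff, Program.eff_branch_neg (hval.trans hpos)]
    have hA' := hI.process hes hrest hy hpos
    set A' : Scan n := _ with hA'def
    change A'.Inv G es at hA'
    have hq : A.r y + 1 < n := by
      have := hA'.r_lt y
      simpa [hA'def] using this
    have htop := hI.r_le_top y hpos
    have htl := hI.top_lt
    have hsz : s.arr 13 (A.r y + 1) + 1 < 2 ^ Λ := by
      have h1 := (hR.bkt _ hq).1
      have h2 := length_le_sum A.bkt hq
      unfold Scan.pot at hpot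
      omega
    refine ⟨hok ((Program.Ok_branch_neg (hval.trans hpos)).2 ?_), A', ?_, hA', ?_, ?_⟩
    · simp only [visitProg, pushProg, Program.Ok, Program.eff, Term.val]
      simp [hs1, hR.r, hR.top]
      omega
    · have hL := hR.loaded
      constructor
      · refine ⟨?_, ?_, ?_, ?_, ?_, ?_⟩
        · simpa [visitProg, pushProg, Program.eff, hs1] using hL.reg_n
        · simpa [visitProg, pushProg, Program.eff, hs1] using hL.reg_m
        · intro i h
          simpa [visitProg, pushProg, Program.eff, hs1] using hL.src i h
        · intro i h
          simpa [visitProg, pushProg, Program.eff, hs1] using hL.dst i h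
        · intro i h
          by_cases hik : i = k
          · subst hik
            simp [visitProg, pushProg, Program.eff, Term.val, hs1, hA'def, hR.r]
            rw [show es[k] = e from hke, Function.update_self]
          · have hne : es[i] ≠ e := by
              rw [← hke]
              intro h'
              exact hik ((hes.1.of_map _).getElem_inj_iff.1 h')
            simp [visitProg, pushProg, Program.eff, Term.val, hs1, hA'def, hik,
              Function.update_of_ne hne, hL.lab i h]
        · intro v
          simpa [visitProg, pushProg, Program.eff, hs1] using hL.wt v
      · refine hR.adj.congr ?_ ?_ <;> funext i <;> simp [visitProg, pushProg, Program.eff, hs1]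
      · refine hR.bkt.push (x := y) hq rfl (fun c => ?_) (fun i => ?_)
        · simp [visitProg, pushProg, Program.eff, Term.val, hs1, hR.r]
        · simp [visitProg, pushProg, Program.eff, Term.val, hs1, hR.r, hL.reg_n]
      · intro v
        simpa [visitProg, pushProg, Program.eff, hs1] using hR.pos v
      · intro v
        by_cases hv : v = y
        · subst hv
          simp [visitProg, pushProg, Program.eff, Term.val, hs1, hA'def, hR.r]
        · have hv' : (v : ℕ) ≠ y := fun h => hv (Fin.ext h)
          simp [visitProg, pushProg, Program.eff, Term.val, hs1, hA'def, hR.r, hv', hv]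
      · simpa [visitProg, pushProg, Program.eff, hs1] using hR.cur
      · simp [visitProg, pushProg, Program.eff, hs1, hA'def]
      · simp [visitProg, pushProg, Program.eff, Term.val, hs1, hA'def, hR.r, hR.top]
        omega
      · simpa [visitProg, pushProg, Program.eff, hs1] using hR.count
    · have h1 := sum_length_update A.bkt hq (A.bkt (A.r y + 1) ++ [y])
      simp only [Scan.pot, hA'def, hrest, List.length_cons]
      rw [List.length_append, List.length_singleton] at h1
      omega
    · simp [visitProg, pushProg, Program.eff, hs1]
  · have hv : (Term.cell 15 (.reg 25)).val s1 ≠ 0 := by rw [hval]; exact hpos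
    rw [heff, Program.eff_branch_pos hv]
    have hL := hR.loaded
    refine ⟨hok ((Program.Ok_branch_pos hv).2 trivial),
      { A with rest := (incident es A.cur).drop (s.reg 21 + 1) },
      ⟨hL.congr ?_ ?_ rfl rfl rfl rfl, hR.adj.congr rfl rfl, hR.bkt, hR.pos, hR.r, ?_, ?_, ?_, ?_⟩,
      hI.skip hrest hy hpos, ?_, ?_⟩
    · simp [Program.eff, hs1]
    · simp [Program.eff, hs1]
    · simpa [Program.eff, hs1] using hR.cur
    · simp [Program.eff, hs1]
    · simpa [Program.eff, hs1] using hR.top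
    · simpa [Program.eff, hs1] using hR.count
    · simp only [Scan.pot, hrest, List.length_cons]
      omega
    · simp [Program.eff, hs1]

/-- Take a vertex from the top bucket. -/
def takeProg : Program :=
  .seq (.store 13 (.reg 22) (.sub (.cell 13 (.reg 22)) (.const 1)))
    (.assign 25 (.cell 14 (.add (.mul (.cell 13 (.reg 22)) (.reg 0)) (.reg 22))))

/-- Scan the vertex `reg 25`. -/
def enterProg : Program :=
  .seq (.assign 26 (.add (.reg 26) (.const 1)))
    (.seq (.store 15 (.reg 25) (.reg 26)) (.seq (.assign 20 (.reg 25)) (.assign 21 (.const 0))))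

/-- Process the top bucket. -/
def bucketProg : Program := .seq takeProg (.branch (.cell 15 (.reg 25)) .skip enterProg)

/-- Removing an entry frees one unit of potential. If the vertex gets scanned, its edges move from
the sum over unscanned vertices to the remaining edges, with the same factor 3. -/
theorem bucketProg_spec {Λ : ℕ} (hes : IsEdgeList G es) (hR : Rep s w es A) (hI : A.Inv G es)
    (hB : Bdd Λ s) (hrest : A.rest = []) (hne : A.bkt A.top ≠ []) :
    bucketProg.Ok Λ s ∧ ∃ A' : Scan n, Rep (bucketProg.eff s) w es A' ∧ A'.Inv G es ∧
      A'.pot es < A.pot es ∧ (bucketProg.eff s).reg 23 = s.reg 23 := by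
  obtain ⟨l, y, hl⟩ := (List.eq_nil_or_concat (A.bkt A.top)).resolve_left hne
  rw [List.concat_eq_append] at hl
  have hn := hB.1 0
  rw [hR.loaded.reg_n] at hn
  have hsz : s.arr 13 A.top < 2 ^ Λ := hB.2 13 _
  set s1 := (s.setCell 13 A.top (s.arr 13 A.top - 1)).setReg 25 y with hs1
  obtain ⟨hbkt, hy⟩ := hR.bkt.pop (sz' := s1.arr 13) hI.top_lt hl (fun c => by simp [hs1])
  unfold VertexNo at hy
  have htake : takeProg.eff s = s1 := by
    simp [takeProg, Program.eff, Term.val, hR.loaded.reg_n, hR.top, hy, hs1]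
  have htake_ok : takeProg.Ok Λ s := by
    simp [takeProg, Program.Ok, Program.eff, Term.val, hR.loaded.reg_n, hR.top, hy]
    omega
  have hval : (Term.cell 15 (.reg 25)).val s1 = A.pos y := by
    simp [Term.val, hs1, hR.pos]
  have heff : bucketProg.eff s = (Program.branch (.cell 15 (.reg 25)) .skip enterProg).eff s1 := by
    rw [← htake]; rfl
  have hok : (Program.branch (.cell 15 (.reg 25)) .skip enterProg).Ok Λ s1 → bucketProg.Ok Λ s :=
    fun h => ⟨htake_ok, by rw [htake]; exact h⟩
  have hsum := sum_length_update A.bkt hI.top_lt l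
  rw [hl, List.length_append, List.length_singleton] at hsum
  have hL := hR.loaded
  by_cases hpos : A.pos y = 0
  · rw [heff, Program.eff_branch_neg (hval.trans hpos)]
    have hA' := hI.scan hes hrest hl hpos
    set A' : Scan n := _ with hA'def
    change A'.Inv G es at hA'
    have hcount : A.count + 1 ≤ n := hA'.count_le
    refine ⟨hok ((Program.Ok_branch_neg (hval.trans hpos)).2 ?_), A', ?_, hA', ?_, ?_⟩
    · simp [enterProg, Program.Ok, Program.eff, Term.val, hs1, hR.count]
      omega
    · constructor
      · refine hL.congr ?_ ?_ ?_ ?_ ?_ ?_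
        · simp [enterProg, Program.eff, hs1]
        · simp [enterProg, Program.eff, hs1]
        all_goals funext i; simp [enterProg, Program.eff, hs1]
      · refine hR.adj.congr ?_ ?_ <;> funext i <;> simp [enterProg, Program.eff, hs1]
      · have e13 : (enterProg.eff s1).arr 13 = s1.arr 13 := by
          funext i; simp [enterProg, Program.eff]
        have e14 : (enterProg.eff s1).arr 14 = s.arr 14 := by
          funext i; simp [enterProg, Program.eff, hs1]
        rw [e13, e14]
        exact hbkt
      · intro v
        by_cases hv : v = y
        · subst hv
          simp [enterProg, Program.eff, Term.val, hs1, hA'def, hR.count]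
        · have hv' : (v : ℕ) ≠ y := fun h => hv (Fin.ext h)
          simp [enterProg, Program.eff, Term.val, hs1, hA'def, hR.pos, hv', hv]
      · intro v
        simpa [enterProg, Program.eff, hs1] using hR.r v
      · simp [enterProg, Program.eff, Term.val, hs1, hA'def]
      · simp [enterProg, Program.eff, Term.val, hA'def]
      · simpa [enterProg, Program.eff, hs1] using hR.top
      · simp [enterProg, Program.eff, Term.val, hs1, hA'def, hR.count]
    · have hfil : Finset.univ.filter (fun v => A.pos v = 0) =
          insert y (Finset.univ.filter fun v => A'.pos v = 0) := by
        ext v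
        simp only [Finset.mem_filter, Finset.mem_univ, true_and, Finset.mem_insert, hA'def]
        by_cases hv : v = y
        · simp [hv, hpos]
        · simp [hv]
      have hnot : y ∉ Finset.univ.filter fun v => A'.pos v = 0 := by
        simp [hA'def]
      simp only [Scan.pot]
      rw [hfil, Finset.sum_insert hnot, hrest, List.length_nil]
      have e1 : A'.rest = incident es y := rfl
      have e2 : A'.bkt = Function.update A.bkt A.top l := rfl
      have e3 : A'.top = A.top := rfl
      rw [e1, e2, e3]
      omega
    · simp [enterProg, Program.eff, hs1]
  · have hv : (Term.cell 15 (.reg 25)).val s1 ≠ 0 := by rw [hval]; exact hpos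
    rw [heff, Program.eff_branch_pos hv]
    refine ⟨hok ((Program.Ok_branch_pos hv).2 trivial),
      { A with bkt := Function.update A.bkt A.top l },
      ⟨hL.congr ?_ ?_ ?_ ?_ ?_ ?_, hR.adj.congr ?_ ?_, hbkt, ?_, ?_, ?_, ?_, ?_, ?_⟩,
      hI.discard hl hpos, ?_, ?_⟩
    · simp [Program.eff, hs1]
    · simp [Program.eff, hs1]
    · funext i; simp [Program.eff, hs1]
    · funext i; simp [Program.eff, hs1]
    · funext i; simp [Program.eff, hs1]
    · funext i; simp [Program.eff, hs1]
    · funext i; simp [Program.eff, hs1]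
    · funext i; simp [Program.eff, hs1]
    · intro v; simpa [Program.eff, hs1] using hR.pos v
    · intro v; simpa [Program.eff, hs1] using hR.r v
    · simpa [Program.eff, hs1] using hR.cur
    · simpa [Program.eff, hs1] using hR.rest
    · simpa [Program.eff, hs1] using hR.top
    · simpa [Program.eff, hs1] using hR.count
    · simp only [Scan.pot]
      omega
    · simp [Program.eff, hs1]

end ScanProgram

/-! ### The scan loop, its running time, and the vertices without earlier neighbours -/

section ScanLoop

variable {n : ℕ} {G : SimpleGraph (Fin n)} {w : Fin n → ℕ} {es : List (Fin n × Fin n)}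
  {A : Scan n} {s : State}

/-- One step of the scan; `reg 23` tells whether the scan is complete. -/
def scanStep : Program :=
  .branch (.lt (.reg 21) (.cell 11 (.reg 20))) edgeProg
    (.branch (.cell 13 (.reg 22)) bucketProg
      (.branch (.reg 22) (.assign 22 (.sub (.reg 22) (.const 1))) (.assign 23 (.const 1))))

/-- The invariant of the scan loop, where `M` bounds the number of remaining steps. -/
def Scanning (Λ : ℕ) (G : SimpleGraph (Fin n)) (w : Fin n → ℕ) (es : List (Fin n × Fin n)) (M : ℕ)
    (s : State) : Prop :=
  Bdd Λ s ∧ ∃ A : Scan n, Rep s w es A ∧ A.Inv G es ∧ A.pot es + (1 - s.reg 23) = M ∧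
    M < 2 ^ Λ ∧ (s.reg 23 ≠ 0 → A.rest = [] ∧ ∀ v, A.pos v ≠ 0)

/-- The bound has one unit beyond the potential, namely 1 minus the flag in register 23, to pay for
the step that raises the flag. -/
theorem hoare_scanStep {Λ M : ℕ} (hΛ : 1 ≤ Λ) (hes : IsEdgeList G es)
    (h : Scanning Λ G w es M s) (h23 : s.reg 23 = 0) :
    Hoare T O scanStep s (300 * Λ) (fun s' => ∃ M' < M, Scanning Λ G w es M' s') 1 := by
  obtain ⟨hB, A, hR, hI, rfl, hM, -⟩ := h
  rw [h23] at hM ⊢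
  have hcw : scanStep.cw * Λ ≤ 300 * Λ := Nat.mul_le_mul_right Λ (by decide)
  have fin : ∀ P : Program, (scanStep.Ok Λ s ↔ P.Ok Λ s) → scanStep.eff s = P.eff s →
      (P.Ok Λ s ∧ ∃ A' : Scan n, Rep (P.eff s) w es A' ∧ A'.Inv G es ∧
        A'.pot es < A.pot es ∧ (P.eff s).reg 23 = s.reg 23) →
      Hoare T O scanStep s (300 * Λ)
        (fun s' => ∃ M' < A.pot es + (1 - 0), Scanning Λ G w es M' s') 1 := by
    rintro P h1 h2 ⟨h3, A', h4, h5, h6, h7⟩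
    refine (Hoare.straight hΛ hB (h1.2 h3) fun hB' => ?_).mono hcw (fun _ h => h) le_rfl
    rw [h2] at hB' ⊢
    exact ⟨A'.pot es + 1, by omega, hB', A', h4, h5, by rw [h7, h23], by omega,
      fun h8 => (h8 (h7.trans h23)).elim⟩
  have hv1 : (Term.lt (.reg 21) (.cell 11 (.reg 20))).val s = 0 ↔ A.rest = [] := by
    rw [hR.rest, List.drop_eq_nil_iff, ← hR.adj.length]
    simp [Term.val, hR.cur]
  by_cases hrest : A.rest = []
  · have e1 := hv1.2 hrest
    have hv2 : (Term.cell 13 (.reg 22)).val s = (A.bkt A.top).length := by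
      rw [Term.val, Term.val, hR.top]
      exact (hR.bkt _ hI.top_lt).1
    by_cases hb : A.bkt A.top = []
    · have e2 : (Term.cell 13 (.reg 22)).val s = 0 := by rw [hv2, hb]; rfl
      have hv3 : (Term.reg 22).val s = A.top := hR.top
      by_cases htop : A.top = 0
      · have e3 := hv3.trans htop
        have heff : scanStep.eff s = s.setReg 23 1 :=
          (Program.eff_branch_neg e1).trans ((Program.eff_branch_neg e2).trans
            (Program.eff_branch_neg e3))
        refine (Hoare.straight hΛ hB ((Program.Ok_branch_neg e1).2 ((Program.Ok_branch_neg e2).2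
          ((Program.Ok_branch_neg e3).2 ?_))) fun hB' => ?_).mono hcw (fun _ h => h) le_rfl
        · exact Nat.one_lt_two_pow (by omega)
        · change Bdd Λ (scanStep.eff s) at hB'
          change ∃ M' < _, Scanning Λ G w es M' (scanStep.eff s)
          rw [heff] at hB' ⊢
          refine ⟨A.pot es, by omega, hB', A, ⟨hR.loaded.congr ?_ ?_ rfl rfl rfl rfl,
            hR.adj.congr rfl rfl, hR.bkt, hR.pos, hR.r, ?_, ?_, ?_, ?_⟩, hI, by simp, by omega,
            fun _ => ⟨hrest, hI.pos_ne_zero hb htop⟩⟩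
          · simp
          · simp
          · simpa using hR.cur
          · simpa using hR.rest
          · simpa using hR.top
          · simpa using hR.count
      · have e3 : (Term.reg 22).val s ≠ 0 := by rw [hv3]; exact htop
        refine fin (.assign 22 (.sub (.reg 22) (.const 1)))
          ((Program.Ok_branch_neg e1).trans ((Program.Ok_branch_neg e2).trans
            (Program.Ok_branch_pos e3)))
          ((Program.eff_branch_neg e1).trans ((Program.eff_branch_neg e2).trans
            (Program.eff_branch_pos e3))) ⟨?_, { A with top := A.top - 1 }, ⟨hR.loaded.congr ?_ ?_ rfl rfl rfl rfl,
            hR.adj.congr rfl rfl, hR.bkt, hR.pos, hR.r, ?_, ?_, ?_, ?_⟩, hI.lower hb, ?_, ?_⟩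
        · have := hB.1 22
          simp [Program.Ok, Term.val]
          omega
        · simp [Program.eff]
        · simp [Program.eff]
        · simpa [Program.eff] using hR.cur
        · simpa [Program.eff] using hR.rest
        · simp [Program.eff, Term.val, hR.top]
        · simpa [Program.eff] using hR.count
        · simp only [Scan.pot]
          omega
        · simp [Program.eff]
    · have e2 : (Term.cell 13 (.reg 22)).val s ≠ 0 := by
        rw [hv2]
        exact fun h => hb (List.length_eq_zero_iff.1 h)
      exact fin bucketProg ((Program.Ok_branch_neg e1).trans (Program.Ok_branch_pos e2))
        ((Program.eff_branch_neg e1).trans (Program.eff_branch_pos e2))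
        (bucketProg_spec hes hR hI hB hrest hb)
  · have e1 := fun h => hrest (hv1.1 h)
    exact fin edgeProg (Program.Ok_branch_pos e1) (Program.eff_branch_pos e1)
      (edgeProg_spec hes hR hI hB hM hrest)

/-- Run the scan. -/
def scanLoop : Program := .loop (.eq (.reg 23) (.const 0)) scanStep

theorem hoare_scanLoop {Λ M : ℕ} (hΛ : 1 ≤ Λ) (hes : IsEdgeList G es)
    (h : Scanning Λ G w es M s) :
    Hoare T O scanLoop s ((M + 1) * (310 * Λ)) (fun s' => Bdd Λ s' ∧ ∃ A : Scan n, Rep s' w es A ∧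
      A.Inv G es ∧ A.rest = [] ∧ ∀ v, A.pos v ≠ 0) 1 := by
  refine (Hoare.while (fun M s => Scanning Λ G w es M s) (ce := 9 * Λ) (t := 300 * Λ)
    (fun M s h => ?_) (fun M s h hv => hoare_scanStep hΛ hes h ?_) h).mono ?_ ?_ le_rfl
  · exact ((Term.eq (.reg 23) (.const 0)).cost_le hΛ h.1).trans
      (Nat.mul_le_mul_right Λ (by decide))
  · by_contra hc
    exact hv (by simp [Term.val, hc])
  · nlinarith
  · rintro s' ⟨h0, M', hB, A, hR, hI, -, -, hfin⟩
    have h23 : s'.reg 23 ≠ 0 := by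
      intro hc
      simp [Term.val, hc] at h0
    exact ⟨hB, A, hR, hI, (hfin h23).1, (hfin h23).2⟩

/-- Compute a maximum adjacency order and the edge labels. -/
def orderProg : Program :=
  .seq (forLoop 27 1 linkBody) (.seq fillProg (.seq (.assign 21 (.reg 1)) scanLoop))

theorem sum_length_incident (es : List (Fin n × Fin n)) :
    ∑ v : Fin n, (incident es v).length ≤ 2 * es.length := by
  induction es with
  | nil => simp [incident]
  | cons e es ih =>
    have h1 : ∀ v, (incident (e :: es) v).length ≤
        (incident es v).length + ((if e.1 = v then 1 else 0) + if e.2 = v then 1 else 0) := by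
      intro v
      unfold incident
      rw [List.filter_cons]
      by_cases h1 : e.1 = v <;> by_cases h2 : e.2 = v <;> simp [h1, h2]
    refine (Finset.sum_le_sum fun v _ => h1 v).trans ?_
    rw [Finset.sum_add_distrib, Finset.sum_add_distrib]
    simp
    omega

theorem hoare_orderProg {Λ : ℕ} (hΛ : 1 ≤ Λ) (hn : 0 < n) (hes : IsEdgeList G es)
    (hB : Bdd Λ (input es w)) (hbig : 6 * es.length + n + 1 < 2 ^ Λ) :
    Hoare T O orderProg (input es w) ((es.length + n + 1) * (2400 * Λ))
      (fun s' => (Bdd Λ s' ∧ ∃ A : Scan n, Rep s' w es A ∧ A.Inv G es ∧ A.rest = [] ∧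
        ∀ v, A.pos v ≠ 0) ∧ SameOff orderProg.wregs orderProg.warrs (input es w) s') 1 := by
  have hL := loaded_input es w
  refine Hoare.and_frame (Q := fun s' => Bdd Λ s' ∧ ∃ A : Scan n, Rep s' w es A ∧ A.Inv G es ∧
    A.rest = [] ∧ ∀ v, A.pos v ≠ 0) ?_
  refine ((hoare_linkLoop hΛ hB hL hes (fun _ => rfl) (by omega)).seq_one
    (t' := ((n + 1) * (100 * Λ) + 10 * Λ) + (10 * Λ + (6 * es.length + n + 1 + 1) * (310 * Λ)))
    ?_).mono ?_ (fun _ h => h) le_rfl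
  swap
  · have e : (es.length + 1) * (100 * Λ) + (((n + 1) * (100 * Λ) + 10 * Λ) +
        (10 * Λ + (6 * es.length + n + 1 + 1) * (310 * Λ))) =
        (1960 * es.length + 410 * n + 840) * Λ := by ring
    rw [e, ← mul_assoc]
    exact Nat.mul_le_mul_right Λ (by omega)
  rintro s1 ⟨hB1, hF1, hA1⟩
  have h13 : ∀ v, s1.arr 13 v = 0 := fun v => by rw [hF1.2 13 (by decide)]; rfl
  refine (hoare_fillProg hΛ hB1 ((hF1.1 0 (by decide)).trans hL.reg_n) h13).seq_one ?_
  rintro s2 ⟨hB2, hF2, hS2⟩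
  have hF : SameOff [27] [11, 12, 13, 14] (input es w) s2 :=
    (hF1.mono (by decide) (by decide)).trans (hF2.mono (by decide) (by decide))
  -- Initially vertex 0 counts as current although it is not scanned. Setting the edge pointer to m
  -- leaves it no remaining edges, so the scan begins with the buckets.
  have h3 := Hoare.straight' (T := T) (O := O) hΛ (.assign 21 (.reg 1)) hB2 (hB2.1 1)
  refine (h3.mono (t' := 10 * Λ) (Nat.mul_le_mul_right Λ (by decide)) (fun _ h => h)
    le_rfl).seq_one ?_
  rintro s3 ⟨rfl, hB3⟩
  have hreg : ∀ x, x ≠ 21 → x ≠ 27 →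
      ((Program.assign 21 (.reg 1)).eff s2).reg x = (input es w).reg x := by
    intro x h1 h2
    simpa [Program.eff, h1] using hF.1 x (by simpa using h2)
  have hsum := sum_length_incident es
  have hm : s2.reg 1 = es.length := (hF.1 1 (by decide)).trans hL.reg_m
  have harr : ∀ a, a ∉ [11, 12, 13, 14] →
      ((Program.assign 21 (.reg 1)).eff s2).arr a = (input es w).arr a := fun a ha => hF.2 a ha
  -- At the start every edge counts 3 at each of its two ends, and bucket 0 has n entries.
  have hpot : (Scan.start hn).pot es + (1 - 0) ≤ 6 * es.length + n + 1 := by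
    have : ∑ b ∈ Finset.range n, ((if b = 0 then List.finRange n else [] : List (Fin n))).length ≤
        n := by
      refine (Finset.sum_le_sum (g := fun b => if b = 0 then n else 0) fun b _ => ?_).trans ?_
      · split_ifs <;> simp
      · rw [Finset.sum_ite_eq']
        split_ifs <;> simp
    simp only [Scan.pot, Scan.start, Finset.filter_true, List.length_nil]
    omega
  refine (hoare_scanLoop hΛ hes (M := (Scan.start hn).pot es + (1 - 0)) ⟨hB3, Scan.start hn,
    ⟨?_, ?_, hS2, fun v => ?_, fun v => ?_, ?_, ?_, ?_, ?_⟩, Scan.start_inv hn, ?_, ?_, ?_⟩).mono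
      (Nat.mul_le_mul_right _ (by omega)) (fun _ h => h) le_rfl
  · exact hL.congr (hreg 0 (by decide) (by decide)) (hreg 1 (by decide) (by decide))
      (harr 0 (by decide)) (harr 1 (by decide)) (harr 2 (by decide)) (harr 10 (by decide))
  · exact hA1.congr (hF2.2 11 (by decide)) (hF2.2 12 (by decide))
  · rw [harr 15 (by decide)]; rfl
  · rw [harr 16 (by decide)]; rfl
  · exact hreg 20 (by decide) (by decide)
  · have : ((Program.assign 21 (.reg 1)).eff s2).reg 21 = es.length := by
      simpa [Program.eff, Term.val] using hm
    rw [this]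
    exact (List.drop_eq_nil_of_le (List.length_filter_le _ _)).symm
  · exact hreg 22 (by decide) (by decide)
  · exact hreg 26 (by decide) (by decide)
  · rw [hreg 23 (by decide) (by decide)]; rfl
  · omega
  · intro h
    exact (h (hreg 23 (by decide) (by decide))).elim

/-- Count the vertices without earlier neighbours. -/
def rootProg : Program :=
  .seq (.assign 29 (.const 0))
    (forLoop 27 0 (.assign 29 (.add (.reg 29) (.eq (.cell 16 (.reg 27)) (.const 0)))))

theorem hoare_rootProg {Λ : ℕ} (hΛ : 1 ≤ Λ) (hB : Bdd Λ s) (h0 : s.reg 0 = n) {r : Fin n → ℕ}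
    (hr : ∀ v : Fin n, s.arr 16 v = r v) :
    Hoare T O rootProg s (10 * Λ + (n + 1) * (100 * Λ))
      (fun s' => Bdd Λ s' ∧ SameOff [29, 27] [] s s' ∧
        s'.reg 29 = (Finset.univ.filter fun v => r v = 0).card) 1 := by
  have hn := hB.1 0
  rw [h0] at hn
  have h1 := Hoare.straight' (T := T) (O := O) hΛ (.assign 29 (.const 0)) hB
    (by simp [Program.Ok, Term.val])
  refine (h1.mono (t' := 10 * Λ) (Nat.mul_le_mul_right Λ (by decide)) (fun _ h => h)
    le_rfl).seq_one ?_
  rintro s1 ⟨rfl, hB1⟩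
  have hsum : ∑ i ∈ Finset.range n, (if s.arr 16 i = 0 then 1 else 0) =
      (Finset.univ.filter fun v => r v = 0).card := by
    rw [Finset.sum_range, Finset.card_filter]
    exact Finset.sum_congr rfl fun v _ => by rw [hr v]
  refine (Hoare.forLoop_one hΛ
    (t := (Program.assign 29 (.add (.reg 29) (.eq (.cell 16 (.reg 27)) (.const 0)))).cw * Λ)
    (N := n) (fun k s' => s'.reg 29 = ∑ i ∈ Finset.range k, if s.arr 16 i = 0 then 1 else 0)
    hB1 (by exact h0) (by decide) (by decide) (by decide) ?_ ?_).mono (loop_time_le (by decide)) ?_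
      le_rfl
  · simp [Program.eff, Term.val]
  · intro k hk s' hks hBs hF hI
    have e16 : s'.arr 16 k = s.arr 16 k := by rw [hF.2 16 (by decide)]; rfl
    have hle : ∑ i ∈ Finset.range (k + 1), (if s.arr 16 i = 0 then 1 else 0) ≤ n := by
      refine (Finset.sum_le_card_nsmul _ _ 1 fun i _ => by split_ifs <;> omega).trans ?_
      simpa using hk
    rw [Finset.sum_range_succ] at hle
    refine Hoare.straight hΛ hBs ?_ fun hB' => ⟨hB', ?_⟩
    · simp only [Program.Ok, Term.val, hks, hI, e16]
      omega
    · rw [Finset.sum_range_succ]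
      simp [Program.eff, Term.val, hks, hI, e16]
  · rintro s' ⟨h1, h2, h3⟩
    refine ⟨h1, ⟨fun x hx => ?_, fun a ha => h2.2 a (by simp [Program.warrs])⟩, h3.trans hsum⟩
    simp only [List.mem_cons, not_or] at hx
    rw [h2.1 x (by simp [Program.wregs, hx.1, hx.2.1])]
    simp [Program.eff, hx.1]

end ScanLoop

/-! ### Unweighted graphs -/

section Unweighted

variable {n : ℕ} {G : SimpleGraph (Fin n)} {es : List (Fin n × Fin n)} {κ : ℕ}

/-- A connected graph on n vertices has at least n - 1 edges. -/
theorem IsEdgeList.isVertexCut_empty (hes : IsEdgeList G es) (h : es.length + 1 < n) :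
    IsVertexCut G ∅ := by
  classical
  intro hpre
  have hconn : G.Preconnected := fun u v =>
    (hpre ⟨u, by simp⟩ ⟨v, by simp⟩).map (SimpleGraph.Embedding.induce _).toHom
  have : Nonempty (Fin n) := ⟨⟨0, by omega⟩⟩
  have h1 := (SimpleGraph.Connected.mk hconn).card_vert_le_card_edgeSet_add_one
  have h2 : G.edgeSet = ((es.map fun e => s(e.1, e.2)).toFinset : Set (Sym2 (Fin n))) := by
    ext e
    rw [← hes.2 e]
    simp
  have h3 := List.toFinset_card_le (es.map fun e => s(e.1, e.2))
  rw [h2] at h1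
  simp only [Nat.card_eq_fintype_card, Fintype.card_fin, Finset.coe_sort_coe, Fintype.card_coe] at h1
  rw [List.length_map] at h3
  omega

/-- In a disconnected graph the empty set is a minimum cut, and an empty output list already
represents it. -/
theorem solved_empty {w : Fin n → ℕ} (hκ : IsVertexConnectivity G w κ) (hcut : IsVertexCut G ∅)
    {s : State} (h2 : s.reg 2 = 0) : Solved G w κ s := by
  refine ⟨∅, ?_, hcut, by simp [State.output, h2]⟩
  have : κ ≤ weight w ∅ := hκ.2 ⟨∅, hcut, rfl⟩
  simp only [weight, Finset.sum_empty] at this ⊢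
  omega

/-- Compute a minimum vertex cut of an unweighted graph. -/
def unweightedProg (c : ℕ) : Program :=
  .branch (.lt (.add (.reg 1) (.const 1)) (.reg 0)) .skip
    (.seq orderProg (.seq rootProg (.branch (.lt (.const 1) (.reg 29)) .skip (searchProg c))))

/-- The time that the preparation of the search takes. -/
def prepTime (Λ m n : ℕ) : ℕ := (m + n + 1) * (2600 * Λ)

/-- The search on an unweighted graph, given a bound `τ` on the time that is left after the
preparation. -/
theorem hoare_unweightedProg {Λ τ c : ℕ} {p : ℝ≥0∞} (hΛ : 1 ≤ Λ) (hes : IsEdgeList G es)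
    (hκ : IsVertexConnectivity G (fun _ => 1) κ) (hB : Bdd Λ (input es fun _ => 1))
    (hbig : 6 * es.length + n + 1 < 2 ^ Λ) (hp : p ≤ 1)
    (hsearch : n ≤ es.length + 1 → 1 ≤ κ → ∀ (ℓ : Fin n × Fin n → ℕ),
      (∀ K S, weight (fun _ => 1) S < K → IsVertexCut (ofList (lowEdges es ℓ K)) S →
        IsVertexCut G S) → (∀ K, (lowEdges es ℓ K).length ≤ n * K) →
      ∀ s, Bdd Λ s → Loaded s (fun _ => 1) es ℓ → s.reg 17 = 0 →
        Hoare T O (searchProg c) s τ (Solved G (fun _ => 1) κ) p) :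
    Hoare T O (unweightedProg c) (input es fun _ => 1)
      (if n ≤ es.length + 1 then prepTime Λ es.length n + τ else 30 * Λ)
      (Solved G (fun _ => 1) κ) p := by
  have hL := loaded_input es fun _ => 1
  have hcost : ∀ s, Bdd Λ s → 1 + (Term.lt (.add (.reg 1) (.const 1)) (.reg 0)).cost s ≤ 20 * Λ := by
    intro s hs
    have h1 := (Term.lt (.add (.reg 1) (.const 1)) (.reg 0)).cost_le hΛ hs
    have h2 := Nat.mul_le_mul_right Λ
      (show (Term.lt (.add (.reg 1) (.const 1)) (.reg 0)).cw ≤ 19 by decide)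
    omega
  have hcost' : ∀ s, Bdd Λ s → 1 + (Term.lt (.const 1) (.reg 29)).cost s ≤ 20 * Λ := by
    intro s hs
    have h1 := (Term.lt (.const 1) (.reg 29)).cost_le hΛ hs
    have h2 := Nat.mul_le_mul_right Λ (show (Term.lt (.const 1) (.reg 29)).cw ≤ 19 by decide)
    omega
  have hguard : (Term.lt (.add (.reg 1) (.const 1)) (.reg 0)).val (input es fun _ => 1) = 0 ↔
      n ≤ es.length + 1 := by
    simp [Term.val, hL.reg_n, hL.reg_m]
  by_cases hn : n ≤ es.length + 1
  swap
  -- Here n may be far larger than 1 + m, so the program must stop before any work linear in n.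
  · rw [if_neg hn]
    refine (Hoare.branch_pos (fun h => hn (hguard.1 h)) (Hoare.skip
      (solved_empty hκ (hes.isVertexCut_empty (by omega)) rfl))).mono ?_ (fun _ h => h) hp
    have := hcost _ hB
    omega
  rw [if_pos hn]
  have hn0 : 0 < n := by
    have := hκ.lt_weight fun _ => le_rfl
    simp only [weight, Finset.sum_const, Finset.card_univ, Fintype.card_fin, smul_eq_mul,
      mul_one] at this
    omega
  refine (Hoare.branch_neg (hguard.2 hn) ((hoare_orderProg hΛ hn0 hes hB hbig).seq_one
    (t' := (10 * Λ + (n + 1) * (100 * Λ)) + (20 * Λ + (1 + τ))) ?_)).mono ?_ (fun _ h => h) le_rfl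
  swap
  · have h1 := hcost _ hB
    have h2 : (n + 1) * (100 * Λ) ≤ (es.length + n + 1) * (100 * Λ) :=
      Nat.mul_le_mul_right _ (by omega)
    have h3 : prepTime Λ es.length n = (es.length + n + 1) * (2400 * Λ) +
      (es.length + n + 1) * (100 * Λ) + (es.length + n + 1) * (100 * Λ) := by unfold prepTime; ring
    have h4 : 100 * Λ ≤ (es.length + n + 1) * (100 * Λ) := Nat.le_mul_of_pos_left _ (by omega)
    omega
  rintro s1 ⟨⟨hB1, A, hR, hI, hrest, hpos⟩, hF1⟩
  have hord := hI.isMaxAdjOrder hrest hpos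
  refine (hoare_rootProg hΛ hB1 hR.loaded.reg_n hR.r).seq_one ?_
  rintro s2 ⟨hB2, hF2, h29⟩
  have hroot : ∀ v, A.r v = 0 ↔ backNbrs G A.pos (A.pos v) v = ∅ := fun v => by
    rw [hI.r_scanned v (hpos v), Finset.card_eq_zero]
  have hreg : ∀ x, x ∉ [29, 27] ++ orderProg.wregs → s2.reg x = (input es fun _ => 1).reg x := by
    intro x hx
    rw [List.mem_append, not_or] at hx
    rw [hF2.1 x hx.1, hF1.1 x hx.2]
  by_cases hcount : 1 < s2.reg 29
  · have hcut : IsVertexCut G ∅ := by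
      rw [h29, Finset.one_lt_card] at hcount
      obtain ⟨u, hu, v, hv, huv⟩ := hcount
      exact hord.isVertexCut_empty huv ((hroot u).1 (by simpa using hu))
        ((hroot v).1 (by simpa using hv))
    refine (Hoare.branch_pos (by simp [Term.val, hcount]) (Hoare.skip
      (solved_empty hκ hcut (hreg 2 (by decide))))).mono ?_ (fun _ h => h) hp
    have := hcost' s2 hB2
    omega
  -- A disconnected graph has a vertex without earlier neighbours on each side, so a single one
  -- means κ ≥ 1. Only now may the search start, as its time bound contains max(κ, 1) in place of κ.
  · have hκ1 : 1 ≤ κ := by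
      by_contra hc
      obtain rfl : κ = 0 := by omega
      obtain ⟨S, hS, hS0⟩ := hκ.1
      have : S = ∅ := by simpa [weight] using hS0
      subst this
      obtain ⟨u, v, huv, hu, hv⟩ := exists_roots A.pos hS
      refine hcount ?_
      rw [h29, Finset.one_lt_card]
      exact ⟨u, by simpa using (hroot u).2 hu, v, by simpa using (hroot v).2 hv, huv⟩
    have h := hsearch hn hκ1 A.lab
      (fun K S hS hcut => hord.certificate hes (by simpa [weight] using hS) hcut)
      (hord.length_lowEdges_le hes) s2 hB2
      (hR.loaded.congr (hF2.1 0 (by decide)) (hF2.1 1 (by decide)) (hF2.2 0 (by decide))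
        (hF2.2 1 (by decide)) (hF2.2 2 (by decide)) (hF2.2 10 (by decide)))
      (hreg 17 (by decide))
    refine (Hoare.branch_neg (by simp [Term.val, hcount]) h).mono ?_ (fun _ h => h) le_rfl
    have := hcost' s2 hB2
    omega

theorem prepTime_le {c N : ℕ} (hN : 1 ≤ N) (m n : ℕ) :
    (prepTime (wordSize c N) m n : ℝ) ≤
      searchConst c * (1 + Real.log N) ^ 3 * (m + n + 1) := by
  have h1 := wordSize_le c hN
  set a : ℝ := 2 * (Nat.size (c + 1) + 30) with ha
  have ha60 : 60 ≤ a := by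
    have : (0 : ℝ) ≤ Nat.size (c + 1) := by positivity
    rw [ha]; linarith
  have hl : 0 ≤ Real.log N := Real.log_natCast_nonneg N
  have h2 : 1 ≤ a * (1 + Real.log N) := by nlinarith
  have h3 : a * (1 + Real.log N) ≤ (a * (1 + Real.log N)) ^ 3 := le_self_pow₀ h2 (by norm_num)
  have h4 : (0 : ℝ) ≤ c := by positivity
  have h5 : 2600 * (wordSize c N : ℝ) ≤ searchConst c * (1 + Real.log N) ^ 3 := by
    have e : searchConst c * (1 + Real.log N) ^ 3 =
        2 * 10 ^ 7 * (c + 1) * (a * (1 + Real.log N)) ^ 3 := by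
      rw [searchConst, mul_pow, ha]; ring
    rw [e]
    have h6 : (2600 : ℝ) ≤ 2 * 10 ^ 7 * (c + 1) := by linarith
    exact mul_le_mul h6 (h1.trans h3) (by positivity) (by positivity)
  have e : (prepTime (wordSize c N) m n : ℝ) = 2600 * (wordSize c N : ℝ) * (m + n + 1) := by
    unfold prepTime
    push_cast
    ring
  rw [e]
  exact mul_le_mul_of_nonneg_right h5 (by positivity)

/-- The unweighted case. -/
theorem unweighted_vertexCut (c D : ℕ) (hT : ∀ m n, m + n ≤ T m n)
    (hmono : ∀ n, Monotone fun m => T m n) (hD : ∀ m n, T (2 * m) n ≤ D * T m n)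
    (hO : SolvesIsolatingCut 1 O) (hes : IsEdgeList G es)
    (hκ : IsVertexConnectivity G (fun _ => 1) κ) {B : ℕ}
    (hB : searchConst c * (4 + 4 * D ^ 2) * (1 + Real.log n) ^ 3 *
      (1 + es.length + κ * T (n * κ) n * min (κ : ℝ) ((n : ℝ) / ((n : ℝ) - κ))) ≤ B) :
    ENNReal.ofReal (1 - 1 / (n : ℝ) ^ c) ≤
      successProb T O (unweightedProg c) G es (fun _ => 1) B := by
  have hW : weight (fun _ : Fin n => 1) Finset.univ = n := by simp [weight]
  have hpos := hκ.lt_weight fun _ => le_rfl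
  rw [hW] at hpos
  have hN : 1 ≤ n * 1 := by omega
  have hσ : 1 ≤ Nat.size (n * 1) := Nat.size_pos.2 hN
  have hΛ : 1 ≤ wordSize c (n * 1) := by unfold wordSize; nlinarith
  have hbig : 6 * es.length + n + 1 < 2 ^ wordSize c (n * 1) := by
    have h1 := pow_four_lt_wordSize (c := c) hN
    have h2 := hes.length_le
    have h3 : n * n ≤ (n * 1) ^ 4 := by
      rw [mul_one, ← sq]; exact Nat.pow_le_pow_right (by omega) (by norm_num)
    have h4 : n ≤ n * n := Nat.le_mul_of_pos_left _ (by omega)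
    omega
  have hBdd := bdd_input_wordSize (w := fun _ => 1) c hes hN fun _ => le_rfl
  have hn1 : (1 : ℝ) ≤ n := by exact_mod_cast (by omega : 1 ≤ n)
  have hl : 0 ≤ Real.log n := Real.log_natCast_nonneg n
  have hsc : 0 ≤ searchConst c := by unfold searchConst; positivity
  set E : ℝ := searchConst c * (1 + Real.log n) ^ 3 with hE
  have hE0 : 0 ≤ E := by positivity
  have hprep := prepTime_le (c := c) hN es.length n
  rw [mul_one, ← hE] at hprep
  rw [mul_one] at hΛ hbig hBdd
  have hm0 : (0 : ℝ) ≤ es.length := by positivity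
  have hD0 : (0 : ℝ) ≤ (D : ℝ) ^ 2 := by positivity
  have hκn : (0 : ℝ) < (n : ℝ) - κ := by
    have : (κ : ℝ) < n := by exact_mod_cast (by omega : κ < n)
    linarith
  set Y : ℝ := κ * T (n * κ) n * min (κ : ℝ) ((n : ℝ) / ((n : ℝ) - κ)) with hY
  have hY0 : 0 ≤ Y := by positivity
  have hB' : E * ((4 + 4 * D ^ 2) * (1 + es.length + Y)) ≤ B := by
    refine le_trans (le_of_eq ?_) hB
    rw [hE]; ring
  have hp1 : ENNReal.ofReal (1 - 1 / (n : ℝ) ^ c) ≤ 1 := by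
    rw [ENNReal.ofReal_le_one]
    have : (0 : ℝ) ≤ 1 / (n : ℝ) ^ c := by positivity
    linarith
  refine (hoare_unweightedProg (c := c) (τ := B - prepTime (wordSize c n) es.length n) hΛ hes hκ
    hBdd hbig hp1 ?_).le_successProb hκ ?_
  · intro hnm hκ1 ℓ hcert hlow s hs hLs h17
    obtain ⟨τ, Xs, hX, hτ, h⟩ := search_spec (T := T) (O := O) (ℓ := ℓ) (U := 1)
      -- A stage uses K ≤ 4κ, hence at most 4nκ edges; two doublings cost the factor D².
      (Tm := D ^ 2 * T (n * κ) n) c hes (fun _ => ⟨le_rfl, le_rfl⟩) hκ hcert hO hT (fun K hK => by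
        have hκmax : max κ 1 = κ := max_eq_left hκ1
        rw [hκmax] at hK
        have h1 : (lowEdges es ℓ K).length ≤ 2 * (2 * (n * κ)) := by
          refine (hlow K).trans ((Nat.mul_le_mul_left n hK).trans (le_of_eq ?_))
          ring
        calc T (lowEdges es ℓ K).length n ≤ T (2 * (2 * (n * κ))) n := hmono n h1
          _ ≤ D * T (2 * (n * κ)) n := hD _ _
          _ ≤ D * (D * T (n * κ) n) := Nat.mul_le_mul_left _ (hD _ _)
          _ = _ := by ring)
    rw [mul_one] at h
    refine (h s hs hLs h17).mono ?_ (fun _ h => h) le_rfl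
    rw [hW] at hX
    rw [Nat.cast_one, mul_one, ← hE] at hτ
    have hρ : rounds n κ * T (n * κ) n = Y := by
      rw [hY, rounds, max_eq_left hκ1]; ring
    have hTk : (1 : ℝ) ≤ T (n * κ) n := by
      have := hT (n * κ) n
      exact_mod_cast (by omega : 1 ≤ T (n * κ) n)
    have hnm' : (n : ℝ) ≤ es.length + 1 := by exact_mod_cast hnm
    -- The calls contribute at most 2(D² + 1)Y because Xs is at most twice `rounds`. The two linear
    -- terms give at most 4(m + 1), since n ≤ m + 1.
    have key : ((es.length + n + 1 : ℕ) + (Xs * (D ^ 2 * T (n * κ) n + 1) : ℕ) : ℝ) +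
        (es.length + n + 1) ≤ (4 + 4 * D ^ 2) * (1 + es.length + Y) := by
      have h1 : (Xs : ℝ) * (D ^ 2 * T (n * κ) n + 1) ≤
          2 * rounds n κ * ((D ^ 2 + 1) * T (n * κ) n) := by
        refine mul_le_mul hX ?_ (by positivity) ?_
        · nlinarith
        · have : (0 : ℝ) ≤ Xs := by positivity
          linarith
      have h2 : 2 * rounds n κ * ((D ^ 2 + 1) * T (n * κ) n) = (2 * D ^ 2 + 2) * Y := by
        rw [← hρ]; ring
      push_cast
      nlinarith [mul_nonneg hD0 hY0, mul_nonneg hD0 hm0]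
    have hsum : ((τ + prepTime (wordSize c n) es.length n : ℕ) : ℝ) ≤ B := by
      rw [Nat.cast_add]
      calc (τ : ℝ) + prepTime (wordSize c n) es.length n ≤ _ := add_le_add hτ hprep
        _ = E * (((es.length + n + 1 : ℕ) + (Xs * (D ^ 2 * T (n * κ) n + 1) : ℕ) : ℝ) +
            (es.length + n + 1)) := by ring
        _ ≤ E * ((4 + 4 * D ^ 2) * (1 + es.length + Y)) := mul_le_mul_of_nonneg_left key hE0
        _ ≤ B := hB'
    have : τ + prepTime (wordSize c n) es.length n ≤ B := by exact_mod_cast hsum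
    omega
  · split_ifs with hnm
    · have hnm' : (n : ℝ) ≤ es.length + 1 := by exact_mod_cast hnm
      have : (prepTime (wordSize c n) es.length n : ℝ) ≤ B := by
        refine hprep.trans (le_trans (mul_le_mul_of_nonneg_left ?_ hE0) hB')
        nlinarith [mul_nonneg hD0 hY0, mul_nonneg hD0 hm0]
      have : prepTime (wordSize c n) es.length n ≤ B := by exact_mod_cast this
      omega
    -- Only the initial test is executed in this case, and its cost of one word operation is covered
    -- by the summand 1 of the time bound.
    · have h0 := prepTime_le (c := c) (N := n) (by omega) 0 0
      rw [← hE] at h0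
      have h1 : 30 * wordSize c n ≤ prepTime (wordSize c n) 0 0 := by unfold prepTime; omega
      have h2 : (prepTime (wordSize c n) 0 0 : ℝ) ≤ B := by
        refine h0.trans (le_trans (mul_le_mul_of_nonneg_left ?_ hE0) hB')
        push_cast
        nlinarith [mul_nonneg hD0 hY0, mul_nonneg hD0 hm0]
      have : prepTime (wordSize c n) 0 0 ≤ B := by exact_mod_cast h2
      omega

end Unweighted

end VertexCut

theorem mainTheorem8 :
    -- integer weights between `1` and `U`, total weight `W = weight w univ`
    (∀ c : ℕ, ∃ (P : Program) (a : ℕ) (C : ℝ),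
      ∀ (T : ℕ → ℕ → ℕ) (U : ℕ) (O : Subroutine),
        (∀ m n, m + n ≤ T m n) → SolvesIsolatingCut U O →
        ∀ (n : ℕ) (G : SimpleGraph (Fin n)) (es : List (Fin n × Fin n)) (w : Fin n → ℕ) (κ : ℕ),
          IsEdgeList G es → (∀ v, 1 ≤ w v ∧ w v ≤ U) → IsVertexConnectivity G w κ →
          ∀ B : ℕ,
            C * (1 + Real.log (n * U)) ^ a *
              ((max κ 1 : ℕ) * T es.length n *
                min ((max κ 1 : ℕ) : ℝ)
                  ((weight w Finset.univ : ℝ) / ((weight w Finset.univ : ℝ) - κ))) ≤ B →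
            ENNReal.ofReal (1 - 1 / (n : ℝ) ^ c) ≤ successProb T O P G es w B) ∧
    -- simple unweighted graphs
    (∀ c : ℕ, ∃ (P : Program) (a : ℕ), ∀ D : ℕ, ∃ C : ℝ,
      ∀ (T : ℕ → ℕ → ℕ) (O : Subroutine),
        (∀ m n, m + n ≤ T m n) → (∀ n, Monotone fun m => T m n) →
        (∀ m n, T (2 * m) n ≤ D * T m n) → SolvesIsolatingCut 1 O →
        ∀ (n : ℕ) (G : SimpleGraph (Fin n)) (es : List (Fin n × Fin n)) (κ : ℕ),
          IsEdgeList G es → IsVertexConnectivity G (fun _ => 1) κ →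
          ∀ B : ℕ,
            C * (1 + Real.log n) ^ a *
              (1 + es.length + κ * T (n * κ) n * min (κ : ℝ) ((n : ℝ) / ((n : ℝ) - κ))) ≤ B →
            ENNReal.ofReal (1 - 1 / (n : ℝ) ^ c) ≤ successProb T O P G es (fun _ => 1) B) := by
  refine ⟨fun c => ⟨searchProg c, 3, 6 * searchConst c, ?_⟩, fun c => ⟨unweightedProg c, 3, ?_⟩⟩
  · intro T U O hT hO n G es w κ hes hw hκ B hB
    exact weighted_vertexCut c hT hO hes hw hκ hB
  · intro D
    refine ⟨searchConst c * (4 + 4 * D ^ 2), ?_⟩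
    intro T O hT hmono hD hO n G es κ hes hκ B hB
    exact unweighted_vertexCut c D hT hmono hD hO hes hκ hB
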